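/- **Setting.** Let $\mathsf{k},\mathsf h,\mathsf h'$ be complex Hilbert spaces (inner products linear in the second argument), let $\hat{\mathsf k}=\mathbb C\oplus\mathsf k$ and $\hat c=(1,c)$ for $c\in\mathsf k$; for a subspace $D$ of $\mathsf k$ let $\hat D=\operatorname{Lin}\{\hat c:c\in D\}$. Let $\mathcal F$ be the symmetric Fock space over $L^2(\mathbb R_+;\mathsf k)$, with exponential vectors $\varepsilon(f)=((n!)^{-1/2}f^{\otimes n})_{n\ge0}$. For a dense subspace $D$ of $\mathsf k$ let $\mathbb S_D$ be the linear span of the functions $d\,1_{[0,t[}$ ($d\in D$, $t\ge 0$) and $\mathcal E_D=\operatorname{Lin}\{\varepsilon(g):g\in\mathbb S_D\}$; put $\mathbb S=\mathbb S_{\mathsf k}$, $\mathcal E=\mathcal E_{\mathsf k}$. An exponential domain in $\mathsf h\otimes\mathcal F$ is a subspace $E\,\underline\otimes\,\mathcal E_D$ (algebraic tensor product) with $E$ dense in $\mathsf h$ and $D$ dense in $\mathsf k$; we write $v\varepsilon(g)=v\otimes\varepsilon(g)$. For a vector $\zeta$ of a Hilbert space let $E_\zeta=I\otimes|\zeta\rangle$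 and $E^\zeta=I\otimes\langle\zeta|$. A process with domain $\mathcal D=E\,\underline\otimes\,\mathcal E_D$ is a family $X=(X_t)_{t\ge0}$ of linear operators $\mathcal D\to\mathsf h'\otimes\mathcal F$ such that every $t\mapsto\langle\xi',X_t\xi\rangle$ is measurable and $\langle u'\varepsilon(g'),X_tu\varepsilon(g)\rangle=\langle u'\varepsilon(g'1_{[0,t[}),X_tu\varepsilon(g1_{[0,t[})\rangle\,\langle\varepsilon(g'1_{[t,\infty[}),\varepsilon(g1_{[t,\infty[})\rangle$ for all $u\in E$, $g\in\mathbb S_D$, $u'\in\mathsf h'$, $g'\in\mathbb S$. In the same way, with $\mathsf h\otimes\hat{\mathsf k}$ and $\mathsf h'\otimes\hat{\mathsf k}$ as initial spaces, one has processes $F$ with domain $E\,\underline\otimes\,\hat D\,\underline\otimes\,\mathcal E_D$ and values in $\mathsf h'\otimes\hat{\mathsf k}\otimes\mathcal F$. Such an $F$ is quantum stochastically integrable if every $s\mapsto F_s(v\otimes\hat g(s)\otimes\varepsilon(g))$ ($v\in E$, $g\in\mathbb S_D$, $\hat g(s)=\widehat{g(s)}$) is strongly measurable and locally square integrable; $\int_0^tF_s\,d\Lambda_s$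 then maps $v\varepsilon(g)$ to the sum of the time integral over $[0,t]$ of the component of this function along $(1,0)\in\hat{\mathsf k}$ and the Hitsuda–Skorohod integral over $[0,t]$ of its component in $\mathsf h'\otimes\mathsf k\otimes\mathcal F$ (the Hitsuda–Skorohod integral being the adjoint of the gradient $v'\varepsilon(g')\mapsto(s\mapsto v'\otimes g'(s)\otimes\varepsilon(g'))$, $v'\in\mathsf h'$, $g'\in\mathbb S$). Let $\mathsf V$ be a (complete) operator space and $\mathsf Y$ a norm closed subspace of $B(\mathsf h;\mathsf h')$. A linear map between operator spaces is called $\mathsf k$-bounded if it is bounded, when $\dim\mathsf k<\infty$, or completely bounded, when $\dim\mathsf k=\infty$; the space $\mathsf k\text{-}B(\cdot\,;\cdot)$ of such maps carries the operator norm or the cb-norm accordingly. Let $\mathsf Y\otimes_{\mathrm M}|\mathcal F\rangle=\{T\in B(\mathsf h;\mathsf h'\otimes\mathcal F):E^\chi T\in\mathsf Y\text{ for all }\chi\in\mathcal F\}$. Fix a dense subspace $D$ of $\mathsf k$, put $\mathcal D=\mathsf h\,\underline\otimes\,\mathcal E_D$, and let $$\phi\in L\big(\hat D;\mathsf k\text{-}B(\mathsf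 V;CB(\langle\hat{\mathsf k}|;\mathsf V))\big),\qquad \kappa\in\mathsf k\text{-}B(\mathsf V;\mathsf Y),$$ where $\langle\hat{\mathsf k}|=B(\hat{\mathsf k};\mathbb C)$; write $\phi_{|\zeta\rangle}$ for the value of $\phi$ at $\zeta\in\hat D$ and $\phi^{\zeta'}_\zeta(x)=\phi_{|\zeta\rangle}(x)\langle\zeta'|$ for $\zeta'\in\hat{\mathsf k}$. Consider the quantum stochastic differential equation $$dk_t=k_t\bullet d\Lambda_\phi(t),\qquad k_0=\iota\circ\kappa.\tag{$*$}$$ For families $k,j$ of linear processes on $\mathsf V$ with domain $\mathcal D$ we write $j_t=\int_0^tk_s\bullet d\Lambda_\phi(s)$ if there is a family $K(x)$, linear in $x\in\mathsf V$, of quantum stochastically integrable processes with domain $\mathsf h\,\underline\otimes\,\hat D\,\underline\otimes\,\mathcal E_D$ such that $E^{\zeta'}K_t(x)E_\zeta=k_t(\phi^{\zeta'}_\zeta(x))$ and $j_t(x)=\int_0^tK_s(x)\,d\Lambda_s$ for all $\zeta'\in\hat{\mathsf k}$, $\zeta\in\hat D$, $x\in\mathsf V$, $t\ge0$. A linear process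 $k$ on $\mathsf V$ is a $\mathcal D$-strong solution of $(*)$ if $k_t(x)=\kappa(x)\underline\otimes I+\int_0^t(k_s\bullet d\Lambda_\phi(s))(x)$ in this sense. For exponential domains $\mathcal D_1'\subset\mathsf h'\otimes\mathcal F$ and $\mathcal D_1=E_1\underline\otimes\mathcal E_{D_1}\subset\mathcal D$ (with $D_1\subset D$), a linear process $\tilde k$ on $\mathsf V$ with domain $\mathcal D_1$ is a $(\mathcal D_1',\mathcal D_1)$-weak solution of $(*)$ if each $t\mapsto\langle\xi',\tilde k_t(x)\xi\rangle$ ($\xi'\in\mathcal D_1'$, $\xi\in\mathcal D_1$) is continuous and $$\langle v'\varepsilon(g'),\tilde k_t(x)v\varepsilon(g)\rangle-\langle v',\kappa(x)v\rangle\langle\varepsilon(g'),\varepsilon(g)\rangle=\int_0^t\big\langle v'\varepsilon(g'),\tilde k_s\big(\phi^{\widehat{g'}(s)}_{\hat g(s)}(x)\big)v\varepsilon(g)\big\rangle ds$$ for all $x\in\mathsf V$, $t\ge0$, $v\varepsilon(g)\in\mathcal D_1$, $v'\varepsilon(g')\in\mathcal D_1'$. **Theorem.** The equation $(*)$ has a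 $\mathcal D$-strong solution $k$, with $E^{\varepsilon'}k_t(x)E_\varepsilon\in\mathsf Y$ for all $\varepsilon'\in\mathcal E$, $\varepsilon\in\mathcal E_D$, $x\in\mathsf V$, $t\ge0$, which is the sum $k_t(x)\xi=\sum_{n\ge0}I^n_t(x)\xi$ $(\xi\in\mathcal D)$ of the iterated quantum stochastic integrals $I^0_t(x)=\kappa(x)\underline\otimes I$, $I^{n+1}_t=\int_0^tI^n_s\bullet d\Lambda_\phi(s)$, and which has the following properties. Write $k_{t,|\varepsilon\rangle}(x)=k_t(x)E_\varepsilon$. (a) $k$ has $\mathsf k$-bounded columns: $k_{t,|\varepsilon\rangle}\in\mathsf k\text{-}B(\mathsf V;\mathsf Y\otimes_{\mathrm M}|\mathcal F\rangle)$ for all $t\ge0$, $\varepsilon\in\mathcal E_D$. (b) For each $\varepsilon\in\mathcal E_D$ the map $s\mapsto k_{s,|\varepsilon\rangle}$, $\mathbb R_+\to\mathsf k\text{-}B(\mathsf V;\mathsf Y\otimes_{\mathrm M}|\mathcal F\rangle)$, is locally Hölder continuous with exponent $\tfrac12$. (c) If $\tilde k$ is a linear $(\mathcal D_1',\mathcal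 D_1)$-weak solution of $(*)$, for exponential domains $\mathcal D_1'\subset\mathsf h'\otimes\mathcal F$ and $\mathcal D_1\subset\mathcal D$, such that each functional $x\mapsto\langle\xi',\tilde k_t(x)\xi\rangle$ on $\mathsf V$ ($\xi'\in\mathcal D_1'$, $\xi\in\mathcal D_1$, $t\ge0$) is bounded, then $\tilde k$ is a restriction of $k$: $\tilde k_t(x)=k_t(x)|_{\mathcal D_1}$ for all $x\in\mathsf V$, $t\ge0$. (d) If $\phi$ has cb-columns (each $\phi_{|\zeta\rangle}$ is completely bounded) and $\kappa$ is completely bounded, then $k$ has cb-columns, $k_{t,|\varepsilon\rangle}\in CB(\mathsf V;\mathsf Y\otimes_{\mathrm M}|\mathcal F\rangle)$, and (b) holds with $CB(\mathsf V;\mathsf Y\otimes_{\mathrm M}|\mathcal F\rangle)$ in place of $\mathsf k\text{-}B(\mathsf V;\mathsf Y\otimes_{\mathrm M}|\mathcal F\rangle)$. -/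

import Mathlib

open MeasureTheory Set
open scoped TensorProduct InnerProductSpace

noncomputable section

namespace QS

universe u v w

/-! ### Operator spaces and completely bounded maps -/

/-- A family of functions on the spaces of square matrices over `V`, to be used as norms. -/
class MatrixNorm (V : Type u) where
  /-- the norm of an `n × n` matrix over `V` -/
  mnorm : ∀ n : ℕ, Matrix (Fin n) (Fin n) V → ℝ

/-- The norm of an `n × n` matrix over `V`. -/
def mnorm {V : Type u} [MatrixNorm V] {n : ℕ} (X : Matrix (Fin n) (Fin n) V) : ℝ :=
  MatrixNorm.mnorm n X

/-- The product `α X β` of a matrix `X` over `V` with rectangular scalar matrices `α`, `β`. -/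
def scalarMul {V : Type u} [AddCommGroup V] [Module ℂ V] {m n : ℕ}
    (α : Matrix (Fin n) (Fin m) ℂ) (X : Matrix (Fin m) (Fin m) V)
    (β : Matrix (Fin m) (Fin n) ℂ) : Matrix (Fin n) (Fin n) V :=
  Matrix.of fun i j => ∑ p, ∑ q, (α i p * β q j) • X p q

/-- The direct sum `X ⊕ Z` as a block diagonal matrix. -/
def directSum {V : Type u} [AddCommGroup V] {m n : ℕ}
    (X : Matrix (Fin m) (Fin m) V) (Z : Matrix (Fin n) (Fin n) V) :
    Matrix (Fin (m + n)) (Fin (m + n)) V :=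
  Matrix.reindex finSumFinEquiv finSumFinEquiv (Matrix.fromBlocks X 0 0 Z)

/-- The operator norm of a rectangular scalar matrix between Euclidean spaces. -/
def scalarNorm {m n : ℕ} (α : Matrix (Fin n) (Fin m) ℂ) : ℝ :=
  ‖(Matrix.toEuclideanLin α).toContinuousLinearMap‖

/-- An (abstract) operator space structure on a normed space: matrix norms that satisfy
Ruan's axioms and induce the given norm at the first level. -/
class OperatorSpace (V : Type u) [NormedAddCommGroup V] [NormedSpace ℂ V]
    extends MatrixNorm V where
  mnorm_one : ∀ x : V, mnorm 1 (Matrix.of fun _ _ => x) = ‖x‖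
  mnorm_add_le : ∀ (n : ℕ) (X Z : Matrix (Fin n) (Fin n) V),
    mnorm n (X + Z) ≤ mnorm n X + mnorm n Z
  mnorm_smul : ∀ (n : ℕ) (c : ℂ) (X : Matrix (Fin n) (Fin n) V),
    mnorm n (c • X) = ‖c‖ * mnorm n X
  mnorm_directSum : ∀ (m n : ℕ) (X : Matrix (Fin m) (Fin m) V) (Z : Matrix (Fin n) (Fin n) V),
    mnorm (m + n) (directSum X Z) = max (mnorm m X) (mnorm n Z)
  mnorm_scalarMul_le : ∀ (m n : ℕ) (α : Matrix (Fin n) (Fin m) ℂ)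
    (X : Matrix (Fin m) (Fin m) V) (β : Matrix (Fin m) (Fin n) ℂ),
    mnorm n (scalarMul α X β) ≤ scalarNorm α * mnorm m X * scalarNorm β

/-- The operator `H^n → K^n` with matrix `[T i j]`, on Hilbert space direct sums. -/
def opMatrix {H : Type u} {K : Type v} [NormedAddCommGroup H] [InnerProductSpace ℂ H]
    [NormedAddCommGroup K] [InnerProductSpace ℂ K] {n : ℕ}
    (T : Matrix (Fin n) (Fin n) (H →L[ℂ] K)) :
    PiLp 2 (fun _ : Fin n => H) →L[ℂ] PiLp 2 (fun _ : Fin n => K) :=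
  ((PiLp.continuousLinearEquiv 2 ℂ (fun _ : Fin n => K)).symm :
      (Fin n → K) →L[ℂ] PiLp 2 (fun _ : Fin n => K)) ∘L
    ContinuousLinearMap.pi fun i => ∑ j, T i j ∘L PiLp.proj 2 (fun _ : Fin n => H) j

/-- The matrix norms of `B(H;K)`: `M_n(B(H;K)) = B(H^n;K^n)`. -/
instance opMatrixNorm {H : Type u} {K : Type v} [NormedAddCommGroup H] [InnerProductSpace ℂ H]
    [NormedAddCommGroup K] [InnerProductSpace ℂ K] : MatrixNorm (H →L[ℂ] K) where
  mnorm _ T := ‖opMatrix T‖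

/-- A subspace inherits the matrix norms. -/
instance subMatrixNorm {W : Type u} [AddCommGroup W] [Module ℂ W] [MatrixNorm W]
    (Y : Submodule ℂ W) : MatrixNorm Y where
  mnorm _ X := mnorm (X.map fun y : Y => (y : W))

/-- `‖A‖ ≤ C`, for the norms at the first matrix level. -/
def HasBound {V : Type u} {W : Type v} [AddCommGroup V] [Module ℂ V] [MatrixNorm V]
    [AddCommGroup W] [Module ℂ W] [MatrixNorm W] (A : V →ₗ[ℂ] W) (C : ℝ) : Prop :=
  ∀ x : V, mnorm (n := 1) (Matrix.of fun _ _ => A x) ≤ C * mnorm (n := 1) (Matrix.of fun _ _ => x)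

/-- `‖A‖_cb ≤ C`. -/
def HasCBBound {V : Type u} {W : Type v} [AddCommGroup V] [Module ℂ V] [MatrixNorm V]
    [AddCommGroup W] [Module ℂ W] [MatrixNorm W] (A : V →ₗ[ℂ] W) (C : ℝ) : Prop :=
  ∀ (n : ℕ) (X : Matrix (Fin n) (Fin n) V), mnorm (X.map A) ≤ C * mnorm X

/-- `A` is completely bounded. -/
def IsCB {V : Type u} {W : Type v} [AddCommGroup V] [Module ℂ V] [MatrixNorm V]
    [AddCommGroup W] [Module ℂ W] [MatrixNorm W] (A : V →ₗ[ℂ] W) : Prop :=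
  ∃ C, HasCBBound A C

/-- The `𝔨`-bounded norm of `A` is at most `C`: the operator norm if `𝔨` is finite
dimensional, the cb-norm otherwise. -/
def HasKBound (𝔨 : Type w) [NormedAddCommGroup 𝔨] [InnerProductSpace ℂ 𝔨]
    {V : Type u} {W : Type v} [AddCommGroup V] [Module ℂ V] [MatrixNorm V]
    [AddCommGroup W] [Module ℂ W] [MatrixNorm W] (A : V →ₗ[ℂ] W) (C : ℝ) : Prop :=
  (FiniteDimensional ℂ 𝔨 → HasBound A C) ∧ (¬ FiniteDimensional ℂ 𝔨 → HasCBBound A C)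

/-- `A` is `𝔨`-bounded. -/
def IsKBounded (𝔨 : Type w) [NormedAddCommGroup 𝔨] [InnerProductSpace ℂ 𝔨]
    {V : Type u} {W : Type v} [AddCommGroup V] [Module ℂ V] [MatrixNorm V]
    [AddCommGroup W] [Module ℂ W] [MatrixNorm W] (A : V →ₗ[ℂ] W) : Prop :=
  ∃ C, HasKBound 𝔨 A C

section CB

variable {V : Type u} {W : Type v} [AddCommGroup V] [Module ℂ V] [MatrixNorm V]
  [NormedAddCommGroup W] [NormedSpace ℂ W] [OperatorSpace W]

theorem isCB_zero : IsCB (0 : V →ₗ[ℂ] W) := by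
  refine ⟨0, fun n X => ?_⟩
  have h := OperatorSpace.mnorm_smul n (0 : ℂ) (0 : Matrix (Fin n) (Fin n) W)
  have e : X.map (0 : V →ₗ[ℂ] W) = 0 := by ext; simp
  rw [zero_mul, e]
  simp only [zero_smul, norm_zero, zero_mul] at h
  exact h.le

theorem isCB_add {A B : V →ₗ[ℂ] W} (hA : IsCB A) (hB : IsCB B) : IsCB (A + B) := by
  obtain ⟨C, hC⟩ := hA
  obtain ⟨C', hC'⟩ := hB
  refine ⟨C + C', fun n X => ?_⟩
  have e : X.map (A + B) = X.map A + X.map B := by ext; simp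
  rw [e, add_mul]
  exact (OperatorSpace.mnorm_add_le n _ _).trans (add_le_add (hC n X) (hC' n X))

theorem isCB_smul (c : ℂ) {A : V →ₗ[ℂ] W} (hA : IsCB A) : IsCB (c • A) := by
  obtain ⟨C, hC⟩ := hA
  refine ⟨‖c‖ * C, fun n X => ?_⟩
  have e : X.map (c • A) = c • X.map A := by ext; simp
  rw [e, mul_assoc]
  exact (OperatorSpace.mnorm_smul n c _).le.trans
    (mul_le_mul_of_nonneg_left (hC n X) (norm_nonneg c))

variable (V W) in
/-- `CB(V;W)`, the space of completely bounded maps. -/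
def CBMap : Submodule ℂ (V →ₗ[ℂ] W) where
  carrier := {A | IsCB A}
  zero_mem' := isCB_zero
  add_mem' := isCB_add
  smul_mem' c _ hA := isCB_smul c hA

/-- The matrix `[T i j (X p q)]` over `W`, for matrices `T` over `CB(V;W)` and `X` over `V`. -/
def cbApply {m n : ℕ} (T : Matrix (Fin n) (Fin n) (CBMap V W))
    (X : Matrix (Fin m) (Fin m) V) : Matrix (Fin (m * n)) (Fin (m * n)) W :=
  Matrix.reindex finProdFinEquiv finProdFinEquiv
    (Matrix.of fun a b : Fin m × Fin n => (T a.2 b.2 : V →ₗ[ℂ] W) (X a.1 b.1))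

/-- The matrix norms of `CB(V;W)`, from `M_n(CB(V;W)) = CB(V;M_n(W))`; at the first level
this is the cb-norm. -/
instance cbMatrixNorm : MatrixNorm (CBMap V W) where
  mnorm _ T := sInf {C : ℝ | 0 ≤ C ∧
    ∀ (m : ℕ) (X : Matrix (Fin m) (Fin m) V), mnorm (cbApply T X) ≤ C * mnorm X}

end CB

/-! ### Hilbert space tensor products -/

section Tensor

variable (H : Type u) (K : Type v) [NormedAddCommGroup H] [InnerProductSpace ℂ H]
  [NormedAddCommGroup K] [InnerProductSpace ℂ K]

/-- The Hilbert space tensor product `H ⊗ K`. -/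
def HT : Type (max u v) := UniformSpace.Completion (H ⊗[ℂ] K)

instance : NormedAddCommGroup (HT H K) :=
  inferInstanceAs (NormedAddCommGroup (UniformSpace.Completion (H ⊗[ℂ] K)))

instance : InnerProductSpace ℂ (HT H K) :=
  inferInstanceAs (InnerProductSpace ℂ (UniformSpace.Completion (H ⊗[ℂ] K)))

instance : CompleteSpace (HT H K) :=
  inferInstanceAs (CompleteSpace (UniformSpace.Completion (H ⊗[ℂ] K)))

variable {H K}

/-- The simple tensor `x ⊗ y`. -/
def tm (x : H) (y : K) : HT H K := ((x ⊗ₜ[ℂ] y : H ⊗[ℂ] K) : UniformSpace.Completion (H ⊗[ℂ] K))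

theorem inner_tm (x x' : H) (y y' : K) : ⟪tm x y, tm x' y'⟫_ℂ = ⟪x, x'⟫_ℂ * ⟪y, y'⟫_ℂ := by
  exact (UniformSpace.Completion.inner_coe _ _).trans (TensorProduct.inner_tmul ..)

theorem norm_tm (x : H) (y : K) : ‖tm x y‖ = ‖x‖ * ‖y‖ := by
  exact (UniformSpace.Completion.norm_coe _).trans (TensorProduct.norm_tmul ..)

theorem tm_add_left (x x' : H) (y : K) : tm (x + x') y = tm x y + tm x' y := by
  simp only [tm, TensorProduct.add_tmul]
  exact UniformSpace.Completion.coe_add _ _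

theorem tm_smul_left (c : ℂ) (x : H) (y : K) : tm (c • x) y = c • tm x y := by
  rw [tm, ← TensorProduct.smul_tmul']
  exact UniformSpace.Completion.coe_smul c (x ⊗ₜ[ℂ] y : H ⊗[ℂ] K)

/-- `E_ζ : H → H ⊗ K`, `x ↦ x ⊗ ζ`. -/
def ket (ζ : K) : H →L[ℂ] HT H K :=
  LinearMap.mkContinuous
    { toFun := fun x => tm x ζ
      map_add' := fun x x' => tm_add_left x x' ζ
      map_smul' := fun c x => tm_smul_left c x ζ } ‖ζ‖
    (fun x => (norm_tm x ζ).le.trans (mul_comm _ _).le)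

/-- `E^ζ = (E_ζ)^* = I ⊗ ⟨ζ| : H ⊗ K → H`. -/
def bra [CompleteSpace H] (ζ : K) : HT H K →L[ℂ] H :=
  ContinuousLinearMap.adjoint (ket ζ)

/-- The algebraic tensor product of subspaces `A` of `H` and `B` of `K`, inside `H ⊗ K`. -/
def algTensor (A : Submodule ℂ H) (B : Submodule ℂ K) : Submodule ℂ (HT H K) :=
  Submodule.span ℂ {z | ∃ a ∈ A, ∃ b ∈ B, z = tm a b}

theorem tm_mem_algTensor {A : Submodule ℂ H} {B : Submodule ℂ K} {a : H} {b : K}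
    (ha : a ∈ A) (hb : b ∈ B) : tm a b ∈ algTensor A B :=
  Submodule.subset_span ⟨a, ha, b, hb, rfl⟩

theorem algTensor_mono {A A' : Submodule ℂ H} {B B' : Submodule ℂ K}
    (hA : A ≤ A') (hB : B ≤ B') : algTensor A B ≤ algTensor A' B' :=
  Submodule.span_mono fun _ ⟨a, ha, b, hb, h⟩ => ⟨a, hA ha, b, hB hb, h⟩

/-- `E_b` restricted to dense domains: `a ↦ a ⊗ b`, from `A` to the algebraic tensor
product of `A` and `B`. -/
def algKet {A : Submodule ℂ H} {B : Submodule ℂ K} (b : B) : A →ₗ[ℂ] algTensor A B where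
  toFun a := ⟨tm (a : H) (b : K), tm_mem_algTensor a.2 b.2⟩
  map_add' _ _ := Subtype.ext (tm_add_left _ _ _)
  map_smul' _ _ := Subtype.ext (tm_smul_left _ _ _)

/-- `ω_{ζ',ζ} • T = E^{ζ'} T E_ζ`, for an operator `T` whose domain is an algebraic tensor
product. -/
def slice {H' : Type*} {K' : Type*} [NormedAddCommGroup H'] [InnerProductSpace ℂ H']
    [CompleteSpace H'] [NormedAddCommGroup K'] [InnerProductSpace ℂ K']
    {A : Submodule ℂ H} {B : Submodule ℂ K} (ζ' : K') (ζ : B)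
    (T : algTensor A B →ₗ[ℂ] HT H' K') : A →ₗ[ℂ] H' :=
  (bra ζ' : HT H' K' →L[ℂ] H').toLinearMap ∘ₗ T ∘ₗ algKet ζ

/-- The column space `Y ⊗_M |K⟩` over a subspace `Y` of `B(H;H')`: the bounded operators
`T : H → H' ⊗ K` all of whose slices `E^χ T` lie in `Y`. -/
def colSpace {H' : Type*} [NormedAddCommGroup H'] [InnerProductSpace ℂ H'] [CompleteSpace H']
    (Y : Submodule ℂ (H →L[ℂ] H')) (K : Type v) [NormedAddCommGroup K] [InnerProductSpace ℂ K] :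
    Submodule ℂ (H →L[ℂ] HT H' K) where
  carrier := {T | ∀ χ : K, bra χ ∘L T ∈ Y}
  zero_mem' χ := by simp
  add_mem' hS hT χ := by
    rw [ContinuousLinearMap.comp_add]
    exact Y.add_mem (hS χ) (hT χ)
  smul_mem' c T hT χ := by
    rw [ContinuousLinearMap.comp_smul]
    exact Y.smul_mem c (hT χ)

end Tensor

/-! ### Symmetric Fock space -/

/-- A Hilbert space, bundled (only used for the recursion that defines tensor powers). -/
structure Hilb where
  carrier : Type u
  [nacg : NormedAddCommGroup carrier]
  [ips : InnerProductSpace ℂ carrier]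
  [cpl : CompleteSpace carrier]

attribute [instance] Hilb.nacg Hilb.ips Hilb.cpl

section Fock

variable (H : Type u) [NormedAddCommGroup H] [InnerProductSpace ℂ H]

/-- The Hilbert space tensor power: a one-dimensional space for `n = 0`, and
`H ⊗ H^{⊗ n}` for `n + 1`. -/
def tensorPow : ℕ → Hilb.{u}
  | 0 => ⟨EuclideanSpace ℂ PUnit.{u + 1}⟩
  | n + 1 => ⟨HT H (tensorPow n).carrier⟩

variable {H}

/-- The vector `f^{⊗ n}`. -/
def vecPow (f : H) : ∀ n : ℕ, (tensorPow H n).carrier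
  | 0 => (EuclideanSpace.single PUnit.unit (1 : ℂ) : EuclideanSpace ℂ PUnit.{u + 1})
  | n + 1 => (tm f (vecPow f n) : HT H (tensorPow H n).carrier)

theorem norm_vecPow (f : H) : ∀ n : ℕ, ‖vecPow f n‖ = ‖f‖ ^ n
  | 0 => by
    change ‖(EuclideanSpace.single PUnit.unit (1 : ℂ) : EuclideanSpace ℂ PUnit.{u + 1})‖ = _
    simp
  | n + 1 => by
    change ‖(tm f (vecPow f n) : HT H (tensorPow H n).carrier)‖ = _
    rw [norm_tm, norm_vecPow f n, pow_succ']

variable (H)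

/-- The full Fock space. -/
abbrev FullFock : Type u := lp (fun n : ℕ => (tensorPow H n).carrier) 2

/-- The symmetric part of the full Fock space: the closed linear span of the symmetric
tensors `f^{⊗ n}`. -/
def symPart : Submodule ℂ (FullFock H) :=
  (Submodule.span ℂ {z | ∃ (n : ℕ) (f : H), z = lp.single 2 n (vecPow f n)}).topologicalClosure

/-- The symmetric Fock space over `H`. -/
def SymFock : Type u := symPart H

instance : NormedAddCommGroup (SymFock H) := inferInstanceAs (NormedAddCommGroup (symPart H))

instance : InnerProductSpace ℂ (SymFock H) := inferInstanceAs (InnerProductSpace ℂ (symPart H))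

instance : CompleteSpace (SymFock H) :=
  (Submodule.isClosed_topologicalClosure _).completeSpace_coe

variable {H}

theorem memℓp_expVec (f : H) :
    Memℓp (fun n : ℕ => (((Real.sqrt n.factorial)⁻¹ : ℝ) : ℂ) • vecPow f n) 2 := by
  refine memℓp_gen ?_
  have h := Real.summable_pow_div_factorial (‖f‖ ^ 2)
  refine h.congr fun n => ?_
  rw [norm_smul, norm_vecPow]
  simp only [ENNReal.toReal_ofNat, Real.rpow_ofNat, Complex.norm_real, norm_inv, Real.norm_eq_abs]
  rw [mul_pow, inv_pow, sq_abs, Real.sq_sqrt (by positivity)]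
  ring

/-- The exponential vector `ε(f) = ((n!)^{-1/2} f^{⊗ n})_n`, in the full Fock space. -/
def expFull (f : H) : FullFock H := ⟨_, memℓp_expVec f⟩

theorem expFull_mem (f : H) : expFull f ∈ symPart H := by
  have h := lp.hasSum_single (p := 2) (by norm_num) (expFull f)
  refine mem_closure_of_tendsto h (Filter.Eventually.of_forall fun s => ?_)
  refine Submodule.sum_mem _ fun n _ => ?_
  have e : lp.single (E := fun n : ℕ => (tensorPow H n).carrier) 2 n (expFull f n)
      = (((Real.sqrt n.factorial)⁻¹ : ℝ) : ℂ) • lp.single 2 n (vecPow f n) :=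
    lp.single_smul 2 n _ _
  rw [e]
  exact Submodule.smul_mem _ _ (Submodule.subset_span ⟨n, f, rfl⟩)

/-- The exponential vector `ε(f)` in the symmetric Fock space. -/
def expVec (f : H) : SymFock H := ⟨expFull f, expFull_mem f⟩

end Fock

/-! ### Step functions, exponential domains and processes -/

section Noise

variable (𝔨 : Type u) [NormedAddCommGroup 𝔨] [InnerProductSpace ℂ 𝔨]

/-- `L²(ℝ₊;𝔨)`. -/
abbrev L2 : Type u := Lp 𝔨 2 (volume.restrict (Ici (0 : ℝ)))

/-- The symmetric Fock space over `L²(ℝ₊;𝔨)`. -/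
abbrev Fock : Type u := SymFock (L2 𝔨)

/-- `𝔨̂ = ℂ ⊕ 𝔨`. -/
abbrev Khat : Type u := WithLp 2 (ℂ × 𝔨)

variable {𝔨}

/-- `ĉ = (1, c)`. -/
def hat (c : 𝔨) : Khat 𝔨 := WithLp.toLp 2 (1, c)

/-- The vector `(0, c)` of `𝔨̂`. -/
def inNoise (c : 𝔨) : Khat 𝔨 := WithLp.toLp 2 (0, c)

/-- `D̂`, the linear span of the vectors `ĉ` with `c ∈ D`. -/
def dhat (D : Submodule ℂ 𝔨) : Submodule ℂ (Khat 𝔨) := Submodule.span ℂ (hat '' (D : Set 𝔨))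

theorem dhat_mono {D D' : Submodule ℂ 𝔨} (h : D ≤ D') : dhat D ≤ dhat D' :=
  Submodule.span_mono (image_mono h)

/-- The `D`-valued right-continuous step functions: the linear span of the functions
`d_{[0,t[}` with `d ∈ D`, `t ≥ 0`. They vanish on the negative half-line. -/
def step (D : Submodule ℂ 𝔨) : Submodule ℂ (ℝ → 𝔨) :=
  Submodule.span ℂ {g | ∃ d ∈ D, ∃ t : ℝ, 0 ≤ t ∧ g = (Ico 0 t).indicator fun _ => d}

theorem step_memLp {D : Submodule ℂ 𝔨} (g : step D) :
    MemLp (g : ℝ → 𝔨) 2 (volume.restrict (Ici (0 : ℝ))) := by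
  obtain ⟨g, hg⟩ := g
  change MemLp g 2 _
  induction hg using Submodule.span_induction with
  | mem g hg =>
    obtain ⟨d, _, t, _, rfl⟩ := hg
    refine memLp_indicator_const 2 measurableSet_Ico d (Or.inr ?_)
    exact ((Measure.restrict_apply_le _ _).trans_lt measure_Ico_lt_top).ne
  | zero => exact MemLp.zero
  | add f g _ _ hf hg => exact hf.add hg
  | smul c g _ hg => exact hg.const_smul c

theorem step_mem {D : Submodule ℂ 𝔨} (g : step D) (s : ℝ) : (g : ℝ → 𝔨) s ∈ D := by
  obtain ⟨g, hg⟩ := g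
  change g s ∈ D
  induction hg using Submodule.span_induction with
  | mem g hg =>
    obtain ⟨d, hd, t, _, rfl⟩ := hg
    by_cases h : s ∈ Ico 0 t
    · simpa [indicator_of_mem h] using hd
    · simp [indicator_of_notMem h]
  | zero => exact D.zero_mem
  | add f g _ _ hf hg => exact D.add_mem hf hg
  | smul c g _ hg => exact D.smul_mem c hg

theorem step_indicator {D : Submodule ℂ 𝔨} (g : step D) {t : ℝ} (ht : 0 ≤ t) :
    (Ico 0 t).indicator (g : ℝ → 𝔨) ∈ step D := by
  obtain ⟨g, hg⟩ := g
  change (Ico 0 t).indicator g ∈ step D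
  induction hg using Submodule.span_induction with
  | mem g hg =>
    obtain ⟨d, hd, s, hs, rfl⟩ := hg
    refine Submodule.subset_span ⟨d, hd, min t s, le_min ht hs, ?_⟩
    rw [indicator_indicator, Ico_inter_Ico, sup_idem]
  | zero => simp
  | add f g _ _ hf hg =>
    rw [indicator_add']
    exact (step D).add_mem hf hg
  | smul c g _ hg =>
    have e : (Ico 0 t).indicator (c • g) = c • (Ico 0 t).indicator g :=
      indicator_const_smul _ c g
    rw [e]
    exact (step D).smul_mem c hg

/-- `g_{[0,t[}`. -/
def before {D : Submodule ℂ 𝔨} (g : step D) {t : ℝ} (ht : 0 ≤ t) : step D :=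
  ⟨(Ico 0 t).indicator g, step_indicator g ht⟩

/-- `g_{[t,∞[} = g - g_{[0,t[}`. -/
def after {D : Submodule ℂ 𝔨} (g : step D) {t : ℝ} (ht : 0 ≤ t) : step D :=
  g - before g ht

/-- `ĝ(s)`, as an element of `D̂`. -/
def hatStep {D : Submodule ℂ 𝔨} (g : step D) (s : ℝ) : dhat D :=
  ⟨hat ((g : ℝ → 𝔨) s), Submodule.subset_span ⟨_, step_mem g s, rfl⟩⟩

/-- The exponential vector `ε(g)` of a step function. -/
def expStep {D : Submodule ℂ 𝔨} (g : step D) : Fock 𝔨 := expVec ((step_memLp g).toLp _)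

/-- The linear span of the exponential vectors `ε(g)` of `D`-valued step functions. -/
def exps (D : Submodule ℂ 𝔨) : Submodule ℂ (Fock 𝔨) :=
  Submodule.span ℂ (range fun g : step D => expStep g)

/-- `ε(g)` as an element of the span. -/
def expD {D : Submodule ℂ 𝔨} (g : step D) : exps D :=
  ⟨expStep g, Submodule.subset_span ⟨g, rfl⟩⟩

theorem exps_mono {D D' : Submodule ℂ 𝔨} (h : D ≤ D') : exps D ≤ exps D' := by
  refine Submodule.span_mono ?_
  rintro _ ⟨g, rfl⟩
  have hg : (g : ℝ → 𝔨) ∈ step D' :=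
    Submodule.span_mono (by rintro _ ⟨d, hd, t, ht, e⟩; exact ⟨d, h hd, t, ht, e⟩) g.2
  exact ⟨⟨g, hg⟩, rfl⟩

variable {𝔥 : Type v} [NormedAddCommGroup 𝔥] [InnerProductSpace ℂ 𝔥]
  {𝔥' : Type w} [NormedAddCommGroup 𝔥'] [InnerProductSpace ℂ 𝔥']

/-- The exponential domain given by subspaces `E` of `𝔥` and `D` of `𝔨`. -/
def expDom (E : Submodule ℂ 𝔥) (D : Submodule ℂ 𝔨) : Submodule ℂ (HT 𝔥 (Fock 𝔨)) :=
  algTensor E (exps D)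

theorem expDom_mono {E E' : Submodule ℂ 𝔥} {D D' : Submodule ℂ 𝔨} (hE : E ≤ E') (hD : D ≤ D') :
    expDom E D ≤ expDom E' D' :=
  algTensor_mono hE (exps_mono hD)

/-- The vector `v ε(g)` of an exponential domain. -/
def vexp {E : Submodule ℂ 𝔥} {D : Submodule ℂ 𝔨} (v : E) (g : step D) : expDom E D :=
  algKet (expD g) v

/-- The operators from `𝔥 ⊗ F` to `𝔥' ⊗ F` whose domain is the exponential domain of `E`
and `D`. -/
abbrev Op (E : Submodule ℂ 𝔥) (D : Submodule ℂ 𝔨) (𝔥' : Type w) [NormedAddCommGroup 𝔥']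
    [InnerProductSpace ℂ 𝔥'] :=
  expDom E D →ₗ[ℂ] HT 𝔥' (Fock 𝔨)

/-- The operators from `𝔥 ⊗ 𝔨̂ ⊗ F` to `𝔥' ⊗ 𝔨̂ ⊗ F` with domain the algebraic tensor product
of `E`, `D̂` and the span of the exponential vectors. The factor `𝔨̂` is written last, so that
`E_ζ` and `E^ζ` for `ζ ∈ 𝔨̂` are `ket ζ` and `bra ζ`. -/
abbrev OpHat (E : Submodule ℂ 𝔥) (D : Submodule ℂ 𝔨) (𝔥' : Type w) [NormedAddCommGroup 𝔥']
    [InnerProductSpace ℂ 𝔥'] :=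
  algTensor (expDom E D) (dhat D) →ₗ[ℂ] HT (HT 𝔥' (Fock 𝔨)) (Khat 𝔨)

/-- `X` is a process: weakly measurable and adapted. Only times `t ≥ 0` matter. -/
structure IsProcess {E : Submodule ℂ 𝔥} {D : Submodule ℂ 𝔨} (X : ℝ → Op E D 𝔥') : Prop where
  measurable : ∀ (ξ' : HT 𝔥' (Fock 𝔨)) (ξ : expDom E D),
    Measurable ((Ici (0 : ℝ)).domRestrict fun t => ⟪ξ', X t ξ⟫_ℂ)
  adapted : ∀ (t : ℝ) (ht : 0 ≤ t) (u : E) (g : step D) (u' : 𝔥') (g' : step (⊤ : Submodule ℂ 𝔨)),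
    ⟪tm u' (expStep g'), X t (vexp u g)⟫_ℂ =
      ⟪tm u' (expStep (before g' ht)), X t (vexp u (before g ht))⟫_ℂ *
        ⟪expStep (after g' ht), expStep (after g ht)⟫_ℂ

/-- `F` is a process of operators on `𝔥 ⊗ 𝔨̂ ⊗ F`, with `𝔥 ⊗ 𝔨̂` as initial space: all its
slices over `𝔨̂` are weakly measurable and adapted. -/
def IsHatProcess {E : Submodule ℂ 𝔥} {D : Submodule ℂ 𝔨} (F : ℝ → OpHat E D 𝔥') : Prop :=
  ∀ (ζ' : Khat 𝔨) (ζ : dhat D), IsProcess fun t => (slice ζ' ζ (F t) : Op E D 𝔥')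

/-! ### Quantum stochastic integrals -/

/-- The integrand `s ↦ F_s (v ⊗ ĝ(s) ⊗ ε(g))`. -/
def integrand {E : Submodule ℂ 𝔥} {D : Submodule ℂ 𝔨} (F : ℝ → OpHat E D 𝔥') (v : E)
    (g : step D) (s : ℝ) : HT (HT 𝔥' (Fock 𝔨)) (Khat 𝔨) :=
  F s (algKet (hatStep g s) (vexp v g))

/-- `F` is quantum stochastically integrable: each `s ↦ F_s (v ⊗ ĝ(s) ⊗ ε(g))` is strongly
measurable and locally square integrable. -/
def QSIntegrable {E : Submodule ℂ 𝔥} {D : Submodule ℂ 𝔨} (F : ℝ → OpHat E D 𝔥') : Prop :=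
  ∀ (v : E) (g : step D) (T : ℝ), 0 ≤ T → MemLp (integrand F v g) 2 (volume.restrict (Icc 0 T))

/-- `y` is the Hitsuda-Skorohod integral over `[0,t]` of the noise component (in `𝔥' ⊗ 𝔨 ⊗ F`)
of the function `z` with values in `𝔥' ⊗ 𝔨̂ ⊗ F`: the value at `z` of the adjoint of the
gradient operator `v' ε(g') ↦ (s ↦ v' ⊗ g'(s) ⊗ ε(g'))`. -/
def IsSkorohodIntegral (z : ℝ → HT (HT 𝔥' (Fock 𝔨)) (Khat 𝔨)) (t : ℝ) (y : HT 𝔥' (Fock 𝔨)) :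
    Prop :=
  ∀ (v' : 𝔥') (g' : step (⊤ : Submodule ℂ 𝔨)),
    ⟪tm v' (expStep g'), y⟫_ℂ =
      ∫ s in (0 : ℝ)..t, ⟪tm (tm v' (expStep g')) (inNoise ((g' : ℝ → 𝔨) s)), z s⟫_ℂ

/-- `X_t = ∫_0^t F_s dΛ_s` for all `t ≥ 0`: on each `v ε(g)`, the operator `X_t` is the sum of
the time integral of the component of `F_s (v ⊗ ĝ(s) ⊗ ε(g))` along `(1,0) ∈ 𝔨̂` and the
Hitsuda-Skorohod integral of its noise component. -/
def IsQSIntegral {E : Submodule ℂ 𝔥} {D : Submodule ℂ 𝔨} (F : ℝ → OpHat E D 𝔥')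
    (X : ℝ → Op E D 𝔥') : Prop :=
  ∀ (t : ℝ), 0 ≤ t → ∀ (v : E) (g : step D), ∃ y : HT 𝔥' (Fock 𝔨),
    IsSkorohodIntegral (integrand F v g) t y ∧
    X t (vexp v g) = (∫ s in (0 : ℝ)..t, bra (hat (0 : 𝔨)) (integrand F v g s)) + y

/-! ### The quantum stochastic differential equation -/

variable {V : Type*} [NormedAddCommGroup V] [NormedSpace ℂ V] [OperatorSpace V]

/-- `φ^{ζ'}_ζ (x)`, the value of the column `φ_{|ζ⟩}(x) ∈ CB(⟨𝔨̂|;V)` at the bra `⟨ζ'|`. -/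
def coeff {D : Submodule ℂ 𝔨}
    (φ : dhat D →ₗ[ℂ] V →ₗ[ℂ] CBMap (StrongDual ℂ (Khat 𝔨)) V)
    (ζ' : Khat 𝔨) (ζ : dhat D) (x : V) : V :=
  (φ ζ x : StrongDual ℂ (Khat 𝔨) →ₗ[ℂ] V) (innerSL ℂ ζ')

/-- `j_t(x) = ∫_0^t K_s(x) dΛ_s` for a linear process `K` on `V` that is pointwise quantum
stochastically integrable and satisfies `ω_{ζ',ζ} • K_t = k_t ∘ φ^{ζ'}_ζ`; in other words,
`j_t = ∫_0^t k_s • dΛ_φ(s)`. -/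
def IsIntegralAgainst {E : Submodule ℂ 𝔥} {D : Submodule ℂ 𝔨}
    (φ : dhat D →ₗ[ℂ] V →ₗ[ℂ] CBMap (StrongDual ℂ (Khat 𝔨)) V)
    (k j : ℝ → V →ₗ[ℂ] Op E D 𝔥') : Prop :=
  ∃ K : ℝ → V →ₗ[ℂ] OpHat E D 𝔥',
    (∀ x, IsHatProcess fun t => K t x) ∧
    (∀ t : ℝ, 0 ≤ t → ∀ (x : V) (ζ' : Khat 𝔨) (ζ : dhat D),
      slice ζ' ζ (K t x) = k t (coeff φ ζ' ζ x)) ∧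
    (∀ x, QSIntegrable fun t => K t x) ∧
    ∀ x, IsQSIntegral (fun t => K t x) fun t => j t x

/-- `k` is a strong solution of `dk_t = k_t • dΛ_φ(t)`, `k_0 = ι ∘ κ`, on the exponential domain
of `E` and `D`: `k_t(x) = κ(x) ⊗ I + ∫_0^t K_s(x) dΛ_s`. -/
def IsStrongSolution {Y : Submodule ℂ (𝔥 →L[ℂ] 𝔥')} {E : Submodule ℂ 𝔥} {D : Submodule ℂ 𝔨}
    (φ : dhat D →ₗ[ℂ] V →ₗ[ℂ] CBMap (StrongDual ℂ (Khat 𝔨)) V) (κ : V →ₗ[ℂ] Y)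
    (k : ℝ → V →ₗ[ℂ] Op E D 𝔥') : Prop :=
  (∀ x, IsProcess fun t => k t x) ∧
  ∃ j : ℝ → V →ₗ[ℂ] Op E D 𝔥', IsIntegralAgainst φ k j ∧
    ∀ t : ℝ, 0 ≤ t → ∀ (x : V) (v : E) (g : step D),
      k t x (vexp v g) = tm ((κ x : 𝔥 →L[ℂ] 𝔥') v) (expStep g) + j t x (vexp v g)

/-- `k` is a linear weak solution of `dk_t = k_t • dΛ_φ(t)`, `k_0 = ι ∘ κ`, with respect to the
exponential domains of `E'`, `D'` in `𝔥' ⊗ F` and of `E`, `D` in `𝔥 ⊗ F`. -/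
structure IsWeakSolution {Y : Submodule ℂ (𝔥 →L[ℂ] 𝔥')} {E : Submodule ℂ 𝔥} {D : Submodule ℂ 𝔨}
    (E' : Submodule ℂ 𝔥') (D' : Submodule ℂ 𝔨)
    (φ : dhat D →ₗ[ℂ] V →ₗ[ℂ] CBMap (StrongDual ℂ (Khat 𝔨)) V) (κ : V →ₗ[ℂ] Y)
    (k : ℝ → V →ₗ[ℂ] Op E D 𝔥') : Prop where
  process : ∀ x, IsProcess fun t => k t x
  continuous : ∀ (ξ' : expDom E' D') (ξ : expDom E D) (x : V),
    ContinuousOn (fun t => ⟪(ξ' : HT 𝔥' (Fock 𝔨)), k t x ξ⟫_ℂ) (Ici 0)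
  equation : ∀ (v' : E') (g' : step D') (v : E) (g : step D) (x : V) (t : ℝ), 0 ≤ t →
    ⟪(vexp v' g' : HT 𝔥' (Fock 𝔨)), k t x (vexp v g)⟫_ℂ
        - ⟪(v' : 𝔥'), (κ x : 𝔥 →L[ℂ] 𝔥') v⟫_ℂ * ⟪expStep g', expStep g⟫_ℂ =
      ∫ s in (0 : ℝ)..t, ⟪(vexp v' g' : HT 𝔥' (Fock 𝔨)),
        k s (coeff φ (hatStep g' s : Khat 𝔨) (hatStep g s) x) (vexp v g)⟫_ℂ

/-- `I n` is the `n`-fold iterated quantum stochastic integral with coefficient `φ` and initial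
condition `κ`: `I 0 = ι ∘ κ` and `I (n+1)_t = ∫_0^t (I n)_s • dΛ_φ(s)`. -/
def IsIteratedIntegral {Y : Submodule ℂ (𝔥 →L[ℂ] 𝔥')} {E : Submodule ℂ 𝔥} {D : Submodule ℂ 𝔨}
    (φ : dhat D →ₗ[ℂ] V →ₗ[ℂ] CBMap (StrongDual ℂ (Khat 𝔨)) V) (κ : V →ₗ[ℂ] Y)
    (I : ℕ → ℝ → V →ₗ[ℂ] Op E D 𝔥') : Prop :=
  (∀ t : ℝ, 0 ≤ t → ∀ (x : V) (v : E) (g : step D),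
    I 0 t x (vexp v g) = tm ((κ x : 𝔥 →L[ℂ] 𝔥') v) (expStep g)) ∧
  ∀ n, (∀ x, IsProcess fun t => I n t x) ∧ IsIntegralAgainst φ (I n) (I (n + 1))

end Noise

end QS

end

set_option linter.unusedSectionVars false

open MeasureTheory Set
open scoped TensorProduct InnerProductSpace

noncomputable section

namespace QS

universe u v w

/-! ### Simple tensors and slices -/

section TensorBasics

variable {H : Type u} {K : Type v} [NormedAddCommGroup H] [InnerProductSpace ℂ H]
  [NormedAddCommGroup K] [InnerProductSpace ℂ K]

/-! An operator on an exponential domain is determined by its columns T E_{ε(g)}, one for each step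
function g. Exponential vectors of distinct step functions are linearly independent
(`linearIndependent_expStep`), so conversely every family of columns comes from an operator
(`opOf`). The construction is therefore carried out for families A_{g,t} : V → B(𝔥; 𝔥' ⊗ F). For
these, B = ∫ A • dΛ_φ is encoded by the first fundamental formula (`WeakEq`): ⟨u'ε(g'), B_{g,t}(x)u⟩
is the integral over [0,t] of ⟨u'ε(g'), A_{g,s}(φ^{ĝ'(s)}_{ĝ(s)}(x))u⟩.

One integration step rests on two facts. The first is algebraic (`exists_hatLift`,
`sum_hatLift_le_of_cb`, `liftable_of_hasBound`): a bounded map A on V lifts along ψ = φ_{|ζ⟩} to the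
map x ↦ Σ_p A(ψ(x)⟨e_p|) ⊗ e_p with values in B(𝔥; 𝔥' ⊗ F ⊗ 𝔨̂), with a bound proportional to that
of A. Here 𝔨-boundedness of φ enters: an infinite orthonormal basis needs complete boundedness,
while a finite one needs only boundedness.

The second is analytic (`exists_adapted_integral`): an adapted square integrable z with values in 𝔥'
⊗ F ⊗ 𝔨̂ has a stochastic integral y with ‖y‖² ≤ C² ∫‖z‖². By Riesz it suffices to bound the pairing
of z with the functions s ↦ Σ c_i v_i ε(f_i) ⊗ f̂_i(s). Adaptedness replaces ε(f_i) by its past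
before s times a scalar future factor. These factors are absorbed by the shift f_i ↦ f_i - g. Then
f̂_i = ĝ + (0, f_i - g) splits the test function into a part that is bounded pointwise and a
gradient, whose square norm is exactly the derivative of the square norm of the truncated shifted
combination (`intervalIntegrable_norm_sq_gradient`).

Together they bound ‖B_t - B_s‖ by R (∫_s^t ‖A_r‖² dr)^{1/2}, where R does not depend on A
(`exists_integral_estimate`). Hence the n-fold iterated integral has norm at most b R^n
(t^n/n!)^{1/2}. The series converges, its sum solves the equation, and the same estimate yields
Hölder exponent 1/2. Every bound is proved on an arbitrary set S of matrix levels containing 1: S =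
{1} gives operator norms, and all levels give cb-norms. The same family thus serves for
𝔨-boundedness and for (d). The strong form of the equation is recovered by subtracting the time
integral, since ĝ'(s) = (1,0) + (0,g'(s)).

For uniqueness, the matrix element of the difference of two solutions is a functional d_t on V with
d_t(x) = ∫_0^t d_s(Ψ_s x) ds and Ψ_s uniformly bounded. Banach–Steinhaus bounds d_t on [0,T], and
iteration gives a factor (MT)^n/n! that tends to 0 (`eq_zero_of_volterra`). -/

theorem tm_add_right (x : H) (y y' : K) : tm x (y + y') = tm x y + tm x y' := by
  simp only [tm, TensorProduct.tmul_add]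
  exact UniformSpace.Completion.coe_add _ _

theorem tm_smul_right (c : ℂ) (x : H) (y : K) : tm x (c • y) = c • tm x y := by
  rw [tm, TensorProduct.tmul_smul]
  exact UniformSpace.Completion.coe_smul c (x ⊗ₜ[ℂ] y : H ⊗[ℂ] K)

/-- The map `y ↦ x ⊗ y`. -/
def tmL (x : H) : K →L[ℂ] HT H K :=
  LinearMap.mkContinuous
    { toFun := fun y => tm x y
      map_add' := tm_add_right x
      map_smul' := fun c y => tm_smul_right c x y } ‖x‖
    (fun y => (norm_tm x y).le)

@[simp] theorem ket_apply (x : H) (y : K) : (ket y : H →L[ℂ] HT H K) x = tm x y := rfl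

theorem tm_zero_right (x : H) : tm x (0 : K) = 0 := (tmL x : K →L[ℂ] HT H K).map_zero

theorem inner_bra [CompleteSpace H] (ζ : K) (x : H) (w : HT H K) :
    ⟪x, bra ζ w⟫_ℂ = ⟪tm x ζ, w⟫_ℂ := by
  rw [bra, ContinuousLinearMap.adjoint_inner_right, ket_apply]

theorem norm_bra_le [CompleteSpace H] (ζ : K) : ‖(bra ζ : HT H K →L[ℂ] H)‖ ≤ ‖ζ‖ := by
  rw [bra, LinearIsometryEquiv.norm_map]
  exact LinearMap.mkContinuous_norm_le _ (norm_nonneg _) _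

theorem bra_add [CompleteSpace H] (ζ ζ' : K) :
    (bra (ζ + ζ') : HT H K →L[ℂ] H) = bra ζ + bra ζ' := by
  ext w
  refine ext_inner_left ℂ fun x => ?_
  simp only [add_apply, inner_add_right, inner_bra, tm_add_right,
    inner_add_left]

theorem bra_smul [CompleteSpace H] (c : ℂ) (ζ : K) :
    (bra (c • ζ) : HT H K →L[ℂ] H) = (starRingEnd ℂ c) • bra ζ := by
  ext w
  refine ext_inner_left ℂ fun x => ?_
  simp only [smul_apply, inner_smul_right, inner_bra, tm_smul_right,
    inner_smul_left]

theorem bra_zero [CompleteSpace H] : (bra (0 : K) : HT H K →L[ℂ] H) = 0 := by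
  simpa using bra_smul (H := H) 0 (0 : K)

theorem bra_sub [CompleteSpace H] (ζ ζ' : K) :
    (bra (ζ - ζ') : HT H K →L[ℂ] H) = bra ζ - bra ζ' := by
  have h := bra_add (H := H) (ζ - ζ') ζ'
  rw [sub_add_cancel] at h
  rw [h, add_sub_cancel_right]

theorem bra_tm [CompleteSpace H] (ζ : K) (x : H) (y : K) : bra ζ (tm x y) = ⟪ζ, y⟫_ℂ • x := by
  refine ext_inner_left ℂ fun x' => ?_
  rw [inner_bra, inner_tm, inner_smul_right, mul_comm]

theorem span_tm_dense : Dense (Submodule.span ℂ {z : HT H K | ∃ a b, z = tm a b} :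
    Set (HT H K)) := by
  have h : DenseRange ((↑) : H ⊗[ℂ] K → UniformSpace.Completion (H ⊗[ℂ] K)) :=
    UniformSpace.Completion.denseRange_coe
  refine Dense.mono ?_ h
  rintro _ ⟨w, rfl⟩
  induction w using TensorProduct.induction_on with
  | zero =>
    exact (UniformSpace.Completion.coe_zero (α := H ⊗[ℂ] K)).symm ▸ Submodule.zero_mem _
  | tmul x y => exact Submodule.subset_span ⟨x, y, rfl⟩
  | add x y hx hy =>
    have e := UniformSpace.Completion.coe_add x y
    rw [e]
    exact Submodule.add_mem _ hx hy

theorem ext_tm {w w' : HT H K} (h : ∀ (x : H) (y : K), ⟪tm x y, w⟫_ℂ = ⟪tm x y, w'⟫_ℂ) :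
    w = w' := by
  refine span_tm_dense.eq_of_inner_right (𝕜 := ℂ) ?_
  intro z hz
  induction hz using Submodule.span_induction with
  | mem z hz => obtain ⟨x, y, rfl⟩ := hz; exact h x y
  | zero => simp
  | add a b _ _ ha hb => rw [inner_add_left, inner_add_left, ha, hb]
  | smul c a _ ha => rw [inner_smul_left, inner_smul_left, ha]

theorem ext_bra [CompleteSpace H] {w w' : HT H K} (h : ∀ ζ : K, bra ζ w = bra ζ w') : w = w' :=
  ext_tm fun x y => by rw [← inner_bra, h, inner_bra]

theorem ext_tm_of_dense {A : Set H} {B : Set K} (hA : Dense A) (hB : Dense B) {w w' : HT H K}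
    (h : ∀ x ∈ A, ∀ y ∈ B, ⟪tm x y, w⟫_ℂ = ⟪tm x y, w'⟫_ℂ) : w = w' := by
  have h1 : ∀ x ∈ A, ∀ y, ⟪tm x y, w⟫_ℂ = ⟪tm x y, w'⟫_ℂ := by
    intro x hx y
    have c : ∀ z : HT H K, Continuous fun y => ⟪tmL x y, z⟫_ℂ := fun z => by fun_prop
    exact congrFun (Continuous.ext_on hB (c w) (c w') fun y hy => h x hx y hy) y
  refine ext_tm fun x y => ?_
  have c : ∀ z : HT H K, Continuous fun x => ⟪(ket y : H →L[ℂ] HT H K) x, z⟫_ℂ :=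
    fun z => by fun_prop
  exact congrFun (Continuous.ext_on hA (c w) (c w') fun x hx => h1 x hx y) x

/-! ### Linear maps on algebraic tensor products -/

/-- The inclusion of the algebraic tensor product of two subspaces in the Hilbert space
tensor product. -/
def algInclusion (A : Submodule ℂ H) (B : Submodule ℂ K) : (A ⊗[ℂ] B) →ₗ[ℂ] HT H K :=
  (UniformSpace.Completion.toComplₗᵢ (𝕜 := ℂ) (E := H ⊗[ℂ] K)).toLinearMap ∘ₗ
    TensorProduct.mapIncl A B

/-- Vector spaces are flat, so A ⊗ B embeds in H ⊗ K, which embeds isometrically in its completion.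
Because of this, bilinear maps define linear maps on `algTensor A B`. -/
theorem algInclusion_injective (A : Submodule ℂ H) (B : Submodule ℂ K) :
    Function.Injective (algInclusion A B) := by
  exact (UniformSpace.Completion.toComplₗᵢ (𝕜 := ℂ) (E := H ⊗[ℂ] K)).injective.comp
    (TensorProduct.map_injective_of_flat_flat _ _ A.subtype_injective B.subtype_injective)

theorem range_algInclusion (A : Submodule ℂ H) (B : Submodule ℂ K) :
    LinearMap.range (algInclusion A B) = algTensor A B := by
  apply le_antisymm
  · rintro _ ⟨w, rfl⟩
    induction w using TensorProduct.induction_on with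
    | zero => rw [map_zero]; exact Submodule.zero_mem _
    | tmul a b => exact tm_mem_algTensor a.2 b.2
    | add x y hx hy => rw [map_add]; exact Submodule.add_mem _ hx hy
  · refine Submodule.span_le.2 ?_
    rintro _ ⟨a, ha, b, hb, rfl⟩
    exact ⟨(⟨a, ha⟩ : A) ⊗ₜ (⟨b, hb⟩ : B), rfl⟩

/-- The algebraic tensor product as a subspace of the Hilbert space tensor product. -/
def algEquiv (A : Submodule ℂ H) (B : Submodule ℂ K) : (A ⊗[ℂ] B) ≃ₗ[ℂ] algTensor A B :=
  (LinearEquiv.ofInjective _ (algInclusion_injective A B)).trans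
    (LinearEquiv.ofEq _ _ (range_algInclusion A B))

theorem algEquiv_tmul {A : Submodule ℂ H} {B : Submodule ℂ K} (a : A) (b : B) :
    algEquiv A B (a ⊗ₜ b) = algKet b a := Subtype.ext rfl

variable {W : Type w} [AddCommGroup W] [Module ℂ W]

/-- The linear map on the algebraic tensor product given by a bilinear map. -/
def algLift {A : Submodule ℂ H} {B : Submodule ℂ K} :
    (A →ₗ[ℂ] B →ₗ[ℂ] W) →ₗ[ℂ] (algTensor A B →ₗ[ℂ] W) where
  toFun f := TensorProduct.lift f ∘ₗ (algEquiv A B).symm.toLinearMap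
  map_add' f f' := by
    have e : TensorProduct.lift (f + f') = TensorProduct.lift f + TensorProduct.lift f' :=
      TensorProduct.ext' fun _ _ => by simp
    rw [e, LinearMap.add_comp]
  map_smul' c f := by
    have e : TensorProduct.lift (c • f) = c • TensorProduct.lift f :=
      TensorProduct.ext' fun _ _ => by simp
    rw [e, LinearMap.smul_comp, RingHom.id_apply]

@[simp] theorem algLift_algKet {A : Submodule ℂ H} {B : Submodule ℂ K}
    (f : A →ₗ[ℂ] B →ₗ[ℂ] W) (a : A) (b : B) : algLift f (algKet b a) = f a b := by
  rw [← algEquiv_tmul]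
  simp [algLift]

theorem algTensor_induction {A : Submodule ℂ H} {B : Submodule ℂ K}
    {p : algTensor A B → Prop} (hz : p 0) (hk : ∀ (a : A) (b : B), p (algKet b a))
    (ha : ∀ x y, p x → p y → p (x + y)) (ξ : algTensor A B) : p ξ := by
  obtain ⟨w, rfl⟩ := (algEquiv A B).surjective ξ
  induction w using TensorProduct.induction_on with
  | zero => rwa [map_zero]
  | tmul a b => rw [algEquiv_tmul]; exact hk a b
  | add x y hx hy => rw [map_add]; exact ha _ _ hx hy

end TensorBasics

/-! ### Hilbert basis expansions in a tensor product -/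

section Expansion

variable {H : Type u} {K : Type v} [NormedAddCommGroup H] [InnerProductSpace ℂ H]
  [NormedAddCommGroup K] [InnerProductSpace ℂ K]
  {ι : Type w}

theorem orthogonalFamily_ket (b : ι → K) (hb : Orthonormal ℂ b) :
    OrthogonalFamily ℂ (fun _ : ι => H) fun i =>
      ({ toLinearMap := (ket (b i) : H →L[ℂ] HT H K).toLinearMap
         norm_map' := fun x => by
          change ‖tm x (b i)‖ = ‖x‖
          rw [norm_tm, hb.1 i, mul_one] } : H →ₗᵢ[ℂ] HT H K) := by
  intro i j hij x y
  change ⟪tm x (b i), tm y (b j)⟫_ℂ = 0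
  rw [inner_tm, hb.2 hij, mul_zero]

/-- The maps x ↦ x ⊗ b_i are isometries with mutually orthogonal ranges, so square summable
coefficients give a convergent series. -/
theorem exists_tm_expansion (b : HilbertBasis ι ℂ K) (f : ι → H)
    {C : ℝ} (hf : ∀ s : Finset ι, ∑ i ∈ s, ‖f i‖ ^ 2 ≤ C) :
    ∃ w : HT H K, HasSum (fun i => tm (f i) (b i)) w := by
  have h : Summable fun i => ‖f i‖ ^ 2 := summable_of_sum_le (fun _ => by positivity) hf
  exact ((orthogonalFamily_ket (H := H) b b.orthonormal).summable_iff_norm_sq_summable f).2 h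

/-- Parseval for several vectors under one joint bound on the partial sums. Matrix level estimates
need this form, because there only the sum over the rows is controlled. -/
theorem sum_norm_sq_expansion_le {n : ℕ} (b : HilbertBasis ι ℂ K) (f : Fin n → ι → H)
    {C : ℝ} (hf : ∀ s : Finset ι, ∑ j, ∑ i ∈ s, ‖f j i‖ ^ 2 ≤ C) {w : Fin n → HT H K}
    (hw : ∀ j, HasSum (fun i => tm (f j i) (b i)) (w j)) : ∑ j, ‖w j‖ ^ 2 ≤ C := by
  have ht : Filter.Tendsto (fun s : Finset ι => ∑ j, ‖∑ i ∈ s, tm (f j i) (b i)‖ ^ 2)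
      Filter.atTop (nhds (∑ j, ‖w j‖ ^ 2)) :=
    tendsto_finsetSum _ fun j _ => ((hw j).norm.pow 2)
  refine le_of_tendsto' ht fun s => ?_
  refine le_trans (le_of_eq (Finset.sum_congr rfl fun j _ => ?_)) (hf s)
  exact (orthogonalFamily_ket (H := H) b b.orthonormal).norm_sum (f j) s

end Expansion

/-! ### Exponential vectors -/

section Exponential

variable {H : Type u} [NormedAddCommGroup H] [InnerProductSpace ℂ H]

theorem inner_vecPow (f g : H) : ∀ n : ℕ, ⟪vecPow f n, vecPow g n⟫_ℂ = ⟪f, g⟫_ℂ ^ n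
  | 0 => by
    change ⟪(EuclideanSpace.single PUnit.unit (1 : ℂ) : EuclideanSpace ℂ PUnit.{u + 1}),
      EuclideanSpace.single PUnit.unit (1 : ℂ)⟫_ℂ = _
    simp
  | n + 1 => by
    change ⟪(tm f (vecPow f n) : HT H (tensorPow H n).carrier), tm g (vecPow g n)⟫_ℂ = _
    rw [inner_tm, inner_vecPow f g n, pow_succ']

theorem vecPow_smul (c : ℂ) (f : H) : ∀ n : ℕ, vecPow (c • f) n = c ^ n • vecPow f n
  | 0 => by rw [pow_zero, one_smul]; rfl
  | n + 1 => by
    change (tm (c • f) (vecPow (c • f) n) : HT H (tensorPow H n).carrier)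
      = c ^ (n + 1) • (tm f (vecPow f n) : HT H (tensorPow H n).carrier)
    rw [tm_smul_left, vecPow_smul c f n, tm_smul_right, smul_smul, pow_succ']

theorem expFull_apply (f : H) (n : ℕ) :
    expFull f n = (((Real.sqrt n.factorial)⁻¹ : ℝ) : ℂ) • vecPow f n := rfl

theorem inner_expVec (f g : H) : ⟪expVec f, expVec g⟫_ℂ = Complex.exp ⟪f, g⟫_ℂ := by
  have h : HasSum (fun n => ⟪expFull f n, expFull g n⟫_ℂ) ⟪expVec f, expVec g⟫_ℂ :=
    lp.hasSum_inner (expFull f) (expFull g)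
  have h' := NormedSpace.expSeries_div_hasSum_exp (⟪f, g⟫_ℂ)
  rw [← Complex.exp_eq_exp_ℂ] at h'
  have e : (fun n => ⟪expFull f n, expFull g n⟫_ℂ) = fun n : ℕ => ⟪f, g⟫_ℂ ^ n / n.factorial := by
    funext n
    rw [expFull_apply, expFull_apply, inner_smul_left, inner_smul_right, inner_vecPow,
      Complex.conj_ofReal, ← mul_assoc, ← Complex.ofReal_mul, ← mul_inv,
      Real.mul_self_sqrt (by positivity)]
    push_cast
    field_simp
  rw [e] at h
  exact h.unique h'

/-- The squared distance ‖ε(f) - ε(g)‖² is a combination of values of the kernel exp⟨·,·⟩, which is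
continuous in f and cancels at f = g. -/
theorem continuous_expVec : Continuous (expVec : H → SymFock H) := by
  rw [continuous_iff_continuousAt]
  intro g
  rw [ContinuousAt, tendsto_iff_norm_sub_tendsto_zero]
  have e : ∀ f : H, ‖expVec f - expVec g‖ =
      Real.sqrt (RCLike.re (Complex.exp ⟪f, f⟫_ℂ - Complex.exp ⟪f, g⟫_ℂ
        - (Complex.exp ⟪g, f⟫_ℂ - Complex.exp ⟪g, g⟫_ℂ))) := by
    intro f
    rw [@norm_eq_sqrt_re_inner ℂ, inner_sub_left, inner_sub_right, inner_sub_right,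
      inner_expVec, inner_expVec, inner_expVec, inner_expVec]
  simp_rw [e]
  have c : Continuous fun f : H => Real.sqrt (RCLike.re (Complex.exp ⟪f, f⟫_ℂ
      - Complex.exp ⟪f, g⟫_ℂ - (Complex.exp ⟪g, f⟫_ℂ - Complex.exp ⟪g, g⟫_ℂ))) := by
    refine Real.continuous_sqrt.comp (RCLike.continuous_re.comp ?_)
    have := Complex.continuous_exp
    fun_prop
  convert c.tendsto g using 2
  simp

theorem eq_zero_of_hasSum_pow_zero {a : ℕ → ℂ}
    (h : ∀ z : ℂ, HasSum (fun n => z ^ n * a n) 0) (n : ℕ) : a n = 0 := by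
  let p : FormalMultilinearSeries ℂ ℂ ℂ := fun n =>
    ContinuousMultilinearMap.mkPiRing ℂ (Fin n) (a n)
  have hc : ∀ n, p.coeff n = a n := fun n => by simp [p, FormalMultilinearSeries.coeff]
  have hp : HasFPowerSeriesAt (0 : ℂ → ℂ) p 0 := by
    rw [hasFPowerSeriesAt_iff]
    refine Filter.Eventually.of_forall fun z => ?_
    simpa [hc] using h z
  have := hp.eq_zero
  rw [← hc n, this]
  simp [FormalMultilinearSeries.coeff]

/-- Replacing f by c f makes ⟨z, ε(c f)⟩ a power series in c whose coefficients are multiples of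
⟨z_n, f^{⊗n}⟩. A vanishing series has vanishing coefficients, so z is orthogonal to all symmetric
powers, hence to the symmetric part that contains it. -/
theorem eq_zero_of_inner_expVec {z : SymFock H} (h : ∀ f : H, ⟪z, expVec f⟫_ℂ = 0) : z = 0 := by
  have h1 : ∀ (f : H) (n : ℕ), ⟪(z.1 : FullFock H) n, vecPow f n⟫_ℂ = 0 := by
    intro f n
    have h2 : ∀ c : ℂ, HasSum (fun n => c ^ n * ⟪(z.1 : FullFock H) n, expFull f n⟫_ℂ) 0 := by
      intro c
      have h3 : HasSum (fun n => ⟪(z.1 : FullFock H) n, expFull (c • f) n⟫_ℂ)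
          ⟪z, expVec (c • f)⟫_ℂ := lp.hasSum_inner z.1 (expFull (c • f))
      rw [h] at h3
      convert h3 using 2 with n
      rw [expFull_apply, expFull_apply, vecPow_smul, inner_smul_right, inner_smul_right,
        inner_smul_right]
      ring
    have h4 := eq_zero_of_hasSum_pow_zero h2 n
    rw [expFull_apply, inner_smul_right] at h4
    refine (mul_eq_zero.1 h4).resolve_left ?_
    exact Complex.ofReal_ne_zero.2 (by positivity)
  have h5 : (z.1 : FullFock H) ∈ (symPart H)ᗮ := by
    unfold symPart
    rw [Submodule.orthogonal_closure, Submodule.mem_orthogonal]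
    intro y hy
    induction hy using Submodule.span_induction with
    | mem y hy =>
      obtain ⟨n, f, rfl⟩ := hy
      rw [lp.inner_single_left, ← inner_conj_symm, h1, map_zero]
    | zero => simp
    | add a b _ _ ha hb => rw [inner_add_left, ha, hb, add_zero]
    | smul c a _ ha => rw [inner_smul_left, ha, mul_zero]
  have h6 : ⟪z.1, z.1⟫_ℂ = 0 := (Submodule.mem_orthogonal _ _).1 h5 z.1 z.2
  exact Subtype.ext (inner_self_eq_zero.1 h6)

/-- The monoid homomorphism `f ↦ exp ⟨f, g⟩`. -/
def expHom (g : H) : Multiplicative H →* ℂ where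
  toFun f := Complex.exp ⟪f.toAdd, g⟫_ℂ
  map_one' := by simp
  map_mul' f f' := by rw [toAdd_mul, inner_add_left, Complex.exp_add]

theorem expHom_injective : Function.Injective (expHom : H → Multiplicative H →* ℂ) := by
  intro g g' h
  by_contra hne
  have hd : 0 < ‖g - g'‖ := norm_pos_iff.2 (sub_ne_zero.2 hne)
  have h1 : ∀ f : H, Complex.exp ⟪f, g - g'⟫_ℂ = 1 := by
    intro f
    have := DFunLike.congr_fun h (Multiplicative.ofAdd f)
    change Complex.exp ⟪f, g⟫_ℂ = Complex.exp ⟪f, g'⟫_ℂ at this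
    rw [inner_sub_right, Complex.exp_sub, this, div_self (Complex.exp_ne_zero _)]
  have h2 := h1 (g - g')
  rw [inner_self_eq_norm_sq_to_K] at h2
  have h3 : Real.exp (‖g - g'‖ ^ 2) = 1 := by
    have : Complex.exp (((‖g - g'‖ ^ 2 : ℝ)) : ℂ) = 1 := by push_cast; exact h2
    exact_mod_cast this
  rw [Real.exp_eq_one_iff] at h3
  exact (pow_pos hd 2).ne' h3

/-- Pairing with exponential vectors sends ε(g) to the character f ↦ exp⟨f,g⟩ of the additive group
H. Distinct g give distinct characters, and distinct characters are independent. -/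
theorem linearIndependent_expVec : LinearIndependent ℂ (expVec : H → SymFock H) := by
  have h := (linearIndependent_monoidHom (Multiplicative H) ℂ).comp expHom expHom_injective
  let L : SymFock H →ₗ[ℂ] (Multiplicative H → ℂ) :=
    { toFun := fun z f => ⟪expVec f.toAdd, z⟫_ℂ
      map_add' := fun z z' => by ext f; simp
      map_smul' := fun c z => by ext f; simp }
  refine LinearIndependent.of_comp L ?_
  have e : (L ∘ expVec : H → Multiplicative H → ℂ) = (fun f => f : (Multiplicative H →* ℂ) →
      Multiplicative H → ℂ) ∘ expHom := by
    ext g f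
    exact inner_expVec _ _
  rw [e]
  exact h

end Exponential

/-! ### Step functions -/

section Steps

variable {𝔨 : Type u} [NormedAddCommGroup 𝔨] [InnerProductSpace ℂ 𝔨]
  {D : Submodule ℂ 𝔨}

theorem step_mono {D D' : Submodule ℂ 𝔨} (h : D ≤ D') : step D ≤ step D' :=
  Submodule.span_mono (by rintro _ ⟨d, hd, t, ht, e⟩; exact ⟨d, h hd, t, ht, e⟩)

theorem step_exists_simpleFunc (g : step D) : ∃ f : SimpleFunc ℝ 𝔨, ∀ s, f s = (g : ℝ → 𝔨) s := by
  obtain ⟨g, hg⟩ := g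
  change ∃ f : SimpleFunc ℝ 𝔨, ∀ s, f s = g s
  induction hg using Submodule.span_induction with
  | mem g hg =>
    obtain ⟨d, _, t, _, rfl⟩ := hg
    refine ⟨SimpleFunc.piecewise (Ico 0 t) measurableSet_Ico (SimpleFunc.const ℝ d)
      (SimpleFunc.const ℝ 0), fun s => ?_⟩
    by_cases h : s ∈ Ico 0 t
    · rw [SimpleFunc.piecewise_apply, if_pos h, indicator_of_mem h]; rfl
    · rw [SimpleFunc.piecewise_apply, if_neg h, indicator_of_notMem h]; rfl
  | zero => exact ⟨SimpleFunc.const ℝ 0, fun _ => rfl⟩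
  | add f g _ _ hf hg =>
    obtain ⟨f', hf⟩ := hf
    obtain ⟨g', hg⟩ := hg
    exact ⟨f' + g', fun s => by simp [hf, hg]⟩
  | smul c g _ hg =>
    obtain ⟨g', hg⟩ := hg
    exact ⟨g'.map fun x => c • x, fun s => by simp [hg]⟩

theorem step_finite_range (g : step D) : (range (g : ℝ → 𝔨)).Finite := by
  obtain ⟨f, hf⟩ := step_exists_simpleFunc g
  have : (g : ℝ → 𝔨) = f := funext fun s => (hf s).symm
  rw [this]
  exact f.finite_range

theorem step_stronglyMeasurable (g : step D) : StronglyMeasurable (g : ℝ → 𝔨) := by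
  obtain ⟨f, hf⟩ := step_exists_simpleFunc g
  have : (g : ℝ → 𝔨) = f := funext fun s => (hf s).symm
  rw [this]
  exact f.stronglyMeasurable

/-- Right continuity in its strongest form. It makes a step function recoverable from its class in
L², and it gives right derivatives at every point to the integrals below. -/
theorem step_eventually_eq (g : step D) (s : ℝ) :
    ∀ᶠ r in nhdsWithin s (Ici s), (g : ℝ → 𝔨) r = (g : ℝ → 𝔨) s := by
  obtain ⟨g, hg⟩ := g
  change ∀ᶠ r in nhdsWithin s (Ici s), g r = g s
  induction hg using Submodule.span_induction with
  | mem g hg =>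
    obtain ⟨d, _, t, _, rfl⟩ := hg
    by_cases hs : s < 0
    · filter_upwards [mem_nhdsWithin_of_mem_nhds (Iio_mem_nhds hs)] with r hr
      rw [indicator_of_notMem (fun h => not_lt.2 h.1 hr),
        indicator_of_notMem (fun h => not_lt.2 h.1 hs)]
    · by_cases hst : s < t
      · filter_upwards [mem_nhdsWithin_of_mem_nhds (Iio_mem_nhds hst), self_mem_nhdsWithin]
          with r hr hr'
        rw [indicator_of_mem (show r ∈ Ico 0 t from ⟨(not_lt.1 hs).trans hr', hr⟩),
          indicator_of_mem (show s ∈ Ico 0 t from ⟨not_lt.1 hs, hst⟩)]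
      · filter_upwards [self_mem_nhdsWithin] with r hr
        rw [indicator_of_notMem (fun h => hst (lt_of_le_of_lt hr h.2)),
          indicator_of_notMem (fun h => hst h.2)]
  | zero => exact Filter.Eventually.of_forall fun _ => rfl
  | add f g _ _ hf hg => filter_upwards [hf, hg] with r h1 h2; simp [h1, h2]
  | smul c g _ hg => filter_upwards [hg] with r h; simp [h]

theorem step_eq_zero_of_neg (g : step D) {s : ℝ} (hs : s < 0) : (g : ℝ → 𝔨) s = 0 := by
  obtain ⟨g, hg⟩ := g
  change g s = 0
  induction hg using Submodule.span_induction with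
  | mem g hg =>
    obtain ⟨d, _, t, _, rfl⟩ := hg
    exact indicator_of_notMem (fun h => not_lt.2 h.1 hs) _
  | zero => rfl
  | add f g _ _ hf hg => simp [hf, hg]
  | smul c g _ hg => simp [hg]

theorem step_exists_support (g : step D) : ∃ T : ℝ, 0 ≤ T ∧ ∀ s, T ≤ s → (g : ℝ → 𝔨) s = 0 := by
  obtain ⟨g, hg⟩ := g
  change ∃ T : ℝ, 0 ≤ T ∧ ∀ s, T ≤ s → g s = 0
  induction hg using Submodule.span_induction with
  | mem g hg =>
    obtain ⟨d, _, t, ht, rfl⟩ := hg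
    exact ⟨t, ht, fun s hs => indicator_of_notMem (fun h => not_lt.2 hs h.2) _⟩
  | zero => exact ⟨0, le_rfl, fun _ _ => rfl⟩
  | add f g _ _ hf hg =>
    obtain ⟨T, hT, h⟩ := hf
    obtain ⟨T', _, h'⟩ := hg
    exact ⟨max T T', le_max_of_le_left hT, fun s hs => by
      simp [h s ((le_max_left _ _).trans hs), h' s ((le_max_right _ _).trans hs)]⟩
  | smul c g _ hg =>
    obtain ⟨T, hT, h⟩ := hg
    exact ⟨T, hT, fun s hs => by simp [h s hs]⟩

theorem step_exists_bound (g : step D) : ∃ m : ℝ, 0 ≤ m ∧ ∀ s, ‖(g : ℝ → 𝔨) s‖ ≤ m := by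
  obtain ⟨m, hm⟩ := ((step_finite_range g).image norm).bddAbove
  have h : ∀ s, ‖(g : ℝ → 𝔨) s‖ ≤ m := fun s => hm ⟨_, ⟨s, rfl⟩, rfl⟩
  exact ⟨m, (norm_nonneg _).trans (h 0), h⟩

/-- Both functions are constant on a short interval to the right of s. Such an interval has positive
measure, so it contains a point where they agree. -/
theorem step_ext_of_ae {g g' : step D}
    (h : (g : ℝ → 𝔨) =ᵐ[volume.restrict (Ici (0 : ℝ))] g') : g = g' := by
  refine Subtype.ext (funext fun s => ?_)
  by_cases hs : s < 0
  · rw [step_eq_zero_of_neg g hs, step_eq_zero_of_neg g' hs]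
  · have h1 := (step_eventually_eq g s).and (step_eventually_eq g' s)
    rw [eventually_nhdsWithin_iff, Metric.eventually_nhds_iff] at h1
    obtain ⟨δ, hδ, h1⟩ := h1
    have h2 : ∀ᵐ r, r ∈ Ici (0 : ℝ) → (g : ℝ → 𝔨) r = (g' : ℝ → 𝔨) r :=
      (ae_restrict_iff' measurableSet_Ici).1 h
    have h3 : ∃ r ∈ Ioo s (s + δ), r ∈ Ici (0 : ℝ) → (g : ℝ → 𝔨) r = (g' : ℝ → 𝔨) r := by
      by_contra hcon
      push Not at hcon
      have : volume (Ioo s (s + δ)) = 0 :=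
        measure_mono_null (fun r hr => by
          simp only [mem_compl_iff, mem_ofPred_eq]
          intro hh
          exact (hcon r hr).2 (hh (hcon r hr).1)) (mem_ae_iff.1 h2)
      rw [Real.volume_Ioo] at this
      simp at this
      linarith
    obtain ⟨r, hr, h4⟩ := h3
    have h5 := h1 (y := r) (by
      rw [Real.dist_eq, abs_lt]; constructor <;> linarith [hr.1, hr.2]) (le_of_lt hr.1)
    rw [← h5.1, ← h5.2]
    exact h4 ((not_lt.1 hs).trans hr.1.le)

/-- The class of a step function in `L²`. -/
def stepLp (D : Submodule ℂ 𝔨) : step D →ₗ[ℂ] L2 𝔨 where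
  toFun g := (step_memLp g).toLp _
  map_add' g g' := MemLp.toLp_add (step_memLp g) (step_memLp g')
  map_smul' c g := MemLp.toLp_const_smul c (step_memLp g)

theorem expStep_eq (g : step D) : expStep g = expVec (stepLp D g) := rfl

theorem stepLp_injective : Function.Injective (stepLp D) := by
  intro g g' h
  refine step_ext_of_ae ?_
  exact (MemLp.coeFn_toLp (step_memLp g)).symm.trans
    ((Lp.ext_iff.1 h).trans (MemLp.coeFn_toLp (step_memLp g')))

theorem linearIndependent_expStep :
    LinearIndependent ℂ (fun g : step D => expStep g) :=
  linearIndependent_expVec.comp _ stepLp_injective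

/-- The exponential vectors of step functions form a basis of their span. -/
def expBasis (D : Submodule ℂ 𝔨) : Module.Basis (step D) ℂ (exps D) :=
  Module.Basis.span linearIndependent_expStep

@[simp] theorem expBasis_apply (g : step D) : expBasis D g = expD g :=
  Module.Basis.span_apply linearIndependent_expStep g

/-- The `L²` inner product of two functions on the half-line. -/
def ip (f g : ℝ → 𝔨) : ℂ := ∫ s in Ici (0 : ℝ), ⟪f s, g s⟫_ℂ

theorem inner_expStep {D' : Submodule ℂ 𝔨} (g' : step D') (g : step D) :
    ⟪expStep g', expStep g⟫_ℂ = Complex.exp (ip (g' : ℝ → 𝔨) (g : ℝ → 𝔨)) := by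
  rw [expStep_eq, expStep_eq, inner_expVec, L2.inner_def]
  congr 1
  refine integral_congr_ae ?_
  filter_upwards [MemLp.coeFn_toLp (step_memLp g'), MemLp.coeFn_toLp (step_memLp g)] with s h h'
  change ⟪(step_memLp g').toLp _ s, (step_memLp g).toLp _ s⟫_ℂ = _
  rw [h, h']

variable [CompleteSpace 𝔨]

/-- The primitive vanishes identically, and by Lebesgue differentiation its derivative is f almost
everywhere. -/
theorem ae_eq_zero_of_integral_Ico {f : ℝ → 𝔨} (hf : LocallyIntegrable f)
    (h0 : ∀ t ≤ 0, f t = 0) (h : ∀ t, 0 ≤ t → ∫ s in Ico 0 t, f s = 0) : f =ᵐ[volume] 0 := by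
  have hF : ∀ t, ∫ s in (0 : ℝ)..t, f s = 0 := by
    intro t
    rcases le_total 0 t with ht | ht
    · rw [intervalIntegral.integral_of_le ht, ← integral_Ico_eq_integral_Ioc, h t ht]
    · rw [intervalIntegral.integral_of_ge ht, setIntegral_eq_zero_of_forall_eq_zero, neg_zero]
      exact fun s hs => h0 s hs.2
  filter_upwards [LocallyIntegrable.ae_hasDerivAt_integral hf] with t ht
  have h1 := ht 0
  simp_rw [hF] at h1
  exact h1.unique (hasDerivAt_const t 0)

/-- If f is orthogonal to every d 1_{[0,t[}, then each ∫_0^t f is orthogonal to the dense set D, so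
every such integral is zero and f vanishes. -/
theorem stepLp_dense (hD : Dense (D : Set 𝔨)) : DenseRange (stepLp D) := by
  have h : (LinearMap.range (stepLp D)).topologicalClosure = ⊤ := by
    rw [Submodule.topologicalClosure_eq_top_iff, Submodule.eq_bot_iff]
    intro f hf
    rw [Submodule.mem_orthogonal] at hf
    -- f is extended by zero to the whole line. The open half-line is used because the
    -- differentiation lemma asks for the value zero at 0 as well.
    have hloc : LocallyIntegrable ((Ioi (0 : ℝ)).indicator f) := by
      have hm : MemLp ((Ioi (0 : ℝ)).indicator f) 2 := by
        have h1 := (Lp.memLp f).mono_measure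
          (Measure.restrict_mono (Ioi_subset_Ici (le_refl (0 : ℝ))) le_rfl)
        exact (memLp_indicator_iff_restrict measurableSet_Ioi).2 h1
      exact hm.locallyIntegrable (by norm_num)
    have hz := ae_eq_zero_of_integral_Ico hloc
      (fun t ht => indicator_of_notMem (not_lt.2 ht) _) ?_
    · refine Lp.ext ?_
      have h1 : ∀ᵐ s ∂(volume.restrict (Ici (0 : ℝ))), s ∈ Ioi (0 : ℝ) := by
        rw [← restrict_Ioi_eq_restrict_Ici]
        exact ae_restrict_mem measurableSet_Ioi
      filter_upwards [ae_restrict_of_ae hz, h1,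
        Lp.coeFn_zero 𝔨 2 (volume.restrict (Ici (0 : ℝ)))] with s hs hs' hs''
      rw [indicator_of_mem hs'] at hs
      rw [hs, hs'']
    · intro t ht
      have hμ : (volume.restrict (Ici (0 : ℝ))) (Ico 0 t) ≠ ⊤ :=
        ((Measure.restrict_apply_le _ _).trans_lt measure_Ico_lt_top).ne
      have e : ∫ s in Ico 0 t, (Ioi (0 : ℝ)).indicator f s
          = ∫ s in Ico 0 t, f s ∂(volume.restrict (Ici (0 : ℝ))) := by
        rw [Measure.restrict_restrict measurableSet_Ico,
          inter_eq_left.2 (Ico_subset_Ici_self : Ico 0 t ⊆ Ici (0 : ℝ)), integral_Ico_eq_integral_Ioo,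
          integral_Ico_eq_integral_Ioo]
        exact setIntegral_congr_fun measurableSet_Ioo fun s hs => indicator_of_mem hs.1 _
      rw [e]
      refine hD.eq_zero_of_inner_right (𝕜 := ℂ) ?_
      intro d hd
      have hg : (Ico 0 t).indicator (fun _ => d) ∈ step D :=
        Submodule.subset_span ⟨d, hd, t, ht, rfl⟩
      have h2 := hf _ ⟨⟨_, hg⟩, rfl⟩
      rw [← L2.inner_indicatorConstLp_eq_inner_setIntegral ℂ measurableSet_Ico hμ d f]
      exact h2
  rw [DenseRange, ← LinearMap.coe_range, dense_iff_closure_eq,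
    ← Submodule.topologicalClosure_coe, h]
  rfl

theorem eq_zero_of_inner_expStep (hD : Dense (D : Set 𝔨)) {z : Fock 𝔨}
    (h : ∀ g : step D, ⟪z, expStep g⟫_ℂ = 0) : z = 0 := by
  refine eq_zero_of_inner_expVec fun f => ?_
  have c : Continuous fun f : L2 𝔨 => ⟪z, expVec f⟫_ℂ := continuous_const.inner continuous_expVec
  exact congrFun ((stepLp_dense hD).equalizer c continuous_const (funext fun g => h g)) f

theorem exps_dense (hD : Dense (D : Set 𝔨)) : Dense (exps D : Set (Fock 𝔨)) := by
  have h : (exps D).topologicalClosure = ⊤ := by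
    rw [Submodule.topologicalClosure_eq_top_iff, Submodule.eq_bot_iff]
    intro z hz
    refine eq_zero_of_inner_expStep hD fun g => ?_
    have h1 : ⟪expStep g, z⟫_ℂ = 0 := (Submodule.mem_orthogonal _ _).1 hz _ (expD g).2
    rw [← inner_conj_symm, h1, map_zero]
  rw [dense_iff_closure_eq, ← Submodule.topologicalClosure_coe, h]
  rfl

theorem ext_expStep {𝔥' : Type v} [NormedAddCommGroup 𝔥'] [InnerProductSpace ℂ 𝔥']
    {E : Submodule ℂ 𝔥'} (hE : Dense (E : Set 𝔥')) (hD : Dense (D : Set 𝔨))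
    {w w' : HT 𝔥' (Fock 𝔨)}
    (h : ∀ v ∈ E, ∀ g : step D, ⟪tm v (expStep g), w⟫_ℂ = ⟪tm v (expStep g), w'⟫_ℂ) :
    w = w' := by
  refine ext_tm_of_dense hE (exps_dense hD) fun x hx y hy => ?_
  induction hy using Submodule.span_induction with
  | mem y hy => obtain ⟨g, rfl⟩ := hy; exact h x hx g
  | zero => rw [tm_zero_right, inner_zero_left, inner_zero_left]
  | add a b _ _ ha hb => rw [tm_add_right, inner_add_left, inner_add_left, ha, hb]
  | smul c a _ ha => rw [tm_smul_right, inner_smul_left, inner_smul_left, ha]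

end Steps

/-! ### Bounds at prescribed matrix levels -/

section LevelBound

/-- `‖A‖ ≤ C` at all matrix levels in `S`. -/
def HasLevelBound {V : Type u} {W : Type v} [AddCommGroup V] [Module ℂ V] [MatrixNorm V]
    [AddCommGroup W] [Module ℂ W] [MatrixNorm W] (S : Set ℕ) (A : V →ₗ[ℂ] W) (C : ℝ) : Prop :=
  ∀ n ∈ S, ∀ X : Matrix (Fin n) (Fin n) V, mnorm (X.map A) ≤ C * mnorm X

theorem hasLevelBound_univ_iff {V : Type u} {W : Type v} [AddCommGroup V] [Module ℂ V]
    [MatrixNorm V] [AddCommGroup W] [Module ℂ W] [MatrixNorm W] {A : V →ₗ[ℂ] W} {C : ℝ} :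
    HasLevelBound univ A C ↔ HasCBBound A C :=
  ⟨fun h n X => h n trivial X, fun h n _ X => h n X⟩

theorem hasLevelBound_one_iff {V : Type u} {W : Type v} [AddCommGroup V] [Module ℂ V]
    [MatrixNorm V] [AddCommGroup W] [Module ℂ W] [MatrixNorm W] {A : V →ₗ[ℂ] W} {C : ℝ} :
    HasLevelBound {1} A C ↔ HasBound A C := by
  constructor
  · intro h x
    exact h 1 rfl (Matrix.of fun _ _ => x)
  · rintro h n rfl X
    have e : X = Matrix.of fun _ _ => X 0 0 := by
      ext i j
      rw [Subsingleton.elim i 0, Subsingleton.elim j 0]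
      rfl
    rw [e]
    exact h (X 0 0)

/-- The matrix levels at which `𝔨`-boundedness is measured. -/
def kLevels (𝔨 : Type w) [NormedAddCommGroup 𝔨] [InnerProductSpace ℂ 𝔨] : Set ℕ :=
  {n | FiniteDimensional ℂ 𝔨 → n = 1}

theorem one_mem_kLevels (𝔨 : Type w) [NormedAddCommGroup 𝔨] [InnerProductSpace ℂ 𝔨] :
    1 ∈ kLevels 𝔨 := fun _ => rfl

theorem kLevels_of_finite (𝔨 : Type w) [NormedAddCommGroup 𝔨] [InnerProductSpace ℂ 𝔨]
    (h : FiniteDimensional ℂ 𝔨) : kLevels 𝔨 = {1} :=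
  Set.ext fun _ => ⟨fun hn => hn h, fun hn _ => hn⟩

theorem kLevels_of_infinite (𝔨 : Type w) [NormedAddCommGroup 𝔨] [InnerProductSpace ℂ 𝔨]
    (h : ¬ FiniteDimensional ℂ 𝔨) : kLevels 𝔨 = univ :=
  Set.ext fun _ => ⟨fun _ => trivial, fun _ h' => absurd h' h⟩

/-- Merges the finite and infinite dimensional cases of 𝔨-boundedness, so that later estimates need
no case distinction. -/
theorem hasLevelBound_kLevels_iff {𝔨 : Type w} [NormedAddCommGroup 𝔨] [InnerProductSpace ℂ 𝔨]
    {V : Type u} {W : Type v} [AddCommGroup V] [Module ℂ V]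
    [MatrixNorm V] [AddCommGroup W] [Module ℂ W] [MatrixNorm W] {A : V →ₗ[ℂ] W} {C : ℝ} :
    HasLevelBound (kLevels 𝔨) A C ↔ HasKBound 𝔨 A C := by
  by_cases h : FiniteDimensional ℂ 𝔨
  · rw [kLevels_of_finite 𝔨 h, hasLevelBound_one_iff, HasKBound]
    tauto
  · rw [kLevels_of_infinite 𝔨 h, hasLevelBound_univ_iff, HasKBound]
    tauto

end LevelBound

/-! ### Consequences of Ruan's axioms -/

section OperatorSpaceBasics

variable {V : Type u} [NormedAddCommGroup V] [NormedSpace ℂ V] [OperatorSpace V]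

theorem mnorm_zero {n : ℕ} : mnorm (0 : Matrix (Fin n) (Fin n) V) = 0 := by
  have h := OperatorSpace.mnorm_smul n (0 : ℂ) (0 : Matrix (Fin n) (Fin n) V)
  rw [zero_smul, norm_zero, zero_mul] at h
  exact h

theorem mnorm_nonneg {n : ℕ} (X : Matrix (Fin n) (Fin n) V) : 0 ≤ mnorm X := by
  have h1 : mnorm (X + (-1 : ℂ) • X) ≤ mnorm X + mnorm ((-1 : ℂ) • X) :=
    OperatorSpace.mnorm_add_le n _ _
  have h2 : mnorm ((-1 : ℂ) • X) = ‖(-1 : ℂ)‖ * mnorm X := OperatorSpace.mnorm_smul n _ _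
  rw [h2, neg_one_smul, add_neg_cancel, mnorm_zero, norm_neg, norm_one, one_mul] at h1
  linarith

theorem mnorm_sum_le {n : ℕ} {ι : Type v} (s : Finset ι) (X : ι → Matrix (Fin n) (Fin n) V) :
    mnorm (∑ i ∈ s, X i) ≤ ∑ i ∈ s, mnorm (X i) := by
  classical
  induction s using Finset.induction_on with
  | empty => simp [mnorm_zero]
  | insert a s ha ih =>
    rw [Finset.sum_insert ha, Finset.sum_insert ha]
    exact (OperatorSpace.mnorm_add_le n _ _).trans (add_le_add_right ih _)

theorem mnorm_single (x : V) : mnorm (n := 1) (Matrix.of fun _ _ => x) = ‖x‖ :=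
  OperatorSpace.mnorm_one x

end OperatorSpaceBasics

/-! ### Matrix norms of operators as square sum estimates -/

section OpMatrix

variable {H : Type u} {G : Type v} [NormedAddCommGroup H] [InnerProductSpace ℂ H]
  [NormedAddCommGroup G] [InnerProductSpace ℂ G]

theorem opMatrix_apply {n : ℕ} (T : Matrix (Fin n) (Fin n) (H →L[ℂ] G))
    (v : PiLp 2 (fun _ : Fin n => H)) (i : Fin n) :
    opMatrix T v i = ∑ j, T i j (v j) := by
  simp [opMatrix]

theorem mnorm_op {n : ℕ} (T : Matrix (Fin n) (Fin n) (H →L[ℂ] G)) : mnorm T = ‖opMatrix T‖ := rfl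

theorem mnorm_op_nonneg {n : ℕ} (T : Matrix (Fin n) (Fin n) (H →L[ℂ] G)) : 0 ≤ mnorm T :=
  norm_nonneg (opMatrix T)

/-- Together with `mnorm_op_le` this turns a bound at level n into an inequality between square sums
of vectors, which can be integrated in time. -/
theorem sum_norm_sq_le_of_mnorm_le {n : ℕ} {T : Matrix (Fin n) (Fin n) (H →L[ℂ] G)} {C : ℝ}
    (h : mnorm T ≤ C) (v : Fin n → H) :
    ∑ i, ‖∑ j, T i j (v j)‖ ^ 2 ≤ C ^ 2 * ∑ j, ‖v j‖ ^ 2 := by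
  have h1 := (opMatrix T).le_of_opNorm_le h (WithLp.toLp 2 v)
  have h2 := pow_le_pow_left₀ (norm_nonneg _) h1 2
  rw [mul_pow, PiLp.norm_sq_eq_of_L2, PiLp.norm_sq_eq_of_L2] at h2
  simpa only [opMatrix_apply] using h2

theorem mnorm_op_le {n : ℕ} {T : Matrix (Fin n) (Fin n) (H →L[ℂ] G)} {C : ℝ} (hC : 0 ≤ C)
    (h : ∀ v : Fin n → H, ∑ i, ‖∑ j, T i j (v j)‖ ^ 2 ≤ C ^ 2 * ∑ j, ‖v j‖ ^ 2) :
    mnorm T ≤ C := by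
  refine (opMatrix T).opNorm_le_bound hC fun v => ?_
  refine le_of_sq_le_sq ?_ (by positivity)
  rw [mul_pow, PiLp.norm_sq_eq_of_L2, PiLp.norm_sq_eq_of_L2]
  simpa only [opMatrix_apply] using h v

end OpMatrix

/-! ### Calculus of level bounds for operator-valued maps -/

section OperatorValued

variable {V : Type w} [NormedAddCommGroup V] [NormedSpace ℂ V] [OperatorSpace V]
  {H : Type u} {G : Type v} [NormedAddCommGroup H] [InnerProductSpace ℂ H]
  [NormedAddCommGroup G] [InnerProductSpace ℂ G] {S : Set ℕ}

theorem HasLevelBound.sum_le {A : V →ₗ[ℂ] (H →L[ℂ] G)} {C : ℝ} (h : HasLevelBound S A C)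
    {n : ℕ} (hn : n ∈ S) (X : Matrix (Fin n) (Fin n) V) (v : Fin n → H) :
    ∑ i, ‖∑ j, A (X i j) (v j)‖ ^ 2 ≤ (C * mnorm X) ^ 2 * ∑ j, ‖v j‖ ^ 2 :=
  sum_norm_sq_le_of_mnorm_le (h n hn X) v

theorem hasLevelBound_of_sum_le {A : V →ₗ[ℂ] (H →L[ℂ] G)} {C : ℝ} (hC : 0 ≤ C)
    (h : ∀ n ∈ S, ∀ (X : Matrix (Fin n) (Fin n) V) (v : Fin n → H),
      ∑ i, ‖∑ j, A (X i j) (v j)‖ ^ 2 ≤ (C * mnorm X) ^ 2 * ∑ j, ‖v j‖ ^ 2) :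
    HasLevelBound S A C :=
  fun n hn X => mnorm_op_le (mul_nonneg hC (mnorm_nonneg X)) (h n hn X)

theorem HasLevelBound.norm_apply_le {A : V →ₗ[ℂ] (H →L[ℂ] G)} {C : ℝ} (h : HasLevelBound S A C)
    (h1 : 1 ∈ S) (x : V) (v : H) : ‖A x v‖ ≤ C * ‖x‖ * ‖v‖ := by
  have h2 := h.sum_le h1 (Matrix.of fun _ _ => x) (fun _ => v)
  have h3 : 0 ≤ C * ‖x‖ := by
    have := h 1 h1 (Matrix.of fun _ _ => x)
    rw [mnorm_single] at this
    exact (mnorm_op_nonneg _).trans this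
  rw [mnorm_single] at h2
  simp only [Finset.univ_unique, Finset.sum_singleton, Matrix.of_apply] at h2
  rw [← mul_pow] at h2
  exact le_of_sq_le_sq h2 (by positivity)

theorem HasLevelBound.norm_le {A : V →ₗ[ℂ] (H →L[ℂ] G)} {C : ℝ} (h : HasLevelBound S A C)
    (h1 : 1 ∈ S) (hC : 0 ≤ C) (x : V) : ‖A x‖ ≤ C * ‖x‖ :=
  (A x).opNorm_le_bound (by positivity) (h.norm_apply_le h1 x)

theorem HasLevelBound.mono {A : V →ₗ[ℂ] (H →L[ℂ] G)} {C C' : ℝ} (h : HasLevelBound S A C)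
    (hC : C ≤ C') : HasLevelBound S A C' :=
  fun n hn X => (h n hn X).trans (mul_le_mul_of_nonneg_right hC (mnorm_nonneg X))

theorem opMatrix_add {n : ℕ} (T T' : Matrix (Fin n) (Fin n) (H →L[ℂ] G)) :
    opMatrix (T + T') = opMatrix T + opMatrix T' := by
  ext v i
  rw [add_apply, PiLp.add_apply, opMatrix_apply, opMatrix_apply, opMatrix_apply,
    ← Finset.sum_add_distrib]
  rfl

theorem HasLevelBound.add {A B : V →ₗ[ℂ] (H →L[ℂ] G)} {C C' : ℝ} (h : HasLevelBound S A C)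
    (h' : HasLevelBound S B C') : HasLevelBound S (A + B) (C + C') := by
  intro n hn X
  have e : X.map (A + B) = X.map A + X.map B := by ext; simp
  rw [e, add_mul, mnorm_op, opMatrix_add]
  exact (norm_add_le (opMatrix (X.map A)) (opMatrix (X.map B))).trans
    (add_le_add (h n hn X) (h' n hn X))

theorem HasLevelBound.smul {A : V →ₗ[ℂ] (H →L[ℂ] G)} {C : ℝ} (c : ℂ)
    (h : HasLevelBound S A C) : HasLevelBound S (c • A) (‖c‖ * C) := by
  intro n hn X
  have h0 : 0 ≤ C * mnorm X := (mnorm_op_nonneg _).trans (h n hn X)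
  rw [mul_assoc]
  refine mnorm_op_le (by positivity) fun v => ?_
  have e : ∀ i, ‖∑ j, (X.map (c • A)) i j (v j)‖ ^ 2
      = ‖c‖ ^ 2 * ‖∑ j, A (X i j) (v j)‖ ^ 2 := by
    intro i
    rw [← mul_pow, ← norm_smul, Finset.smul_sum]
    rfl
  rw [Finset.sum_congr rfl fun i _ => e i, ← Finset.mul_sum, mul_pow, mul_assoc]
  exact mul_le_mul_of_nonneg_left (h.sum_le hn X v) (by positivity)

theorem HasLevelBound.neg {A : V →ₗ[ℂ] (H →L[ℂ] G)} {C : ℝ}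
    (h : HasLevelBound S A C) : HasLevelBound S (-A) C := by
  have h1 := h.smul (-1)
  have e : (-1 : ℂ) • A = -A := by ext; simp
  rwa [norm_neg, norm_one, one_mul, e] at h1

theorem HasLevelBound.sub {A B : V →ₗ[ℂ] (H →L[ℂ] G)} {C C' : ℝ} (h : HasLevelBound S A C)
    (h' : HasLevelBound S B C') : HasLevelBound S (A - B) (C + C') := by
  simpa [sub_eq_add_neg] using h.add h'.neg

theorem hasLevelBound_zero : HasLevelBound S (0 : V →ₗ[ℂ] (H →L[ℂ] G)) 0 :=
  hasLevelBound_of_sum_le le_rfl fun n _ X v => by simp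

theorem HasLevelBound.sum {ι : Type*} (s : Finset ι) {A : ι → V →ₗ[ℂ] (H →L[ℂ] G)} {C : ι → ℝ}
    (h : ∀ i ∈ s, HasLevelBound S (A i) (C i)) : HasLevelBound S (∑ i ∈ s, A i) (∑ i ∈ s, C i) := by
  classical
  induction s using Finset.induction_on with
  | empty => simpa using hasLevelBound_zero
  | insert a s ha ih =>
    rw [Finset.sum_insert ha, Finset.sum_insert ha]
    exact (h a (Finset.mem_insert_self a s)).add
      (ih fun i hi => h i (Finset.mem_insert_of_mem hi))

/-- At a fixed level the square sum inequality involves finitely many vectors, so it survives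
pointwise strong limits. -/
theorem hasLevelBound_of_tendsto {ι : Type*} {l : Filter ι} [l.NeBot]
    {A : ι → V →ₗ[ℂ] (H →L[ℂ] G)} {B : V →ₗ[ℂ] (H →L[ℂ] G)} {C : ℝ} (hC : 0 ≤ C)
    (hA : ∀ i, HasLevelBound S (A i) C)
    (hB : ∀ x v, Filter.Tendsto (fun i => A i x v) l (nhds (B x v))) : HasLevelBound S B C := by
  refine hasLevelBound_of_sum_le hC fun n hn X v => ?_
  have ht : Filter.Tendsto (fun a => ∑ i, ‖∑ j, A a (X i j) (v j)‖ ^ 2) l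
      (nhds (∑ i, ‖∑ j, B (X i j) (v j)‖ ^ 2)) :=
    tendsto_finsetSum _ fun i _ =>
      ((tendsto_finsetSum _ fun j _ => hB (X i j) (v j)).norm.pow 2)
  exact le_of_tendsto' ht fun a => (hA a).sum_le hn X v

end OperatorValued

/-! ### Matrices of completely bounded maps -/

section CBMatrices

theorem scalarNorm_le_one {m n : ℕ} {α : Matrix (Fin n) (Fin m) ℂ}
    (h : ∀ v : Fin m → ℂ, ∑ i, ‖∑ j, α i j * v j‖ ^ 2 ≤ ∑ j, ‖v j‖ ^ 2) : scalarNorm α ≤ 1 := by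
  refine ContinuousLinearMap.opNorm_le_bound _ zero_le_one fun v => ?_
  refine le_of_sq_le_sq ?_ (by positivity)
  rw [one_mul, PiLp.norm_sq_eq_of_L2, PiLp.norm_sq_eq_of_L2]
  simpa [Matrix.toEuclideanLin, Matrix.mulVec, dotProduct] using h (fun j => v j)

theorem scalarNorm_nonneg {m n : ℕ} (α : Matrix (Fin n) (Fin m) ℂ) : 0 ≤ scalarNorm α :=
  norm_nonneg _

variable {V : Type u} {W : Type v} [AddCommGroup V] [Module ℂ V] [MatrixNorm V]
  [NormedAddCommGroup W] [NormedSpace ℂ W] [OperatorSpace W]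

/-- The inclusion of a block row. -/
def blockIncl (m n : ℕ) (i : Fin n) : Matrix (Fin (m * n)) (Fin m) ℂ :=
  Matrix.of fun a p => if finProdFinEquiv.symm a = (p, i) then 1 else 0

/-- The projection on a block column. -/
def blockProj (m n : ℕ) (j : Fin n) : Matrix (Fin m) (Fin (m * n)) ℂ :=
  Matrix.of fun q b => if finProdFinEquiv.symm b = (q, j) then 1 else 0

theorem scalarNorm_blockIncl (m n : ℕ) (i : Fin n) : scalarNorm (blockIncl m n i) ≤ 1 := by
  refine scalarNorm_le_one fun v => ?_
  rw [← finProdFinEquiv.sum_comp, Fintype.sum_prod_type]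
  refine Finset.sum_le_sum fun p _ => ?_
  simp only [blockIncl, Matrix.of_apply, Equiv.symm_apply_apply, Prod.mk.injEq, ite_mul, one_mul,
    zero_mul]
  rw [Finset.sum_eq_single i]
  · simp
  · intro k _ hk
    simp [hk]
  · simp

theorem scalarNorm_blockProj (m n : ℕ) (j : Fin n) : scalarNorm (blockProj m n j) ≤ 1 := by
  refine scalarNorm_le_one fun v => ?_
  rw [← finProdFinEquiv.sum_comp (fun b => ‖v b‖ ^ 2), Fintype.sum_prod_type]
  refine Finset.sum_le_sum fun q _ => ?_
  rw [← finProdFinEquiv.sum_comp]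
  simp only [blockProj, Matrix.of_apply, Equiv.symm_apply_apply, ite_mul, one_mul,
    zero_mul, Finset.sum_ite_eq', Finset.mem_univ, if_true]
  exact Finset.single_le_sum (f := fun j => ‖v (finProdFinEquiv (q, j))‖ ^ 2)
    (fun _ _ => by positivity) (Finset.mem_univ j)

/-- Splits the block matrix into its n² blocks, each placed by contractive scalar matrices. Ruan's
axioms then bound it by the cb-norms of the entries of T. -/
theorem cbApply_eq_sum {m n : ℕ} (T : Matrix (Fin n) (Fin n) (CBMap V W))
    (X : Matrix (Fin m) (Fin m) V) :
    cbApply T X = ∑ i, ∑ j, scalarMul (blockIncl m n i) (X.map (T i j : V →ₗ[ℂ] W))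
      (blockProj m n j) := by
  ext a b
  obtain ⟨⟨p, i⟩, rfl⟩ := finProdFinEquiv.surjective a
  obtain ⟨⟨q, j⟩, rfl⟩ := finProdFinEquiv.surjective b
  rw [Matrix.sum_apply, Finset.sum_eq_single i]
  · rw [Matrix.sum_apply, Finset.sum_eq_single j]
    · simp only [cbApply, scalarMul, blockIncl, blockProj, Matrix.of_apply,
        Equiv.symm_apply_apply, Matrix.reindex_apply, Matrix.submatrix_apply, Matrix.map_apply]
      rw [Finset.sum_eq_single p]
      · rw [Finset.sum_eq_single q]
        · simp
        · intro k _ hk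
          simp [hk.symm]
        · simp
      · intro k _ hk
        simp [hk.symm]
      · simp
    · intro k _ hk
      simp [scalarMul, blockProj, hk.symm, -finProdFinEquiv_symm_apply]
    · simp
  · intro k _ hk
    rw [Matrix.sum_apply]
    simp [scalarMul, blockIncl, hk.symm, -finProdFinEquiv_symm_apply]
  · simp

/-- Shows that there are constants bounding `cbApply T`, so the infimum defining the norm of T is
not taken over an empty set. -/
theorem exists_cbApply_bound {n : ℕ} (T : Matrix (Fin n) (Fin n) (CBMap V W)) :
    ∃ C : ℝ, ∀ (m : ℕ) (X : Matrix (Fin m) (Fin m) V), mnorm (cbApply T X) ≤ C * mnorm X := by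
  choose C hC using fun i j => (T i j).2
  refine ⟨∑ i, ∑ j, C i j, fun m X => ?_⟩
  rw [cbApply_eq_sum, Finset.sum_mul]
  refine (mnorm_sum_le _ _).trans (Finset.sum_le_sum fun i _ => ?_)
  rw [Finset.sum_mul]
  refine (mnorm_sum_le _ _).trans (Finset.sum_le_sum fun j _ => ?_)
  refine (OperatorSpace.mnorm_scalarMul_le _ _ _ _ _).trans (le_trans ?_ (hC i j m X))
  have h1 := scalarNorm_blockIncl m n i
  have h2 := scalarNorm_blockProj m n j
  have h3 := scalarNorm_nonneg (blockProj m n j)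
  have h4 : 0 ≤ mnorm (X.map (T i j : V →ₗ[ℂ] W)) := mnorm_nonneg _
  calc _ ≤ 1 * mnorm (X.map (T i j : V →ₗ[ℂ] W)) * 1 := by
        refine mul_le_mul (mul_le_mul_of_nonneg_right h1 h4) h2 h3 ?_
        simpa using h4
    _ = _ := by ring

/-- The infimum defining the norm of T is itself an admissible constant for X. When X has norm zero
there is nothing to divide by, and any finite constant gives the claim. -/
theorem mnorm_cbApply_le {m n : ℕ} (T : Matrix (Fin n) (Fin n) (CBMap V W))
    (X : Matrix (Fin m) (Fin m) V) (hX : 0 ≤ mnorm X) :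
    mnorm (cbApply T X) ≤ mnorm T * mnorm X := by
  rcases hX.eq_or_lt with h0 | hpos
  · obtain ⟨C, hC⟩ := exists_cbApply_bound T
    have := hC m X
    rw [← h0, mul_zero] at this
    rwa [← h0, mul_zero]
  · rw [← div_le_iff₀ hpos]
    refine le_csInf ?_ ?_
    · obtain ⟨C, hC⟩ := exists_cbApply_bound T
      -- V carries bare matrix norms, which could be negative. If none is, C may be replaced by its
      -- positive part. Otherwise C is already nonnegative, as the estimate for X itself shows.
      by_cases h : ∀ (k : ℕ) (Z : Matrix (Fin k) (Fin k) V), 0 ≤ mnorm Z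
      · exact ⟨max C 0, le_max_right _ _, fun k Z => (hC k Z).trans
          (mul_le_mul_of_nonneg_right (le_max_left _ _) (h k Z))⟩
      · refine ⟨C, ?_, hC⟩
        have h1 := (mnorm_nonneg (cbApply T X)).trans (hC m X)
        exact nonneg_of_mul_nonneg_left h1 hpos
    · rintro C ⟨_, hC⟩
      rw [div_le_iff₀ hpos]
      exact hC m X

end CBMatrices

/-! ### Lifting a map along a column of completely bounded maps -/

section HatLift

variable {V : Type w} [NormedAddCommGroup V] [NormedSpace ℂ V] [OperatorSpace V]
  {H : Type u} {G : Type v} [NormedAddCommGroup H] [InnerProductSpace ℂ H]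
  [NormedAddCommGroup G] [InnerProductSpace ℂ G]
  {K : Type*} [NormedAddCommGroup K] [InnerProductSpace ℂ K]

/-- The functionals ⟨e_p|, p ∈ s, form a column Z of norm at most 1 by Bessel's inequality. Applying
the matrix ψ(X) to Z and then A gives an operator matrix of norm at most Cψ C ‖X‖, whose first block
column contains exactly the terms to be summed. The bound does not depend on the size of s, and for
this ψ and A must be completely bounded. -/
theorem sum_hatLift_le_of_cb {ι : Type*} {e : ι → K} (he : Orthonormal ℂ e)
    {A : V →ₗ[ℂ] (H →L[ℂ] G)} {ψ : V →ₗ[ℂ] CBMap (StrongDual ℂ K) V} {C Cψ : ℝ}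
    (hA : HasCBBound A C) (hψ : HasCBBound ψ Cψ) (hC : 0 ≤ C)
    {n : ℕ} (X : Matrix (Fin n) (Fin n) V) (v : Fin n → H) (s : Finset ι) :
    ∑ i, ∑ p ∈ s, ‖∑ j, A ((ψ (X i j) : StrongDual ℂ K →ₗ[ℂ] V) (innerSL ℂ (e p))) (v j)‖ ^ 2
        ≤ (Cψ * C * mnorm X) ^ 2 * ∑ j, ‖v j‖ ^ 2 := by
  obtain ⟨m, hm⟩ : ∃ m, s.card = m := ⟨_, rfl⟩
  rcases m with _ | m
  · rw [Finset.card_eq_zero] at hm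
    subst hm
    simp only [Finset.sum_empty, Finset.sum_const_zero]
    positivity
  let q : Fin (m + 1) ≃ s := (s.equivFinOfCardEq hm).symm
  -- A column is made square by zero padding, since matrix norms are given for square matrices only.
  -- Index 0 must exist, hence the separate treatment of an empty s.
  let Z : Matrix (Fin (m + 1)) (Fin (m + 1)) (StrongDual ℂ K) :=
    Matrix.of fun p r => if r = 0 then innerSL ℂ (e (q p)) else 0
  have hZ : mnorm Z ≤ 1 := by
    refine mnorm_op_le zero_le_one fun w => ?_
    have e1 : ∀ p, ∑ r, Z p r (w r) = ⟪e (q p), w 0⟫_ℂ := by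
      intro p
      rw [Finset.sum_eq_single 0]
      · simp [Z]
      · intro r _ hr
        simp [Z, hr]
      · simp
    simp only [e1, one_pow, one_mul]
    have ho : Orthonormal ℂ fun p => e (q p) :=
      he.comp _ (Subtype.val_injective.comp q.injective)
    exact (ho.sum_inner_products_le (s := Finset.univ) (w 0)).trans
      (Finset.single_le_sum (f := fun r => ‖w r‖ ^ 2) (fun _ _ => by positivity)
        (Finset.mem_univ 0))
  -- The vector v sits in the block of the only nonzero column of Z.
  let v' : Fin ((m + 1) * n) → H := fun a =>
    if (finProdFinEquiv.symm a).1 = 0 then v (finProdFinEquiv.symm a).2 else 0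
  have h1 : mnorm ((cbApply (X.map ψ) Z).map A) ≤ Cψ * C * mnorm X := by
    refine (hA _ _).trans ?_
    have h2 := mnorm_cbApply_le (X.map ψ) Z (mnorm_op_nonneg Z)
    have h3 : 0 ≤ mnorm (X.map ψ) := Real.sInf_nonneg fun c hc => hc.1
    calc _ ≤ C * (mnorm (X.map ψ) * 1) := by gcongr; exact h2.trans (by gcongr)
      _ ≤ C * (Cψ * mnorm X * 1) := by gcongr; exact hψ n X
      _ = _ := by ring
  have h2 := sum_norm_sq_le_of_mnorm_le h1 v'
  have e2 : ∑ a, ‖v' a‖ ^ 2 = ∑ j, ‖v j‖ ^ 2 := by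
    rw [← finProdFinEquiv.sum_comp, Fintype.sum_prod_type, Finset.sum_eq_single 0]
    · simp [v', -finProdFinEquiv_symm_apply]
    · intro r _ hr
      simp [v', hr, -finProdFinEquiv_symm_apply]
    · simp
  have e3 : ∀ (p : Fin (m + 1)) (i : Fin n),
      ∑ b, ((cbApply (X.map ψ) Z).map A) (finProdFinEquiv (p, i)) b (v' b)
        = ∑ j, A ((ψ (X i j) : StrongDual ℂ K →ₗ[ℂ] V) (innerSL ℂ (e (q p)))) (v j) := by
    intro p i
    rw [← finProdFinEquiv.sum_comp, Fintype.sum_prod_type, Finset.sum_eq_single 0]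
    · simp [v', cbApply, Z, -finProdFinEquiv_symm_apply]
    · intro r _ hr
      simp [v', hr, -finProdFinEquiv_symm_apply]
    · simp
  rw [← finProdFinEquiv.sum_comp, Fintype.sum_prod_type, e2] at h2
  simp only [e3] at h2
  refine le_trans (le_of_eq ?_) h2
  rw [Finset.sum_comm, ← Finset.sum_coe_sort s]
  exact (q.sum_comp fun p : s => ∑ i, ‖∑ j, A ((ψ (X i j) : StrongDual ℂ K →ₗ[ℂ] V)
    (innerSL ℂ (e p))) (v j)‖ ^ 2).symm

variable [CompleteSpace G]

/-- `B` has the slices `E^η B(x) = A(ψ(x)⟨η|)`. -/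
def IsHatLift (A : V →ₗ[ℂ] (H →L[ℂ] G)) (ψ : V →ₗ[ℂ] CBMap (StrongDual ℂ K) V)
    (B : V →ₗ[ℂ] (H →L[ℂ] HT G K)) : Prop :=
  ∀ (x : V) (η : K) (v : H),
    bra η (B x v) = A ((ψ x : StrongDual ℂ K →ₗ[ℂ] V) (innerSL ℂ η)) v

theorem IsHatLift.unique {A : V →ₗ[ℂ] (H →L[ℂ] G)} {ψ : V →ₗ[ℂ] CBMap (StrongDual ℂ K) V}
    {B B' : V →ₗ[ℂ] (H →L[ℂ] HT G K)} (h : IsHatLift A ψ B) (h' : IsHatLift A ψ B') : B = B' := by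
  ext x v
  exact ext_bra fun η => by rw [h, h']

theorem norm_cbMap_apply_le {ψ : V →ₗ[ℂ] CBMap (StrongDual ℂ K) V} {C : ℝ}
    (hψ : HasBound ψ C) (x : V) (f : StrongDual ℂ K) :
    ‖(ψ x : StrongDual ℂ K →ₗ[ℂ] V) f‖ ≤ C * ‖x‖ * ‖f‖ := by
  have h1 := mnorm_cbApply_le (Matrix.of fun _ _ : Fin 1 => ψ x)
    (Matrix.of fun _ _ : Fin 1 => f) (mnorm_op_nonneg _)
  have h2 : mnorm (n := 1) (Matrix.of fun _ _ => f) ≤ ‖f‖ := by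
    refine mnorm_op_le (norm_nonneg _) fun v => ?_
    simp only [Finset.univ_unique, Finset.sum_singleton, Matrix.of_apply, ← mul_pow]
    exact pow_le_pow_left₀ (norm_nonneg _) (f.le_opNorm _) 2
  have h3 := hψ x
  rw [mnorm_single] at h3
  have h4 : mnorm (cbApply (Matrix.of fun _ _ : Fin 1 => ψ x) (Matrix.of fun _ _ : Fin 1 => f))
      = ‖(ψ x : StrongDual ℂ K →ₗ[ℂ] V) f‖ := by
    exact mnorm_single ((ψ x : StrongDual ℂ K →ₗ[ℂ] V) f)
  rw [h4] at h1
  have h5 : 0 ≤ mnorm (n := 1) (Matrix.of fun _ _ => ψ x) :=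
    Real.sInf_nonneg fun c hc => hc.1
  calc _ ≤ _ := h1
    _ ≤ mnorm (n := 1) (Matrix.of fun _ _ => ψ x) * ‖f‖ := by gcongr
    _ ≤ C * ‖x‖ * ‖f‖ := by gcongr

/-- The lift is Σ_p A(ψ(x)⟨b_p|)v ⊗ b_p. It converges by the case n = 1 of the square sum
hypothesis, and the remaining levels give its level bounds. Linearity follows because vectors are
determined by their slices. -/
theorem exists_hatLift {ι : Type*} (b : HilbertBasis ι ℂ K) {S : Set ℕ} (h1 : 1 ∈ S)
    {A : V →ₗ[ℂ] (H →L[ℂ] G)} {ψ : V →ₗ[ℂ] CBMap (StrongDual ℂ K) V} {C Cψ C' : ℝ}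
    (hA : HasLevelBound S A C) (hψ : HasBound ψ Cψ) (hC : 0 ≤ C) (hC' : 0 ≤ C')
    (hsum : ∀ n ∈ S, ∀ (X : Matrix (Fin n) (Fin n) V) (v : Fin n → H) (s : Finset ι),
      ∑ i, ∑ p ∈ s, ‖∑ j, A ((ψ (X i j) : StrongDual ℂ K →ₗ[ℂ] V) (innerSL ℂ (b p))) (v j)‖ ^ 2
        ≤ (C' * mnorm X) ^ 2 * ∑ j, ‖v j‖ ^ 2) :
    ∃ B : V →ₗ[ℂ] (H →L[ℂ] HT G K), IsHatLift A ψ B ∧ HasLevelBound S B C' := by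
  have hs1 : ∀ (x : V) (v : H) (s : Finset ι),
      ∑ p ∈ s, ‖A ((ψ x : StrongDual ℂ K →ₗ[ℂ] V) (innerSL ℂ (b p))) v‖ ^ 2
        ≤ (C' * ‖x‖ * ‖v‖) ^ 2 := by
    intro x v s
    have := hsum 1 h1 (Matrix.of fun _ _ => x) (fun _ => v) s
    rw [mnorm_single] at this
    simpa [mul_pow] using this
  have hex : ∀ (x : V) (v : H), ∃ w : HT G K,
      HasSum (fun p => tm (A ((ψ x : StrongDual ℂ K →ₗ[ℂ] V) (innerSL ℂ (b p))) v) (b p)) w :=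
    fun x v => exists_tm_expansion b _ (hs1 x v)
  choose w hw using hex
  have hnorm : ∀ x v, ‖w x v‖ ≤ C' * ‖x‖ * ‖v‖ := by
    intro x v
    have := sum_norm_sq_expansion_le (n := 1) b
      (fun _ p => A ((ψ x : StrongDual ℂ K →ₗ[ℂ] V) (innerSL ℂ (b p))) v)
      (fun s => by simpa using hs1 x v s) (w := fun _ => w x v) (fun _ => hw x v)
    simp only [Finset.univ_unique, Finset.sum_singleton] at this
    exact le_of_sq_le_sq this (by positivity)
  have hbra : ∀ x v (η : K),
      bra η (w x v) = A ((ψ x : StrongDual ℂ K →ₗ[ℂ] V) (innerSL ℂ η)) v := by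
    intro x v η
    have e1 := (hw x v).mapL (bra η)
    simp only [bra_tm] at e1
    -- Continuity of f ↦ A(ψ(x)f)v lets the basis expansion of ⟨η| pass through A and ψ. This
    -- identifies the slice at an arbitrary η, not only at basis vectors.
    let L : StrongDual ℂ K →L[ℂ] G := LinearMap.mkContinuous
      { toFun := fun f => A ((ψ x : StrongDual ℂ K →ₗ[ℂ] V) f) v
        map_add' := fun f f' => by simp
        map_smul' := fun c f => by simp } (C * (Cψ * ‖x‖) * ‖v‖) (fun f => by
          refine (hA.norm_apply_le h1 _ v).trans ?_
          have := norm_cbMap_apply_le hψ x f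
          calc _ ≤ C * (Cψ * ‖x‖ * ‖f‖) * ‖v‖ := by gcongr
            _ = _ := by ring)
    have e2 : HasSum (fun p => ⟪η, b p⟫_ℂ • innerSL ℂ (b p)) (innerSL ℂ η) := by
      have h := (b.hasSum_repr η).mapL (innerSL ℂ)
      convert h using 2 with p
      rw [b.repr_apply_apply, map_smulₛₗ, inner_conj_symm]
    have e3 := e2.mapL L
    simp only [map_smul] at e3
    exact e1.unique e3
  let B : V →ₗ[ℂ] (H →L[ℂ] HT G K) :=
    { toFun := fun x => LinearMap.mkContinuous
        { toFun := w x
          map_add' := fun v v' => ext_bra fun η => by rw [map_add, hbra, hbra, hbra, map_add]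
          map_smul' := fun c v => ext_bra fun η => by
            rw [map_smul, hbra, hbra, map_smul, RingHom.id_apply] } (C' * ‖x‖) (hnorm x)
      map_add' := fun x x' => by
        ext v
        refine ext_bra fun η => ?_
        change bra η (w (x + x') v) = bra η (w x v + w x' v)
        rw [map_add, hbra, hbra, hbra]
        simp
      map_smul' := fun c x => by
        ext v
        refine ext_bra fun η => ?_
        change bra η (w (c • x) v) = bra η (c • w x v)
        rw [map_smul, hbra, hbra]
        simp }
  refine ⟨B, fun x η v => hbra x v η, hasLevelBound_of_sum_le hC' fun n hn X v => ?_⟩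
  refine sum_norm_sq_expansion_le b
    (fun i p => ∑ j, A ((ψ (X i j) : StrongDual ℂ K →ₗ[ℂ] V) (innerSL ℂ (b p))) (v j))
    (hsum n hn X v) fun i => ?_
  have h := hasSum_sum (s := Finset.univ) (fun j _ => hw (X i j) (v j))
  have e : (fun p => tm (∑ j, A ((ψ (X i j) : StrongDual ℂ K →ₗ[ℂ] V) (innerSL ℂ (b p))) (v j))
      (b p)) = fun p => ∑ j, tm (A ((ψ (X i j) : StrongDual ℂ K →ₗ[ℂ] V) (innerSL ℂ (b p))) (v j))
        (b p) := funext fun p => map_sum (ket (b p) : G →L[ℂ] HT G K) _ _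
  rw [e]
  exact h

/-- Maps `A` that are bounded at the levels in `S` lift along `ψ`, with control of the bound. -/
def Liftable (S : Set ℕ) (ψ : V →ₗ[ℂ] CBMap (StrongDual ℂ K) V) (H : Type u) (G : Type v)
    [NormedAddCommGroup H] [InnerProductSpace ℂ H]
    [NormedAddCommGroup G] [InnerProductSpace ℂ G] [CompleteSpace G] : Prop :=
  ∃ L : ℝ, 0 ≤ L ∧ ∀ (A : V →ₗ[ℂ] (H →L[ℂ] G)) (C : ℝ), 0 ≤ C → HasLevelBound S A C →
    ∃ B : V →ₗ[ℂ] (H →L[ℂ] HT G K), IsHatLift A ψ B ∧ HasLevelBound S B (L * C)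

variable [CompleteSpace K]

theorem liftable_of_isCB {ψ : V →ₗ[ℂ] CBMap (StrongDual ℂ K) V} (hψ : IsCB ψ) :
    Liftable univ ψ H G := by
  obtain ⟨C₀, hC₀⟩ := hψ
  have hψ : HasCBBound ψ (max C₀ 0) := fun n X =>
    (hC₀ n X).trans (mul_le_mul_of_nonneg_right (le_max_left _ _) (mnorm_nonneg X))
  obtain ⟨w, b, _⟩ := exists_hilbertBasis ℂ K
  refine ⟨max C₀ 0, le_max_right _ _, fun A C hC hA => ?_⟩
  refine exists_hatLift b (mem_univ 1) hA (fun x => hψ 1 _) hC (by positivity) fun n _ X v s => ?_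
  exact sum_hatLift_le_of_cb b.orthonormal (hasLevelBound_univ_iff.1 hA) hψ hC X v s

/-- With d basis vectors, the square sum has at most d terms, each bounded by (C M ‖x‖ ‖v‖)². The
constant d M, in place of √d M, uses only d ≤ d². -/
theorem liftable_of_hasBound [FiniteDimensional ℂ K] {ψ : V →ₗ[ℂ] CBMap (StrongDual ℂ K) V}
    {C₀ : ℝ} (hC₀ : HasBound ψ C₀) : Liftable {1} ψ H G := by
  have hψ : HasBound ψ (max C₀ 0) := fun x =>
    (hC₀ x).trans (mul_le_mul_of_nonneg_right (le_max_left _ _) (mnorm_nonneg _))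
  have hM : 0 ≤ max C₀ 0 := le_max_right _ _
  generalize max C₀ 0 = M at hψ hM
  let b := (stdOrthonormalBasis ℂ K).toHilbertBasis
  obtain ⟨d, hd⟩ : ∃ d, d = Module.finrank ℂ K := ⟨_, rfl⟩
  refine ⟨d * M, by positivity, fun A C hC hA => ?_⟩
  refine exists_hatLift b (mem_singleton 1) hA hψ hC (by positivity) ?_
  rintro n rfl X v s
  have hX : mnorm X = ‖X 0 0‖ := by
    rw [← mnorm_single]
    congr 1
    ext i j
    rw [Subsingleton.elim i 0, Subsingleton.elim j 0]
    rfl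
  simp only [Finset.univ_unique, Finset.sum_singleton, Fin.default_eq_zero]
  have h1 : ∀ p ∈ s, ‖A ((ψ (X 0 0) : StrongDual ℂ K →ₗ[ℂ] V) (innerSL ℂ (b p))) (v 0)‖ ^ 2
      ≤ (C * (M * ‖X 0 0‖) * ‖v 0‖) ^ 2 := by
    intro p _
    refine pow_le_pow_left₀ (norm_nonneg _) ((hA.norm_apply_le (mem_singleton 1) _ _).trans ?_) 2
    have h2 := norm_cbMap_apply_le hψ (X 0 0) (innerSL ℂ (b p))
    rw [innerSL_apply_norm, b.orthonormal.1 p, mul_one] at h2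
    gcongr
  refine (Finset.sum_le_sum h1).trans ?_
  rw [Finset.sum_const, nsmul_eq_mul, hX]
  have h3 : (s.card : ℝ) ≤ d := by
    have h5 : s.card ≤ d := (Finset.card_le_univ s).trans_eq ((Fintype.card_fin _).trans hd.symm)
    exact_mod_cast h5
  have h4 : (d : ℝ) ≤ d ^ 2 := by
    exact_mod_cast Nat.le_self_pow two_ne_zero d
  calc (s.card : ℝ) * (C * (M * ‖X 0 0‖) * ‖v 0‖) ^ 2
      ≤ (d : ℝ) ^ 2 * (C * (M * ‖X 0 0‖) * ‖v 0‖) ^ 2 := by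
        gcongr
        exact h3.trans h4
    _ = _ := by ring

theorem liftable_kLevels {𝔨 : Type*} [NormedAddCommGroup 𝔨] [InnerProductSpace ℂ 𝔨]
    [CompleteSpace 𝔨] {ψ : V →ₗ[ℂ] CBMap (StrongDual ℂ (Khat 𝔨)) V} (hψ : IsKBounded 𝔨 ψ) :
    Liftable (kLevels 𝔨) ψ H G := by
  obtain ⟨C, hC⟩ := hψ
  by_cases h : FiniteDimensional ℂ 𝔨
  · rw [kLevels_of_finite 𝔨 h]
    have : FiniteDimensional ℂ (Khat 𝔨) := inferInstance
    exact liftable_of_hasBound (hC.1 h)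
  · rw [kLevels_of_infinite 𝔨 h]
    exact liftable_of_isCB ⟨C, hC.2 h⟩

end HatLift

/-! ### Gram matrices of truncated exponential vectors -/

theorem hat_eq_add {𝔨 : Type u} [NormedAddCommGroup 𝔨] (a b : 𝔨) :
    hat a = hat b + inNoise (a - b) := by
  simp only [hat, inNoise, ← WithLp.toLp_add, Prod.mk_add_mk, add_zero, add_sub_cancel]

section Gram

variable {𝔨 : Type u} [NormedAddCommGroup 𝔨] [InnerProductSpace ℂ 𝔨]
  {D D' : Submodule ℂ 𝔨}

/-- `g_{[0,s[}`, for all real `s`. -/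
def cut (g : step D) (s : ℝ) : step D :=
  ⟨(Ico 0 s).indicator g, by
    rcases le_total 0 s with h | h
    · exact step_indicator g h
    · rw [Ico_eq_empty (not_lt.2 h), indicator_empty]
      exact (step D).zero_mem⟩

theorem cut_apply (g : step D) (s : ℝ) : (cut g s : ℝ → 𝔨) = (Ico 0 s).indicator g := rfl

theorem before_eq_cut (g : step D) {t : ℝ} (ht : 0 ≤ t) : before g ht = cut g t := rfl

theorem after_eq_sub_cut (g : step D) {t : ℝ} (ht : 0 ≤ t) : after g ht = g - cut g t := rfl

theorem integrable_inner_step (f : step D) (g : step D') :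
    Integrable fun r => ⟪(f : ℝ → 𝔨) r, (g : ℝ → 𝔨) r⟫_ℂ := by
  obtain ⟨T, hT, hz⟩ := step_exists_support f
  obtain ⟨m, hm, hb⟩ := step_exists_bound f
  obtain ⟨m', hm', hb'⟩ := step_exists_bound g
  have e : (fun r => ⟪(f : ℝ → 𝔨) r, (g : ℝ → 𝔨) r⟫_ℂ)
      = (Icc 0 T).indicator fun r => ⟪(f : ℝ → 𝔨) r, (g : ℝ → 𝔨) r⟫_ℂ := by
    funext r
    by_cases hr : r ∈ Icc 0 T
    · rw [indicator_of_mem hr]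
    · rw [indicator_of_notMem hr]
      have : (f : ℝ → 𝔨) r = 0 := by
        by_cases h0 : r < 0
        · exact step_eq_zero_of_neg f h0
        · exact hz r (le_of_lt (lt_of_not_ge fun h => hr ⟨not_lt.1 h0, h⟩))
      rw [this, inner_zero_left]
  rw [e, integrable_indicator_iff measurableSet_Icc]
  refine Measure.integrableOn_of_bounded (M := m * m') (by simp)
    ((step_stronglyMeasurable f).inner (step_stronglyMeasurable g)).aestronglyMeasurable ?_
  refine Filter.Eventually.of_forall fun r => (norm_inner_le_norm _ _).trans ?_
  exact mul_le_mul (hb r) (hb' r) (norm_nonneg _) hm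

/-- The `L²` inner product over `[0,s]`. -/
def cum (f g : ℝ → 𝔨) (s : ℝ) : ℂ := ∫ r in (0 : ℝ)..s, ⟪f r, g r⟫_ℂ

theorem ip_cut_left (f : step D) (g : step D') {s : ℝ} (hs : 0 ≤ s) :
    ip (cut f s : ℝ → 𝔨) (g : ℝ → 𝔨) = cum (f : ℝ → 𝔨) (g : ℝ → 𝔨) s := by
  rw [ip, cum, intervalIntegral.integral_of_le hs, ← integral_Ico_eq_integral_Ioc,
    ← inter_eq_right.2 (Ico_subset_Ici_self : Ico 0 s ⊆ Ici (0 : ℝ)),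
    ← setIntegral_indicator measurableSet_Ico]
  refine integral_congr_ae (Filter.Eventually.of_forall fun r => ?_)
  by_cases hr : r ∈ Ico 0 s
  · simp [cut_apply, indicator_of_mem hr]
  · simp [cut_apply, indicator_of_notMem hr]

theorem ip_cut_cut (f : step D) (g : step D') {s : ℝ} (hs : 0 ≤ s) :
    ip (cut f s : ℝ → 𝔨) (cut g s : ℝ → 𝔨) = cum (f : ℝ → 𝔨) (g : ℝ → 𝔨) s := by
  rw [← ip_cut_left f g hs, ip, ip]
  congr 1
  funext r
  by_cases hr : r ∈ Ico 0 s
  · simp [cut_apply, indicator_of_mem hr]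
  · simp [cut_apply, indicator_of_notMem hr]

theorem ip_sub_left (f f' : step D) (g : step D') :
    ip ((f - f' : step D) : ℝ → 𝔨) (g : ℝ → 𝔨)
      = ip (f : ℝ → 𝔨) (g : ℝ → 𝔨) - ip (f' : ℝ → 𝔨) (g : ℝ → 𝔨) := by
  rw [ip, ip, ip, ← integral_sub (integrable_inner_step f g).integrableOn
    (integrable_inner_step f' g).integrableOn]
  simp

theorem ip_conj (f g : ℝ → 𝔨) : starRingEnd ℂ (ip f g) = ip g f := by
  rw [ip, ip, ← integral_conj]
  simp

theorem cum_conj (f g : ℝ → 𝔨) (s : ℝ) : starRingEnd ℂ (cum f g s) = cum g f s := by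
  simp only [cum, intervalIntegral, map_sub, ← integral_conj, inner_conj_symm]

theorem cum_sub_sub (f g : step D) (h : step D) (s : ℝ) :
    cum ((f - h : step D) : ℝ → 𝔨) ((g - h : step D) : ℝ → 𝔨) s
      = cum (f : ℝ → 𝔨) (g : ℝ → 𝔨) s - cum (f : ℝ → 𝔨) (h : ℝ → 𝔨) s - cum (h : ℝ → 𝔨) (g : ℝ → 𝔨) s
        + cum (h : ℝ → 𝔨) (h : ℝ → 𝔨) s := by
  have i : ∀ a b : step D, IntervalIntegrable (fun r => ⟪(a : ℝ → 𝔨) r, (b : ℝ → 𝔨) r⟫_ℂ)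
      volume 0 s := fun a b => (integrable_inner_step a b).intervalIntegrable
  rw [cum, cum, cum, cum, cum, ← intervalIntegral.integral_sub (i f g) (i f h),
    ← intervalIntegral.integral_sub ((i f g).sub (i f h)) (i h g),
    ← intervalIntegral.integral_add (((i f g).sub (i f h)).sub (i h g)) (i h h)]
  congr 1
  funext r
  simp only [Submodule.coe_sub, Pi.sub_apply, inner_sub_left, inner_sub_right]
  ring

theorem cum_self (g : ℝ → 𝔨) (s : ℝ) :
    cum g g s = ((∫ r in (0 : ℝ)..s, ‖g r‖ ^ 2 : ℝ) : ℂ) := by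
  rw [cum, ← intervalIntegral.integral_ofReal]
  simp [inner_self_eq_norm_sq_to_K]

theorem cum_continuous (f : step D) (g : step D') : Continuous (cum (f : ℝ → 𝔨) g) :=
  intervalIntegral.continuous_primitive
    (fun _ _ => (integrable_inner_step f g).intervalIntegrable) 0

/-- Step functions are right continuous, so the right derivative exists at every time, jumps
included. For a continuous primitive this is all that the fundamental theorem of calculus needs. -/
theorem cum_hasDerivWithinAt (f : step D) (g : step D') (s : ℝ) :
    HasDerivWithinAt (cum (f : ℝ → 𝔨) g) ⟪(f : ℝ → 𝔨) s, (g : ℝ → 𝔨) s⟫_ℂ (Ioi s) s := by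
  have h : HasDerivWithinAt (cum (f : ℝ → 𝔨) g) ⟪(f : ℝ → 𝔨) s, (g : ℝ → 𝔨) s⟫_ℂ (Ici s) s := by
    refine intervalIntegral.integral_hasDerivWithinAt_right
      (integrable_inner_step f g).intervalIntegrable (t := Ioi s)
      (integrable_inner_step f g).aestronglyMeasurable.stronglyMeasurableAtFilter ?_
    refine ContinuousWithinAt.mono (t := Ici s) ?_ Ioi_subset_Ici_self
    refine tendsto_const_nhds.congr' ?_
    filter_upwards [step_eventually_eq f s, step_eventually_eq g s] with r h h'
    rw [h, h']
  exact h.mono Ioi_subset_Ici_self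

theorem intervalIntegrable_inner_mul_exp (f : step D) (g : step D') (a b : ℝ) :
    IntervalIntegrable (fun s => Complex.exp (cum (f : ℝ → 𝔨) g s) *
      ⟪(f : ℝ → 𝔨) s, (g : ℝ → 𝔨) s⟫_ℂ) volume a b :=
  (integrable_inner_step f g).intervalIntegrable.continuousOn_mul
    (Complex.continuous_exp.comp (cum_continuous f g)).continuousOn

theorem integral_inner_mul_exp (f : step D) (g : step D') (a b : ℝ) :
    ∫ s in a..b, Complex.exp (cum (f : ℝ → 𝔨) g s) * ⟪(f : ℝ → 𝔨) s, (g : ℝ → 𝔨) s⟫_ℂ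
      = Complex.exp (cum (f : ℝ → 𝔨) g b) - Complex.exp (cum (f : ℝ → 𝔨) g a) := by
  refine intervalIntegral.integral_eq_sub_of_hasDeriv_right
    (Complex.continuous_exp.comp (cum_continuous f g)).continuousOn (fun s _ => ?_)
    (intervalIntegrable_inner_mul_exp f g a b)
  exact (cum_hasDerivWithinAt f g s).cexp

theorem intervalIntegrable_finset_sum {ι : Type*} (I : Finset ι) {p : ι → ℝ → ℂ} {a b : ℝ}
    (h : ∀ i ∈ I, IntervalIntegrable (p i) volume a b) :
    IntervalIntegrable (fun s => ∑ i ∈ I, p i s) volume a b := by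
  have h1 := IntervalIntegrable.sum I h
  rwa [Finset.sum_fn] at h1

theorem norm_sq_sum_eq {F : Type*} [NormedAddCommGroup F] [InnerProductSpace ℂ F] {ι : Type*}
    (I : Finset ι) (w : ι → F) :
    ((‖∑ i ∈ I, w i‖ ^ 2 : ℝ) : ℂ) = ∑ i ∈ I, ∑ j ∈ I, ⟪w i, w j⟫_ℂ := by
  have h := inner_self_eq_norm_sq_to_K (𝕜 := ℂ) (∑ i ∈ I, w i)
  rw [sum_inner] at h
  simp_rw [inner_sum] at h
  rw [h]
  push_cast
  rfl

variable {𝔥' : Type v} [NormedAddCommGroup 𝔥'] [InnerProductSpace ℂ 𝔥'] {ι : Type*}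
  (I : Finset ι) (c : ι → ℂ) (v : ι → 𝔥') (f : ι → step D)

theorem norm_sq_sum_cut {s : ℝ} (hs : 0 ≤ s) :
    ((‖∑ i ∈ I, c i • tm (v i) (expStep (cut (f i) s))‖ ^ 2 : ℝ) : ℂ)
      = ∑ i ∈ I, ∑ j ∈ I, starRingEnd ℂ (c i) * c j * ⟪v i, v j⟫_ℂ *
        Complex.exp (cum (f i : ℝ → 𝔨) (f j) s) := by
  rw [norm_sq_sum_eq]
  refine Finset.sum_congr rfl fun i _ => Finset.sum_congr rfl fun j _ => ?_
  rw [inner_smul_left, inner_smul_right, inner_tm, inner_expStep, ip_cut_cut _ _ hs]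
  ring

theorem norm_sq_sum_cut_tm (η : ι → Khat 𝔨) {s : ℝ} (hs : 0 ≤ s) :
    ((‖∑ i ∈ I, c i • tm (tm (v i) (expStep (cut (f i) s))) (η i)‖ ^ 2 : ℝ) : ℂ)
      = ∑ i ∈ I, ∑ j ∈ I, starRingEnd ℂ (c i) * c j * ⟪v i, v j⟫_ℂ *
        (Complex.exp (cum (f i : ℝ → 𝔨) (f j) s) * ⟪η i, η j⟫_ℂ) := by
  rw [norm_sq_sum_eq]
  refine Finset.sum_congr rfl fun i _ => Finset.sum_congr rfl fun j _ => ?_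
  rw [inner_smul_left, inner_smul_right, inner_tm, inner_tm, inner_expStep, ip_cut_cut _ _ hs]
  ring

theorem inner_inNoise (a b : 𝔨) : ⟪inNoise a, inNoise b⟫_ℂ = ⟪a, b⟫_ℂ := by
  simp [inNoise, WithLp.prod_inner_apply]

/-- The Gram entries exp(∫_0^s ⟨f_i,f_j⟩) have right derivative ⟨f_i(s),f_j(s)⟩ times themselves,
and this is the Gram entry of the gradient vectors. In particular the norm of a truncated
combination increases with the truncation time. -/
theorem intervalIntegrable_norm_sq_gradient {a b : ℝ} (ha : 0 ≤ a) (hab : a ≤ b) :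
    IntervalIntegrable (fun s => ‖∑ i ∈ I, c i • tm (tm (v i) (expStep (cut (f i) s)))
      (inNoise ((f i : ℝ → 𝔨) s))‖ ^ 2) volume a b ∧
    ∫ s in a..b, ‖∑ i ∈ I, c i • tm (tm (v i) (expStep (cut (f i) s)))
      (inNoise ((f i : ℝ → 𝔨) s))‖ ^ 2
      = ‖∑ i ∈ I, c i • tm (v i) (expStep (cut (f i) b))‖ ^ 2
        - ‖∑ i ∈ I, c i • tm (v i) (expStep (cut (f i) a))‖ ^ 2 := by
  set n₁ : ℝ → ℝ := fun s => ‖∑ i ∈ I, c i • tm (tm (v i) (expStep (cut (f i) s)))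
      (inNoise ((f i : ℝ → 𝔨) s))‖ ^ 2 with hn₁
  let q : ℝ → ℂ := fun s => ∑ i ∈ I, ∑ j ∈ I, starRingEnd ℂ (c i) * c j * ⟪v i, v j⟫_ℂ *
    (Complex.exp (cum (f i : ℝ → 𝔨) (f j) s) * ⟪(f i : ℝ → 𝔨) s, (f j : ℝ → 𝔨) s⟫_ℂ)
  have e : ∀ s, 0 ≤ s → (n₁ s : ℂ) = q s := by
    intro s hs
    rw [hn₁, norm_sq_sum_cut_tm I c v f _ hs]
    simp only [inner_inNoise, q]
  have hterm : ∀ i j, IntervalIntegrable (fun s => starRingEnd ℂ (c i) * c j * ⟪v i, v j⟫_ℂ *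
    (Complex.exp (cum (f i : ℝ → 𝔨) (f j) s) * ⟪(f i : ℝ → 𝔨) s, (f j : ℝ → 𝔨) s⟫_ℂ))
      volume a b := fun i j => (intervalIntegrable_inner_mul_exp (f i) (f j) a b).const_mul _
  have hq : IntervalIntegrable q volume a b :=
    intervalIntegrable_finset_sum I fun i _ => intervalIntegrable_finset_sum I fun j _ => hterm i j
  have hI : ∫ s in a..b, q s
      = ((‖∑ i ∈ I, c i • tm (v i) (expStep (cut (f i) b))‖ ^ 2 : ℝ) : ℂ)
        - ((‖∑ i ∈ I, c i • tm (v i) (expStep (cut (f i) a))‖ ^ 2 : ℝ) : ℂ) := by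
    rw [norm_sq_sum_cut I c v f (ha.trans hab), norm_sq_sum_cut I c v f ha,
      ← Finset.sum_sub_distrib, intervalIntegral.integral_finsetSum]
    · refine Finset.sum_congr rfl fun i _ => ?_
      rw [← Finset.sum_sub_distrib, intervalIntegral.integral_finsetSum fun j _ => hterm i j]
      refine Finset.sum_congr rfl fun j _ => ?_
      rw [intervalIntegral.integral_const_mul, integral_inner_mul_exp]
      ring
    · exact fun i _ => intervalIntegrable_finset_sum I fun j _ => hterm i j
  have hn : ∀ s ∈ uIcc a b, n₁ s = (q s).re := by
    intro s hs
    rw [uIcc_of_le hab] at hs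
    rw [← e s (ha.trans hs.1), Complex.ofReal_re]
  refine ⟨?_, ?_⟩
  · refine (intervalIntegrable_iff.2 ((intervalIntegrable_iff.1 hq).re)).congr ?_
    intro s hs
    exact (hn s (uIoc_subset_uIcc hs)).symm
  · have h1 : ∫ s in a..b, ((n₁ s : ℝ) : ℂ) = ∫ s in a..b, q s :=
      intervalIntegral.integral_congr fun s hs => by
        rw [uIcc_of_le hab] at hs
        exact e s (ha.trans hs.1)
    rw [intervalIntegral.integral_ofReal, hI, ← Complex.ofReal_sub] at h1
    exact Complex.ofReal_injective h1

end Gram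

/-! ### Existence and estimate of quantum stochastic integrals of adapted integrands -/

section Auxiliary

/-- Cauchy–Schwarz from a discriminant: 2l|F| ≤ l²p + q for l ≥ 0, so the integrated quadratic in l
is nonnegative. No measurability of F is needed. -/
theorem norm_integral_sq_le {F : ℝ → ℂ} {p q : ℝ → ℝ} {a b : ℝ} (hab : a ≤ b)
    (hp : IntervalIntegrable p volume a b) (hq : IntervalIntegrable q volume a b)
    (hp0 : ∀ s ∈ Icc a b, 0 ≤ p s) (hq0 : ∀ s ∈ Icc a b, 0 ≤ q s)
    (h : ∀ s ∈ Icc a b, ‖F s‖ ^ 2 ≤ p s * q s) :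
    ‖∫ s in a..b, F s‖ ^ 2 ≤ (∫ s in a..b, p s) * ∫ s in a..b, q s := by
  have hP : 0 ≤ ∫ s in a..b, p s := intervalIntegral.integral_nonneg hab hp0
  have hQ : 0 ≤ ∫ s in a..b, q s := intervalIntegral.integral_nonneg hab hq0
  have key : ∀ l : ℝ, 0 ≤ (∫ s in a..b, p s) * (l * l) + (-2 * ‖∫ s in a..b, F s‖) * l
      + ∫ s in a..b, q s := by
    intro l
    rcases le_total l 0 with hl | hl
    · have : 0 ≤ (-2 * ‖∫ s in a..b, F s‖) * l :=
        mul_nonneg_of_nonpos_of_nonpos (by linarith [norm_nonneg (∫ s in a..b, F s)]) hl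
      have := mul_nonneg hP (mul_self_nonneg l)
      linarith
    · have h1 : ‖∫ s in a..b, ((2 * l : ℝ) : ℂ) * F s‖ ≤ ∫ s in a..b, (l ^ 2 * p s + q s) := by
        refine intervalIntegral.norm_integral_le_of_norm_le hab
          (Filter.Eventually.of_forall fun s hs => ?_) ((hp.const_mul _).add hq)
        have hs' : s ∈ Icc a b := Ioc_subset_Icc_self hs
        have hp1 := hp0 s hs'
        have hq1 := hq0 s hs'
        rw [norm_mul, Complex.norm_real, Real.norm_of_nonneg (by positivity)]
        refine le_of_sq_le_sq ?_ (by positivity)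
        have h2 := h s hs'
        have h3 : 4 * l ^ 2 * ‖F s‖ ^ 2 ≤ 4 * l ^ 2 * (p s * q s) := by gcongr
        nlinarith [sq_nonneg (l ^ 2 * p s - q s)]
      rw [intervalIntegral.integral_const_mul, norm_mul, Complex.norm_real,
        Real.norm_of_nonneg (by positivity), intervalIntegral.integral_add (hp.const_mul _) hq,
        intervalIntegral.integral_const_mul] at h1
      nlinarith
  have := discrim_le_zero key
  rw [discrim] at this
  nlinarith

/-- The estimate makes l factor through the range of J. The factored functional extends by
Hahn–Banach without increase of norm and is represented by a vector by Riesz. -/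
theorem exists_inner_eq_of_le {F : Type*} [AddCommGroup F] [Module ℂ F] {H : Type*}
    [NormedAddCommGroup H] [InnerProductSpace ℂ H] [CompleteSpace H] (J : F →ₗ[ℂ] H)
    (l : F →ₗ[ℂ] ℂ) {C : ℝ} (hC : 0 ≤ C) (h : ∀ x, ‖l x‖ ≤ C * ‖J x‖) :
    ∃ y : H, ‖y‖ ≤ C ∧ ∀ x, ⟪y, J x⟫_ℂ = l x := by
  have hker : LinearMap.ker J ≤ LinearMap.ker l := by
    intro x hx
    rw [LinearMap.mem_ker] at hx ⊢
    have := h x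
    rw [hx, norm_zero, mul_zero] at this
    exact norm_le_zero_iff.1 this
  let l₁ : LinearMap.range J →ₗ[ℂ] ℂ :=
    (LinearMap.ker J).liftQ l hker ∘ₗ (J.quotKerEquivRange).symm.toLinearMap
  have hl₁ : ∀ x, l₁ ⟨J x, x, rfl⟩ = l x := by
    intro x
    have e : (J.quotKerEquivRange).symm ⟨J x, x, rfl⟩ = (LinearMap.ker J).mkQ x := by
      rw [LinearEquiv.symm_apply_eq]
      rfl
    simp [l₁, e]
  let l₂ : StrongDual ℂ (LinearMap.range J) := l₁.mkContinuous C (by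
    rintro ⟨_, x, rfl⟩
    rw [hl₁]
    exact h x)
  obtain ⟨m, hm, hn⟩ := exists_extension_norm_eq (LinearMap.range J) l₂
  refine ⟨(InnerProductSpace.toDual ℂ H).symm m, ?_, fun x => ?_⟩
  · rw [LinearIsometryEquiv.norm_map, hn]
    exact LinearMap.mkContinuous_norm_le _ hC _
  · rw [InnerProductSpace.toDual_symm_apply, ← hl₁ x]
    exact hm ⟨J x, x, rfl⟩

theorem norm_hat_zero {𝔨 : Type u} [NormedAddCommGroup 𝔨] : ‖(hat (0 : 𝔨) : Khat 𝔨)‖ = 1 := by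
  rw [hat, WithLp.prod_norm_eq_of_L2]
  simp

end Auxiliary

/-! ### Integrals of adapted vector functions -/

section Integral

variable {𝔨 : Type u} [NormedAddCommGroup 𝔨] [InnerProductSpace ℂ 𝔨]
  {D : Submodule ℂ 𝔨}
  {𝔥' : Type v} [NormedAddCommGroup 𝔥'] [InnerProductSpace ℂ 𝔥']

theorem step_comp_stronglyMeasurable {β : Type*} [TopologicalSpace β] (g : step D) (F : 𝔨 → β) :
    StronglyMeasurable fun s => F ((g : ℝ → 𝔨) s) := by
  obtain ⟨f, hf⟩ := step_exists_simpleFunc g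
  simp_rw [← hf]
  exact (f.map F).stronglyMeasurable

theorem step_exists_bound_comp (g : step D) (F : 𝔨 → ℝ) :
    ∃ m : ℝ, 0 ≤ m ∧ ∀ s, F ((g : ℝ → 𝔨) s) ≤ m := by
  obtain ⟨m, hm⟩ := ((step_finite_range g).image F).bddAbove
  exact ⟨max m 0, le_max_right _ _, fun s => (hm ⟨_, ⟨s, rfl⟩, rfl⟩).trans (le_max_left _ _)⟩

/-- The vector `z` is adapted at time `s`, with future `g`. -/
def AdaptedAt (g : ℝ → 𝔨) (s : ℝ) (z : HT (HT 𝔥' (Fock 𝔨)) (Khat 𝔨)) : Prop :=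
  ∀ (u : 𝔥') (g' : step (⊤ : Submodule ℂ 𝔨)) (η : Khat 𝔨),
    ⟪tm (tm u (expStep g')) η, z⟫_ℂ = ⟪tm (tm u (expStep (cut g' s))) η, z⟫_ℂ *
      Complex.exp (ip (g' : ℝ → 𝔨) g - cum (g' : ℝ → 𝔨) g s)

variable {ι : Type*} (I : Finset ι) (c : ι → ℂ) (v : ι → 𝔥') (f : ι → step D) (g : step D)

/-- Expanding ⟨f_i - g, f_j - g⟩ over [0,s] shows that the factors exp(-∫_0^s⟨g,f_i⟩) turn the Gram
matrix of the f_i into that of the f_i - g, up to the scalar exp(-∫_0^s‖g‖²). The future factors are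
thus absorbed by a shift, leaving coefficients that do not depend on s. -/
theorem norm_sq_sum_future_eq (η : ι → Khat 𝔨) {s : ℝ} (hs : 0 ≤ s) :
    ‖∑ i ∈ I, (c i * Complex.exp (ip (g : ℝ → 𝔨) (f i : ℝ → 𝔨)
        - cum (g : ℝ → 𝔨) (f i : ℝ → 𝔨) s)) • tm (tm (v i) (expStep (cut (f i) s))) (η i)‖ ^ 2
      = Real.exp (-∫ r in (0 : ℝ)..s, ‖(g : ℝ → 𝔨) r‖ ^ 2) *
        ‖∑ i ∈ I, (c i * Complex.exp (ip (g : ℝ → 𝔨) (f i : ℝ → 𝔨))) •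
          tm (tm (v i) (expStep (cut (f i - g) s))) (η i)‖ ^ 2 := by
  apply Complex.ofReal_injective
  rw [Complex.ofReal_mul, norm_sq_sum_cut_tm I _ v f η hs,
    norm_sq_sum_cut_tm I _ v (fun i => f i - g) η hs, Complex.ofReal_exp, Complex.ofReal_neg,
    ← cum_self, Finset.mul_sum]
  refine Finset.sum_congr rfl fun i _ => ?_
  rw [Finset.mul_sum]
  refine Finset.sum_congr rfl fun j _ => ?_
  rw [cum_sub_sub, map_mul, map_mul, ← Complex.exp_conj, ← Complex.exp_conj, map_sub, ip_conj,
    cum_conj]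
  simp only [Complex.exp_sub, Complex.exp_add, Complex.exp_neg]
  have h1 := Complex.exp_ne_zero (cum (g : ℝ → 𝔨) (g : ℝ → 𝔨) s)
  field_simp

theorem cut_eq_self {g : step D} {T : ℝ} (h : ∀ s, T ≤ s → (g : ℝ → 𝔨) s = 0) : cut g T = g := by
  refine Subtype.ext (funext fun s => ?_)
  rw [cut_apply]
  by_cases hs : s ∈ Ico 0 T
  · rw [indicator_of_mem hs]
  · rw [indicator_of_notMem hs]
    by_cases h0 : s < 0
    · exact (step_eq_zero_of_neg g h0).symm
    · exact (h s (not_lt.1 fun h' => hs ⟨not_lt.1 h0, h'⟩)).symm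

theorem norm_sum_tm_hat_zero (w : ι → HT 𝔥' (Fock 𝔨)) :
    ‖∑ i ∈ I, c i • tm (w i) (hat (0 : 𝔨) : Khat 𝔨)‖ = ‖∑ i ∈ I, c i • w i‖ := by
  have e : ∑ i ∈ I, c i • tm (w i) (hat (0 : 𝔨) : Khat 𝔨)
      = tm (∑ i ∈ I, c i • w i) (hat (0 : 𝔨) : Khat 𝔨) := by
    have h := map_sum (ket (hat (0 : 𝔨) : Khat 𝔨) : HT 𝔥' (Fock 𝔨) →L[ℂ] _)
      (fun i => c i • w i) I
    simp only [map_smul, ket_apply] at h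
    exact h.symm
  rw [e, norm_tm, norm_hat_zero, mul_one]

/-- By monotonicity in the truncation time, s may be replaced by a T beyond all supports. There
truncation has no effect, and the shift identity returns the combination of the ε(f_i). -/
theorem norm_sq_sum_shift_le {s : ℝ} (hs : 0 ≤ s) :
    ‖∑ i ∈ I, (c i * Complex.exp (ip (g : ℝ → 𝔨) (f i : ℝ → 𝔨))) •
          tm (v i) (expStep (cut (f i - g) s))‖ ^ 2
      ≤ Real.exp (ip (g : ℝ → 𝔨) (g : ℝ → 𝔨)).re *
        ‖∑ i ∈ I, c i • tm (v i) (expStep (f i))‖ ^ 2 := by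
  choose Tf hTf0 hTf using fun i => step_exists_support (f i)
  obtain ⟨Tg, hTg0, hTg⟩ := step_exists_support g
  obtain ⟨M, hM⟩ := (I.image Tf).exists_le
  obtain ⟨T, hT⟩ : ∃ T, T = max s (max M Tg) := ⟨_, rfl⟩
  have hsT : s ≤ T := hT ▸ le_max_left _ _
  have hMT : M ≤ T := hT ▸ (le_max_left _ _).trans (le_max_right _ _)
  have hgT : Tg ≤ T := hT ▸ (le_max_right _ _).trans (le_max_right _ _)
  have hT0 : 0 ≤ T := hs.trans hsT
  have hcutg : cut g T = g := cut_eq_self fun r hr => hTg r (hgT.trans hr)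
  have hcutf : ∀ i ∈ I, cut (f i) T = f i := fun i hi => cut_eq_self fun r hr =>
    hTf i r (((hM _ (Finset.mem_image_of_mem Tf hi)).trans hMT).trans hr)
  have h1 := (intervalIntegrable_norm_sq_gradient I
    (fun i => c i * Complex.exp (ip (g : ℝ → 𝔨) (f i : ℝ → 𝔨))) v (fun i => f i - g) hs hsT).2
  have h2 : 0 ≤ ∫ r in s..T, ‖∑ i ∈ I, (c i * Complex.exp (ip (g : ℝ → 𝔨) (f i : ℝ → 𝔨))) •
      tm (tm (v i) (expStep (cut (f i - g) r))) (inNoise (((f i - g : step D) : ℝ → 𝔨) r))‖ ^ 2 :=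
    intervalIntegral.integral_nonneg hsT fun _ _ => by positivity
  rw [h1, sub_nonneg] at h2
  refine h2.trans (le_of_eq ?_)
  have h3 := norm_sq_sum_future_eq I c v f g (fun _ => hat 0) hT0
  rw [norm_sum_tm_hat_zero, norm_sum_tm_hat_zero] at h3
  have e1 : ∀ i, ip (g : ℝ → 𝔨) (f i : ℝ → 𝔨) = cum (g : ℝ → 𝔨) (f i : ℝ → 𝔨) T := fun i => by
    rw [← ip_cut_left g (f i) hT0, hcutg]
  have e2 : ip (g : ℝ → 𝔨) (g : ℝ → 𝔨) = cum (g : ℝ → 𝔨) (g : ℝ → 𝔨) T := by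
    rw [← ip_cut_left g g hT0, hcutg]
  have e3 : ∑ i ∈ I, (c i * Complex.exp (ip (g : ℝ → 𝔨) (f i : ℝ → 𝔨)
        - cum (g : ℝ → 𝔨) (f i : ℝ → 𝔨) T)) • tm (v i) (expStep (cut (f i) T))
      = ∑ i ∈ I, c i • tm (v i) (expStep (f i)) :=
    Finset.sum_congr rfl fun i hi => by
      rw [e1, sub_self, Complex.exp_zero, mul_one, hcutf i hi]
  rw [e3] at h3
  rw [h3, e2, cum_self, Complex.ofReal_re, ← mul_assoc, ← Real.exp_add, add_neg_cancel,
    Real.exp_zero, one_mul]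

theorem memLp_norm_sq_intervalIntegrable {E : Type*} [NormedAddCommGroup E] {z : ℝ → E} {a b : ℝ}
    (hab : a ≤ b) (hz : MemLp z 2 (volume.restrict (Icc a b))) :
    IntervalIntegrable (fun s => ‖z s‖ ^ 2) volume a b := by
  rw [intervalIntegrable_iff_integrableOn_Icc_of_le hab]
  exact (memLp_two_iff_integrable_sq_norm hz.1).1 hz

theorem intervalIntegrable_inner_tm {z : ℝ → HT (HT 𝔥' (Fock 𝔨)) (Khat 𝔨)} {a b : ℝ}
    (hab : a ≤ b) (hz : MemLp z 2 (volume.restrict (Icc a b))) (w : HT 𝔥' (Fock 𝔨))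
    (g' : step D) (F : 𝔨 → Khat 𝔨) :
    IntervalIntegrable (fun s => ⟪tm w (F ((g' : ℝ → 𝔨) s)), z s⟫_ℂ) volume a b := by
  rw [intervalIntegrable_iff_integrableOn_Icc_of_le hab]
  have h1 : Integrable z (volume.restrict (Icc a b)) := hz.integrable (by norm_num)
  obtain ⟨m, hm, hb⟩ := step_exists_bound_comp g' fun x => ‖tm w (F x)‖
  refine (h1.norm.const_mul m).mono' ?_ (Filter.Eventually.of_forall fun s => ?_)
  · exact (step_comp_stronglyMeasurable g' fun x => tm w (F x)).aestronglyMeasurable.inner hz.1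
  · exact (norm_inner_le_norm _ _).trans (mul_le_mul_of_nonneg_right (hb s) (norm_nonneg _))

/-- Since z_s is adapted, the sum of pairings equals ⟨Θ_s, z_s⟩, where Θ_s involves only the pasts
of the f_i. Cauchy–Schwarz in time then needs a bound on ∫‖Θ_s‖², and the shift by g together with
the gradient identity provides one. -/
theorem norm_sum_pairing_sq_le (f : ι → step (⊤ : Submodule ℂ 𝔨)) (g : step (⊤ : Submodule ℂ 𝔨))
    {m T a b : ℝ} (hm : ∀ s, ‖(hat ((g : ℝ → 𝔨) s) : Khat 𝔨)‖ ^ 2 ≤ m) (ha : 0 ≤ a)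
    (hab : a ≤ b) (hbT : b ≤ T) {z : ℝ → HT (HT 𝔥' (Fock 𝔨)) (Khat 𝔨)}
    (hz : MemLp z 2 (volume.restrict (Icc a b))) (had : ∀ s ∈ Icc a b, AdaptedAt g s (z s)) :
    ‖∑ i ∈ I, starRingEnd ℂ (c i) *
        ∫ s in a..b, ⟪tm (tm (v i) (expStep (f i))) (hat ((f i : ℝ → 𝔨) s)), z s⟫_ℂ‖ ^ 2
      ≤ (2 * m * T + 2) * Real.exp (ip (g : ℝ → 𝔨) (g : ℝ → 𝔨)).re *
        (∫ s in a..b, ‖z s‖ ^ 2) * ‖∑ i ∈ I, c i • tm (v i) (expStep (f i))‖ ^ 2 := by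
  have hm0 : 0 ≤ m := (by positivity : (0 : ℝ) ≤ _).trans (hm 0)
  let c' : ι → ℂ := fun i => c i * Complex.exp (ip (g : ℝ → 𝔨) (f i : ℝ → 𝔨))
  set M := Real.exp (ip (g : ℝ → 𝔨) (g : ℝ → 𝔨)).re *
        ‖∑ i ∈ I, c i • tm (v i) (expStep (f i))‖ ^ 2 with hM
  have hM0 : 0 ≤ M := by positivity
  let n₁ : ℝ → ℝ := fun s => ‖∑ i ∈ I, c' i • tm (tm (v i) (expStep (cut (f i - g) s)))
      (inNoise (((f i - g : step (⊤ : Submodule ℂ 𝔨)) : ℝ → 𝔨) s))‖ ^ 2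
  obtain ⟨hn₁, hn₁I⟩ := intervalIntegrable_norm_sq_gradient I c' v (fun i => f i - g) ha hab
  -- Majorant of ‖Θ_s‖² from (x + y)² ≤ 2x² + 2y²: the first term comes from ĝ(s), the second from
  -- (0, f_i(s) - g(s)). The first contributes at most 2mTM to the integral. The second contributes
  -- at most 2M, because the gradient integrates to a difference of two squares of which the larger
  -- is at most M.
  let p : ℝ → ℝ := fun s => 2 * m * M + 2 * n₁ s
  have hp : IntervalIntegrable p volume a b := intervalIntegrable_const.add (hn₁.const_mul 2)
  have hpI : ∫ s in a..b, p s ≤ (2 * m * T + 2) * M := by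
    rw [intervalIntegral.integral_add intervalIntegrable_const (hn₁.const_mul 2),
      intervalIntegral.integral_const, smul_eq_mul, intervalIntegral.integral_const_mul, hn₁I]
    have h1 : ‖∑ i ∈ I, c' i • tm (v i) (expStep (cut (f i - g) b))‖ ^ 2 ≤ M :=
      norm_sq_sum_shift_le I c v f g (ha.trans hab)
    have h2 : 0 ≤ ‖∑ i ∈ I, c' i • tm (v i) (expStep (cut (f i - g) a))‖ ^ 2 := by positivity
    have h3 : (b - a) * (2 * m * M) ≤ T * (2 * m * M) := by
      gcongr
      linarith
    linarith
  have hq := memLp_norm_sq_intervalIntegrable hab hz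
  have e : ∑ i ∈ I, starRingEnd ℂ (c i) *
        ∫ s in a..b, ⟪tm (tm (v i) (expStep (f i))) (hat ((f i : ℝ → 𝔨) s)), z s⟫_ℂ
      = ∫ s in a..b, ∑ i ∈ I, starRingEnd ℂ (c i) *
        ⟪tm (tm (v i) (expStep (f i))) (hat ((f i : ℝ → 𝔨) s)), z s⟫_ℂ := by
    rw [intervalIntegral.integral_finsetSum]
    · exact Finset.sum_congr rfl fun i _ => (intervalIntegral.integral_const_mul _ _).symm
    · exact fun i _ => (intervalIntegrable_inner_tm hab hz _ (f i) hat).const_mul _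
  rw [e]
  have hmain : ∀ s ∈ Icc a b, ‖∑ i ∈ I, starRingEnd ℂ (c i) *
      ⟪tm (tm (v i) (expStep (f i))) (hat ((f i : ℝ → 𝔨) s)), z s⟫_ℂ‖ ^ 2 ≤ p s * ‖z s‖ ^ 2 := by
    intro s hs
    have hs0 : 0 ≤ s := ha.trans hs.1
    set Θ := ∑ i ∈ I, (c i * Complex.exp (ip (g : ℝ → 𝔨) (f i : ℝ → 𝔨)
        - cum (g : ℝ → 𝔨) (f i : ℝ → 𝔨) s)) • tm (tm (v i) (expStep (cut (f i) s)))
          (hat ((f i : ℝ → 𝔨) s)) with hΘ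
    have e1 : ∑ i ∈ I, starRingEnd ℂ (c i) *
        ⟪tm (tm (v i) (expStep (f i))) (hat ((f i : ℝ → 𝔨) s)), z s⟫_ℂ = ⟪Θ, z s⟫_ℂ := by
      rw [hΘ, sum_inner]
      refine Finset.sum_congr rfl fun i _ => ?_
      rw [had s hs, inner_smul_left, map_mul, ← Complex.exp_conj, map_sub, ip_conj, cum_conj]
      ring
    have e2 : ∑ i ∈ I, c' i • tm (tm (v i) (expStep (cut (f i - g) s))) (hat ((f i : ℝ → 𝔨) s))
        = tm (∑ i ∈ I, c' i • tm (v i) (expStep (cut (f i - g) s))) (hat ((g : ℝ → 𝔨) s))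
          + ∑ i ∈ I, c' i • tm (tm (v i) (expStep (cut (f i - g) s)))
            (inNoise (((f i - g : step (⊤ : Submodule ℂ 𝔨)) : ℝ → 𝔨) s)) := by
      have h := map_sum (ket (hat ((g : ℝ → 𝔨) s)) : HT 𝔥' (Fock 𝔨) →L[ℂ] _)
        (fun i => c' i • tm (v i) (expStep (cut (f i - g) s))) I
      simp only [map_smul, ket_apply] at h
      rw [h, ← Finset.sum_add_distrib]
      refine Finset.sum_congr rfl fun i _ => ?_
      rw [← smul_add, ← tm_add_right, hat_eq_add ((f i : ℝ → 𝔨) s) ((g : ℝ → 𝔨) s)]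
      rfl
    have h1 : ‖Θ‖ ^ 2 ≤ p s := by
      rw [hΘ, norm_sq_sum_future_eq I c v f g (fun i => hat ((f i : ℝ → 𝔨) s)) hs0]
      have h2 : Real.exp (-∫ r in (0 : ℝ)..s, ‖(g : ℝ → 𝔨) r‖ ^ 2) ≤ 1 := by
        rw [Real.exp_le_one_iff, neg_nonpos]
        exact intervalIntegral.integral_nonneg hs0 fun _ _ => by positivity
      refine (mul_le_of_le_one_left (by positivity) h2).trans ?_
      rw [e2]
      have h3 := norm_add_le
        (tm (∑ i ∈ I, c' i • tm (v i) (expStep (cut (f i - g) s))) (hat ((g : ℝ → 𝔨) s)))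
        (∑ i ∈ I, c' i • tm (tm (v i) (expStep (cut (f i - g) s)))
            (inNoise (((f i - g : step (⊤ : Submodule ℂ 𝔨)) : ℝ → 𝔨) s)))
      have h4 : ‖tm (∑ i ∈ I, c' i • tm (v i) (expStep (cut (f i - g) s)))
          (hat ((g : ℝ → 𝔨) s))‖ ^ 2 ≤ m * M := by
        rw [norm_tm, mul_pow, mul_comm m]
        exact mul_le_mul (norm_sq_sum_shift_le I c v f g hs0) (hm s) (by positivity) hM0
      have h5 := pow_le_pow_left₀ (norm_nonneg _) h3 2
      refine h5.trans ((add_sq_le).trans ?_)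
      simp only [p, n₁]
      linarith
    rw [e1]
    calc ‖⟪Θ, z s⟫_ℂ‖ ^ 2 ≤ (‖Θ‖ * ‖z s‖) ^ 2 := by gcongr; exact norm_inner_le_norm _ _
      _ = ‖Θ‖ ^ 2 * ‖z s‖ ^ 2 := by ring
      _ ≤ _ := by gcongr
  refine (norm_integral_sq_le hab hp hq (fun s _ => ?_) (fun _ _ => by positivity) hmain).trans ?_
  · have : 0 ≤ n₁ s := by positivity
    positivity
  · have hQ : 0 ≤ ∫ s in a..b, ‖z s‖ ^ 2 :=
      intervalIntegral.integral_nonneg hab fun _ _ => by positivity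
    calc _ ≤ (2 * m * T + 2) * M * ∫ s in a..b, ‖z s‖ ^ 2 := by gcongr
      _ = _ := by rw [hM]; ring

/-- The integral is the Riesz vector of the pairing functional, so existence and the L² estimate
come out together. C depends on g and T only, as iteration requires. -/
theorem exists_adapted_integral (g : step D) (T : ℝ) :
    ∃ C : ℝ, 0 ≤ C ∧ ∀ (a b : ℝ), 0 ≤ a → a ≤ b → b ≤ T →
      ∀ z : ℝ → HT (HT 𝔥' (Fock 𝔨)) (Khat 𝔨), MemLp z 2 (volume.restrict (Icc a b)) →
      (∀ s ∈ Icc a b, AdaptedAt (g : ℝ → 𝔨) s (z s)) →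
      ∃ y : HT 𝔥' (Fock 𝔨), (∀ (u : 𝔥') (g' : step (⊤ : Submodule ℂ 𝔨)),
        ⟪tm u (expStep g'), y⟫_ℂ =
          ∫ s in a..b, ⟪tm (tm u (expStep g')) (hat ((g' : ℝ → 𝔨) s)), z s⟫_ℂ) ∧
        ‖y‖ ^ 2 ≤ C ^ 2 * ∫ s in a..b, ‖z s‖ ^ 2 := by
  let g₁ : step (⊤ : Submodule ℂ 𝔨) := ⟨g, step_mono le_top g.2⟩
  obtain ⟨m, hm0, hm⟩ := step_exists_bound_comp g₁ fun x => ‖(hat x : Khat 𝔨)‖ ^ 2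
  set K := (2 * m * T + 2) * Real.exp (ip (g : ℝ → 𝔨) (g : ℝ → 𝔨)).re with hK
  refine ⟨Real.sqrt K, Real.sqrt_nonneg _, fun a b ha hab hbT z hz had => ?_⟩
  have hT0 : 0 ≤ T := (ha.trans hab).trans hbT
  have hK0 : 0 ≤ K := by positivity
  have hQ : 0 ≤ ∫ s in a..b, ‖z s‖ ^ 2 :=
    intervalIntegral.integral_nonneg hab fun _ _ => by positivity
  -- The functional is defined on formal combinations of pairs (v', g'). That it depends only on the
  -- vector they represent is a consequence of the estimate. Conjugation makes it linear.
  let J : ((𝔥' × step (⊤ : Submodule ℂ 𝔨)) →₀ ℂ) →ₗ[ℂ] HT 𝔥' (Fock 𝔨) :=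
    Finsupp.linearCombination ℂ fun p => tm p.1 (expStep p.2)
  let l : ((𝔥' × step (⊤ : Submodule ℂ 𝔨)) →₀ ℂ) →ₗ[ℂ] ℂ :=
    Finsupp.linearCombination ℂ fun p => starRingEnd ℂ
      (∫ s in a..b, ⟪tm (tm p.1 (expStep p.2)) (hat ((p.2 : ℝ → 𝔨) s)), z s⟫_ℂ)
  obtain ⟨y, hy, hyl⟩ := exists_inner_eq_of_le J l
    (C := Real.sqrt (K * ∫ s in a..b, ‖z s‖ ^ 2)) (Real.sqrt_nonneg _) (fun c => by
      refine le_of_sq_le_sq ?_ (by positivity)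
      rw [mul_pow, Real.sq_sqrt (by positivity)]
      have h := norm_sum_pairing_sq_le c.support c (fun p => p.1) (fun p => p.2) g₁ hm ha hab hbT
        hz had
      have e : ‖l c‖ = ‖∑ p ∈ c.support, starRingEnd ℂ (c p) *
          ∫ s in a..b, ⟪tm (tm p.1 (expStep p.2)) (hat ((p.2 : ℝ → 𝔨) s)), z s⟫_ℂ‖ := by
        rw [← RCLike.norm_conj, Finsupp.linearCombination_apply, Finsupp.sum, map_sum]
        simp
      rw [e]
      exact h)
  refine ⟨y, fun u g' => ?_, ?_⟩
  · have h := hyl (Finsupp.single (u, g') 1)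
    simp only [J, l, Finsupp.linearCombination_single, one_smul] at h
    rw [← inner_conj_symm, h, Complex.conj_conj]
  · rw [Real.sq_sqrt hK0]
    have h := pow_le_pow_left₀ (norm_nonneg _) hy 2
    rwa [Real.sq_sqrt (by positivity)] at h

end Integral

/-! ### Families of columns -/

section Measurability

variable {E : Type*} [NormedAddCommGroup E]

theorem aestronglyMeasurable_simpleFunc_comp {Q : Type*} (q : SimpleFunc ℝ Q) (Z : Q → ℝ → E)
    {μ : Measure ℝ} (h : ∀ c ∈ range q, AEStronglyMeasurable (Z c) μ) :
    AEStronglyMeasurable (fun s => Z (q s) s) μ := by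
  classical
  have e : (fun s => Z (q s) s) = fun s => ∑ c ∈ q.range, (q ⁻¹' {c}).indicator (Z c) s := by
    funext s
    refine ((Finset.sum_eq_single (q s) ?_ ?_).trans ?_).symm
    · intro c _ hc
      simp [indicator, Ne.symm hc]
    · exact fun h' => absurd (q.mem_range_self s) h'
    · simp [indicator]
  rw [e]
  refine Finset.aestronglyMeasurable_fun_sum _ fun c hc => ?_
  exact (h c (SimpleFunc.mem_range.1 hc)).indicator (q.measurableSet_fiber c)

theorem intervalIntegrable_simpleFunc_comp {Q : Type*} (q : SimpleFunc ℝ Q) {Z : Q → ℝ → E}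
    {a b : ℝ} (hab : a ≤ b) (h : ∀ c, ContinuousOn (Z c) (Icc a b)) :
    IntervalIntegrable (fun s => Z (q s) s) volume a b := by
  choose M hM using fun c => isCompact_Icc.exists_bound_of_continuousOn (h c)
  obtain ⟨m, hm⟩ := (q.finite_range.image M).bddAbove
  rw [intervalIntegrable_iff_integrableOn_Icc_of_le hab]
  refine Integrable.of_bound (aestronglyMeasurable_simpleFunc_comp q Z fun c _ =>
    (h c).aestronglyMeasurable measurableSet_Icc) m ?_
  filter_upwards [ae_restrict_mem measurableSet_Icc] with s hs
  exact (hM _ s hs).trans (hm ⟨_, ⟨s, rfl⟩, rfl⟩)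

theorem continuousOn_of_holder {F : ℝ → E}
    (h : ∀ T : ℝ, ∃ C : ℝ, ∀ s ∈ Icc 0 T, ∀ t ∈ Icc 0 T,
      ‖F t - F s‖ ≤ C * |t - s| ^ (1 / 2 : ℝ)) : ContinuousOn F (Ici 0) := by
  intro s hs
  obtain ⟨C, hC⟩ := h (s + 1)
  have hs0 : (0 : ℝ) ≤ s := hs
  rw [ContinuousWithinAt, tendsto_iff_norm_sub_tendsto_zero]
  have hc : Continuous fun t : ℝ => C * |t - s| ^ (1 / 2 : ℝ) :=
    continuous_const.mul ((continuous_id.sub continuous_const).abs.rpow_const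
      fun _ => Or.inr (by norm_num))
  have h0 : Filter.Tendsto (fun t : ℝ => C * |t - s| ^ (1 / 2 : ℝ)) (nhdsWithin s (Ici 0))
      (nhds 0) := by
    have := hc.tendsto s
    simp only [sub_self, abs_zero] at this
    rw [Real.zero_rpow (by norm_num), mul_zero] at this
    exact this.mono_left nhdsWithin_le_nhds
  refine squeeze_zero' (Filter.Eventually.of_forall fun _ => norm_nonneg _) ?_ h0
  have : Iio (s + 1) ∈ nhdsWithin s (Ici 0) :=
    mem_nhdsWithin_of_mem_nhds (Iio_mem_nhds (by linarith))
  filter_upwards [this, self_mem_nhdsWithin] with t ht ht'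
  exact hC s ⟨hs0, by linarith⟩ t ⟨ht', le_of_lt ht⟩

end Measurability

/-! ### Finitely many values of ĝ -/

section Hats

variable {𝔨 : Type u} [NormedAddCommGroup 𝔨] [InnerProductSpace ℂ 𝔨] {D : Submodule ℂ 𝔨}

/-- As ĝ takes finitely many values on measurable sets, a quantity depending on s through ĝ(s) needs
to be controlled only for each fixed ζ ∈ D̂. Thus no uniformity or continuity of φ in ζ is needed.
-/
theorem exists_simpleFunc_hatStep (g : step D) :
    ∃ q : SimpleFunc ℝ (dhat D), ∀ s, q s = hatStep g s := by
  obtain ⟨f, hf⟩ := step_exists_simpleFunc g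
  refine ⟨⟨hatStep g, fun ζ => ?_, ?_⟩, fun _ => rfl⟩
  · have e : hatStep g ⁻¹' {ζ} = f ⁻¹' {c | (hat c : Khat 𝔨) = ζ} := by
      ext s
      simp only [mem_preimage, mem_singleton_iff, Subtype.ext_iff, hf]
      rfl
    rw [e]
    exact f.measurableSet_preimage _
  · refine Set.Finite.of_finite_image (f := Subtype.val) ?_ Subtype.val_injective.injOn
    refine (f.finite_range.image (hat : 𝔨 → Khat 𝔨)).subset ?_
    rintro _ ⟨_, ⟨s, rfl⟩, rfl⟩
    exact ⟨_, ⟨s, rfl⟩, by rw [hf]; rfl⟩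

theorem exists_bound_hatStep (g : step D) (L : dhat D → ℝ) :
    ∃ M : ℝ, 0 ≤ M ∧ ∀ s, L (hatStep g s) ≤ M := by
  obtain ⟨q, hq⟩ := exists_simpleFunc_hatStep g
  obtain ⟨m, hm⟩ := (q.finite_range.image L).bddAbove
  exact ⟨max m 0, le_max_right _ _, fun s =>
    (hm ⟨_, ⟨s, rfl⟩, by rw [hq]⟩).trans (le_max_left _ _)⟩

theorem exists_simpleFunc_hatStep_pair {D' : Submodule ℂ 𝔨} (g' : step D') (g : step D) :
    ∃ q : SimpleFunc ℝ (Khat 𝔨 × dhat D), ∀ s, q s = (hat ((g' : ℝ → 𝔨) s), hatStep g s) := by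
  obtain ⟨q, hq⟩ := exists_simpleFunc_hatStep g
  obtain ⟨q', hq'⟩ := exists_simpleFunc_hatStep g'
  refine ⟨(q'.map Subtype.val).pair q, fun s => ?_⟩
  rw [SimpleFunc.pair_apply, SimpleFunc.map_apply, hq, hq']
  rfl

theorem exists_bound_hatStep_pair {D' : Submodule ℂ 𝔨} (g' : step D') (g : step D)
    (L : Khat 𝔨 → dhat D → ℝ) :
    ∃ M : ℝ, 0 ≤ M ∧ ∀ s, L (hat ((g' : ℝ → 𝔨) s)) (hatStep g s) ≤ M := by
  obtain ⟨q, hq⟩ := exists_simpleFunc_hatStep_pair g' g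
  obtain ⟨m, hm⟩ := (q.finite_range.image fun ζ => L ζ.1 ζ.2).bddAbove
  exact ⟨max m 0, le_max_right _ _, fun s =>
    (hm ⟨_, ⟨s, rfl⟩, by rw [hq]⟩).trans (le_max_left _ _)⟩

end Hats

/-! ### Lifts and integral estimates for families of columns -/

section Columns

variable {𝔨 : Type*} [NormedAddCommGroup 𝔨] [InnerProductSpace ℂ 𝔨] [CompleteSpace 𝔨]
  {𝔥 : Type*} [NormedAddCommGroup 𝔥] [InnerProductSpace ℂ 𝔥]
  {𝔥' : Type*} [NormedAddCommGroup 𝔥'] [InnerProductSpace ℂ 𝔥']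
  {V : Type*} [NormedAddCommGroup V] [NormedSpace ℂ V] [OperatorSpace V]
  {D : Submodule ℂ 𝔨} {S : Set ℕ}

/-- Local boundedness and local Hölder continuity with exponent `1/2`, at the matrix levels
in `S`. -/
structure Regular (S : Set ℕ) (A : ℝ → V →ₗ[ℂ] (𝔥 →L[ℂ] HT 𝔥' (Fock 𝔨))) : Prop where
  bound : ∀ T : ℝ, ∃ C : ℝ, 0 ≤ C ∧ ∀ t ∈ Icc 0 T, HasLevelBound S (A t) C
  holder : ∀ T : ℝ, ∃ C : ℝ, 0 ≤ C ∧ ∀ s ∈ Icc 0 T, ∀ t ∈ Icc 0 T,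
    HasLevelBound S (A t - A s) (C * |t - s| ^ (1 / 2 : ℝ))

/-- Adaptedness of a family of columns indexed by the step functions. -/
def FamAdapted (A : step D → ℝ → V →ₗ[ℂ] (𝔥 →L[ℂ] HT 𝔥' (Fock 𝔨))) : Prop :=
  ∀ (g : step D) (t : ℝ), 0 ≤ t → ∀ (x : V) (u : 𝔥) (u' : 𝔥') (g' : step (⊤ : Submodule ℂ 𝔨)),
    ⟪tm u' (expStep g'), A g t x u⟫_ℂ =
      ⟪tm u' (expStep (cut g' t)), A (cut g t) t x u⟫_ℂ *
        Complex.exp (ip (g' : ℝ → 𝔨) (g : ℝ → 𝔨) - cum (g' : ℝ → 𝔨) (g : ℝ → 𝔨) t)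

/-- The weak form of `B_t = ∫_0^t A_s • dΛ_φ(s)`. -/
def WeakEq (φ : dhat D →ₗ[ℂ] V →ₗ[ℂ] CBMap (StrongDual ℂ (Khat 𝔨)) V)
    (A B : step D → ℝ → V →ₗ[ℂ] (𝔥 →L[ℂ] HT 𝔥' (Fock 𝔨))) : Prop :=
  ∀ (g : step D) (t : ℝ), 0 ≤ t → ∀ (x : V) (u : 𝔥) (u' : 𝔥') (g' : step (⊤ : Submodule ℂ 𝔨)),
    ⟪tm u' (expStep g'), B g t x u⟫_ℂ = ∫ s in (0 : ℝ)..t,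
      ⟪tm u' (expStep g'), A g s (coeff φ (hat ((g' : ℝ → 𝔨) s)) (hatStep g s) x) u⟫_ℂ

theorem cum_cut_left (f : step D) {D' : Submodule ℂ 𝔨} (g : step D') {s t : ℝ} (hs : 0 ≤ s)
    (hst : s ≤ t) :
    cum (cut f t : ℝ → 𝔨) (g : ℝ → 𝔨) s = cum (f : ℝ → 𝔨) (g : ℝ → 𝔨) s := by
  rw [cum, cum, intervalIntegral.integral_of_le hs, intervalIntegral.integral_of_le hs,
    ← integral_Ico_eq_integral_Ioc, ← integral_Ico_eq_integral_Ioc]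
  refine setIntegral_congr_fun measurableSet_Ico fun r hr => ?_
  simp only [cut_apply]
  rw [indicator_of_mem (show r ∈ Ico 0 t from ⟨hr.1, hr.2.trans_le hst⟩)]

theorem cut_cut (g : step D) {s t : ℝ} (hst : s ≤ t) : cut (cut g t) s = cut g s := by
  refine Subtype.ext ?_
  rw [cut_apply, cut_apply, cut_apply, indicator_indicator]
  congr 1
  exact inter_eq_left.2 (Ico_subset_Ico_right hst)

/-- Adaptedness is applied once to g' and once to its truncation, with g fixed. The truncated column
cancels, leaving a condition on the vector A_{g,t}(x)u alone. -/
theorem FamAdapted.vector {A : step D → ℝ → V →ₗ[ℂ] (𝔥 →L[ℂ] HT 𝔥' (Fock 𝔨))}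
    (hA : FamAdapted A) (g : step D) {t : ℝ} (ht : 0 ≤ t) (x : V) (u : 𝔥) (u' : 𝔥')
    (g' : step (⊤ : Submodule ℂ 𝔨)) :
    ⟪tm u' (expStep g'), A g t x u⟫_ℂ = ⟪tm u' (expStep (cut g' t)), A g t x u⟫_ℂ *
      Complex.exp (ip (g' : ℝ → 𝔨) (g : ℝ → 𝔨) - cum (g' : ℝ → 𝔨) (g : ℝ → 𝔨) t) := by
  rw [hA g t ht x u u' g', hA g t ht x u u' (cut g' t), cut_cut g' le_rfl, ip_cut_left g' g ht,
    cum_cut_left g' g ht le_rfl, sub_self, Complex.exp_zero, mul_one]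

variable [CompleteSpace 𝔥']

/-- The lift of `A` along `ψ`, if there is one. -/
def hatLift (A : V →ₗ[ℂ] (𝔥 →L[ℂ] HT 𝔥' (Fock 𝔨)))
    (ψ : V →ₗ[ℂ] CBMap (StrongDual ℂ (Khat 𝔨)) V) :
    V →ₗ[ℂ] (𝔥 →L[ℂ] HT (HT 𝔥' (Fock 𝔨)) (Khat 𝔨)) :=
  open Classical in if h : ∃ B, IsHatLift A ψ B then h.choose else 0

theorem hatLift_eq {A : V →ₗ[ℂ] (𝔥 →L[ℂ] HT 𝔥' (Fock 𝔨))}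
    {ψ : V →ₗ[ℂ] CBMap (StrongDual ℂ (Khat 𝔨)) V}
    {B : V →ₗ[ℂ] (𝔥 →L[ℂ] HT (HT 𝔥' (Fock 𝔨)) (Khat 𝔨))} (h : IsHatLift A ψ B) :
    hatLift A ψ = B := by
  have h' : ∃ B, IsHatLift A ψ B := ⟨B, h⟩
  rw [hatLift, dif_pos h']
  exact h'.choose_spec.unique h

theorem Liftable.exists_bound {ψ : V →ₗ[ℂ] CBMap (StrongDual ℂ (Khat 𝔨)) V}
    (h : Liftable S ψ 𝔥 (HT 𝔥' (Fock 𝔨))) :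
    ∃ L : ℝ, 0 ≤ L ∧ ∀ (A : V →ₗ[ℂ] (𝔥 →L[ℂ] HT 𝔥' (Fock 𝔨))) (C : ℝ), 0 ≤ C →
      HasLevelBound S A C → IsHatLift A ψ (hatLift A ψ) ∧
        HasLevelBound S (hatLift A ψ) (L * C) := by
  obtain ⟨L, hL, h⟩ := h
  refine ⟨L, hL, fun A C hC hA => ?_⟩
  obtain ⟨B, hB, hB'⟩ := h A C hC hA
  rw [hatLift_eq hB]
  exact ⟨hB, hB'⟩

theorem IsHatLift.inner_eq {A : V →ₗ[ℂ] (𝔥 →L[ℂ] HT 𝔥' (Fock 𝔨))}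
    {φ : dhat D →ₗ[ℂ] V →ₗ[ℂ] CBMap (StrongDual ℂ (Khat 𝔨)) V} {ζ : dhat D}
    {B : V →ₗ[ℂ] (𝔥 →L[ℂ] HT (HT 𝔥' (Fock 𝔨)) (Khat 𝔨))} (h : IsHatLift A (φ ζ) B)
    (w : HT 𝔥' (Fock 𝔨)) (η : Khat 𝔨) (x : V) (v : 𝔥) :
    ⟪tm w η, B x v⟫_ℂ = ⟪w, A (coeff φ η ζ x) v⟫_ℂ := by
  rw [← inner_bra, h]
  rfl

theorem Regular.isHatLift {A : ℝ → V →ₗ[ℂ] (𝔥 →L[ℂ] HT 𝔥' (Fock 𝔨))} (hA : Regular S A)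
    {ψ : V →ₗ[ℂ] CBMap (StrongDual ℂ (Khat 𝔨)) V} (hψ : Liftable S ψ 𝔥 (HT 𝔥' (Fock 𝔨)))
    {t : ℝ} (ht : 0 ≤ t) : IsHatLift (A t) ψ (hatLift (A t) ψ) := by
  obtain ⟨C, hC, h⟩ := hA.bound t
  obtain ⟨L, hL, h'⟩ := hψ.exists_bound
  exact (h' _ _ hC (h t ⟨ht, le_rfl⟩)).1

theorem Regular.continuousOn {A : ℝ → V →ₗ[ℂ] (𝔥 →L[ℂ] HT 𝔥' (Fock 𝔨))} (hA : Regular S A)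
    (h1 : 1 ∈ S) (x : V) : ContinuousOn (fun t => A t x) (Ici 0) := by
  refine continuousOn_of_holder fun T => ?_
  obtain ⟨C, hC, h⟩ := hA.holder T
  refine ⟨C * ‖x‖, fun s hs t ht => ?_⟩
  refine ((h s hs t ht).norm_le h1 (by positivity) x).trans (le_of_eq (by ring))

/-- Lifts are unique, so the lift of a difference is the difference of the lifts, and the Hölder
estimate passes through the bound for lifting. -/
theorem Regular.continuousOn_hatLift {A : ℝ → V →ₗ[ℂ] (𝔥 →L[ℂ] HT 𝔥' (Fock 𝔨))}
    (hA : Regular S A) (h1 : 1 ∈ S) {ψ : V →ₗ[ℂ] CBMap (StrongDual ℂ (Khat 𝔨)) V}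
    (hψ : Liftable S ψ 𝔥 (HT 𝔥' (Fock 𝔨))) (x : V) (v : 𝔥) :
    ContinuousOn (fun t => hatLift (A t) ψ x v) (Ici 0) := by
  refine continuousOn_of_holder fun T => ?_
  obtain ⟨C, hC, h⟩ := hA.holder T
  obtain ⟨L, hL, h'⟩ := hψ.exists_bound
  refine ⟨L * C * ‖x‖ * ‖v‖, fun s hs t ht => ?_⟩
  have h2 := h' _ _ (by positivity) (h s hs t ht)
  have e : hatLift (A t - A s) ψ = hatLift (A t) ψ - hatLift (A s) ψ := by
    refine hatLift_eq fun x η v => ?_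
    have e1 := hA.isHatLift hψ ht.1 x η v
    have e2 := hA.isHatLift hψ hs.1 x η v
    rw [LinearMap.sub_apply, sub_apply, map_sub, e1, e2]
    rfl
  rw [e] at h2
  exact (h2.2.norm_apply_le h1 x v).trans (le_of_eq (by ring))

variable {φ : dhat D →ₗ[ℂ] V →ₗ[ℂ] CBMap (StrongDual ℂ (Khat 𝔨)) V}

theorem aestronglyMeasurable_hatLift (h1 : 1 ∈ S)
    (hφ : ∀ ζ, Liftable S (φ ζ) 𝔥 (HT 𝔥' (Fock 𝔨)))
    {A : ℝ → V →ₗ[ℂ] (𝔥 →L[ℂ] HT 𝔥' (Fock 𝔨))} (hA : Regular S A) (g : step D)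
    (x : V) (v : 𝔥) {a b : ℝ} (ha : 0 ≤ a) :
    AEStronglyMeasurable (fun s => hatLift (A s) (φ (hatStep g s)) x v)
      (volume.restrict (Icc a b)) := by
  obtain ⟨q, hq⟩ := exists_simpleFunc_hatStep g
  simp_rw [← hq]
  refine aestronglyMeasurable_simpleFunc_comp q (fun ζ s => hatLift (A s) (φ ζ) x v) fun ζ _ => ?_
  exact ((hA.continuousOn_hatLift h1 (hφ ζ) x v).mono
    fun s hs => ha.trans hs.1).aestronglyMeasurable measurableSet_Icc

theorem exists_hatLift_bound (hφ : ∀ ζ, Liftable S (φ ζ) 𝔥 (HT 𝔥' (Fock 𝔨)))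
    (g : step D) : ∃ L : ℝ, 0 ≤ L ∧ ∀ (s : ℝ) (A : V →ₗ[ℂ] (𝔥 →L[ℂ] HT 𝔥' (Fock 𝔨))) (C : ℝ),
      0 ≤ C → HasLevelBound S A C → HasLevelBound S (hatLift A (φ (hatStep g s))) (L * C) := by
  choose L hL hL' using fun ζ => (hφ ζ).exists_bound
  obtain ⟨M, hM, hM'⟩ := exists_bound_hatStep g L
  refine ⟨M, hM, fun s A C hC hA => ((hL' _ A C hC hA).2).mono ?_⟩
  exact mul_le_mul_of_nonneg_right (hM' s) hC

theorem memLp_hatLift (h1 : 1 ∈ S) (hφ : ∀ ζ, Liftable S (φ ζ) 𝔥 (HT 𝔥' (Fock 𝔨)))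
    {A : ℝ → V →ₗ[ℂ] (𝔥 →L[ℂ] HT 𝔥' (Fock 𝔨))} (hA : Regular S A) (g : step D)
    (x : V) (v : 𝔥) {a b : ℝ} (ha : 0 ≤ a) :
    MemLp (fun s => hatLift (A s) (φ (hatStep g s)) x v) 2 (volume.restrict (Icc a b)) := by
  obtain ⟨L, hL, hL'⟩ := exists_hatLift_bound hφ g
  obtain ⟨C, hC, h⟩ := hA.bound b
  refine MemLp.of_bound (aestronglyMeasurable_hatLift h1 hφ hA g x v ha) (L * C * ‖x‖ * ‖v‖) ?_
  filter_upwards [ae_restrict_mem measurableSet_Icc] with s hs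
  exact (hL' s _ _ hC (h s ⟨ha.trans hs.1, hs.2⟩)).norm_apply_le h1 x v

/-- Each slice of the lift is A_{g,s} at another element of V, and the adaptedness identity holds
for all elements of V. -/
theorem adaptedAt_hatLift (hφ : ∀ ζ, Liftable S (φ ζ) 𝔥 (HT 𝔥' (Fock 𝔨)))
    {A : step D → ℝ → V →ₗ[ℂ] (𝔥 →L[ℂ] HT 𝔥' (Fock 𝔨))} (had : FamAdapted A) (g : step D)
    (hA : Regular S (A g)) (x : V) (v : 𝔥) {s : ℝ} (hs : 0 ≤ s) :
    AdaptedAt (g : ℝ → 𝔨) s (hatLift (A g s) (φ (hatStep g s)) x v) := by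
  intro u g' η
  have h := hA.isHatLift (hφ (hatStep g s)) hs
  rw [h.inner_eq, h.inner_eq]
  exact had.vector g hs _ v u g'

theorem AdaptedAt.sum {ι : Type*} (I : Finset ι) {g : ℝ → 𝔨} {s : ℝ}
    {z : ι → HT (HT 𝔥' (Fock 𝔨)) (Khat 𝔨)} (h : ∀ i ∈ I, AdaptedAt g s (z i)) :
    AdaptedAt g s (∑ i ∈ I, z i) := by
  intro u g' η
  rw [inner_sum, inner_sum, Finset.sum_mul]
  exact Finset.sum_congr rfl fun i hi => h i hi u g' η

theorem inner_sum_hatLift (hφ : ∀ ζ, Liftable S (φ ζ) 𝔥 (HT 𝔥' (Fock 𝔨)))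
    {A : ℝ → V →ₗ[ℂ] (𝔥 →L[ℂ] HT 𝔥' (Fock 𝔨))} (hA : Regular S A) (g : step D)
    (x : V) (v : 𝔥) {s : ℝ} (hs : 0 ≤ s) (w : HT 𝔥' (Fock 𝔨)) (η : Khat 𝔨) :
    ⟪tm w η, hatLift (A s) (φ (hatStep g s)) x v⟫_ℂ
      = ⟪w, A s (coeff φ η (hatStep g s) x) v⟫_ℂ :=
  (hA.isHatLift (hφ (hatStep g s)) hs).inner_eq w η x v

theorem intervalIntegrable_weak (h1 : 1 ∈ S) (hφ : ∀ ζ, Liftable S (φ ζ) 𝔥 (HT 𝔥' (Fock 𝔨)))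
    {A : ℝ → V →ₗ[ℂ] (𝔥 →L[ℂ] HT 𝔥' (Fock 𝔨))} (hA : Regular S A) {D' : Submodule ℂ 𝔨}
    (g : step D) (x : V) (v : 𝔥) (w : HT 𝔥' (Fock 𝔨)) (g' : step D') {a b : ℝ}
    (ha : 0 ≤ a) (hab : a ≤ b) :
    IntervalIntegrable (fun s => ⟪w, A s (coeff φ (hat ((g' : ℝ → 𝔨) s)) (hatStep g s) x) v⟫_ℂ)
      volume a b := by
  refine (intervalIntegrable_inner_tm hab (memLp_hatLift h1 hφ hA g x v ha) w g' hat).congr ?_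
  intro s hs
  rw [uIoc_of_le hab] at hs
  exact inner_sum_hatLift hφ hA g x v (ha.trans hs.1.le) w _

/-- The increment of B is the integral of the lifted A, so the L² estimate applies to it row by row.
R is chosen before A and B, so it can be used unchanged at every stage of the iteration. -/
theorem exists_integral_estimate (h1 : 1 ∈ S)
    (hφ : ∀ ζ, Liftable S (φ ζ) 𝔥 (HT 𝔥' (Fock 𝔨))) (g : step D) (T : ℝ) :
    ∃ R : ℝ, 0 ≤ R ∧ ∀ A B : step D → ℝ → V →ₗ[ℂ] (𝔥 →L[ℂ] HT 𝔥' (Fock 𝔨)),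
      FamAdapted A → Regular S (A g) → WeakEq φ A B →
      ∀ c : ℝ → ℝ, Continuous c → (∀ r, 0 ≤ c r) →
      (∀ r ∈ Icc 0 T, HasLevelBound S (A g r) (c r)) →
      ∀ s t : ℝ, 0 ≤ s → s ≤ t → t ≤ T →
        HasLevelBound S (B g t - B g s) (R * Real.sqrt (∫ r in s..t, c r ^ 2)) := by
  obtain ⟨L, hL, hL'⟩ := exists_hatLift_bound (𝔥' := 𝔥') hφ g
  obtain ⟨C, hC, hInt⟩ := exists_adapted_integral (𝔥' := 𝔥') g T
  refine ⟨C * L, by positivity, fun A B had hreg hw c hc hc0 hb s t hs hst htT => ?_⟩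
  have hI : 0 ≤ ∫ r in s..t, c r ^ 2 :=
    intervalIntegral.integral_nonneg hst fun _ _ => by positivity
  refine hasLevelBound_of_sum_le (by positivity) fun n hn X v => ?_
  -- The rows of the lifted matrix applied to v. The level bound of the lift controls the sum of
  -- their square norms at each time.
  let z : Fin n → ℝ → HT (HT 𝔥' (Fock 𝔨)) (Khat 𝔨) := fun i r =>
    ∑ j, hatLift (A g r) (φ (hatStep g r)) (X i j) (v j)
  have hz : ∀ i, MemLp (z i) 2 (volume.restrict (Icc s t)) := fun i =>
    memLp_finsetSum _ fun j _ => memLp_hatLift h1 hφ hreg g (X i j) (v j) hs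
  have hza : ∀ i, ∀ r ∈ Icc s t, AdaptedAt (g : ℝ → 𝔨) r (z i r) := fun i r hr =>
    AdaptedAt.sum _ fun j _ => adaptedAt_hatLift hφ had g hreg _ _ (hs.trans hr.1)
  choose y hy hyn using fun i => hInt s t hs hst htT (z i) (hz i) (hza i)
  -- The vectors y_i from the existence lemma are the rows of the increment of B, because both have
  -- the same pairings with the total set of vectors u ε(g').
  have hye : ∀ i, y i = ∑ j, (B g t - B g s) (X i j) (v j) := by
    intro i
    refine ext_expStep (E := ⊤) (D := ⊤) dense_univ dense_univ fun u _ g' => ?_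
    rw [hy, inner_sum]
    have e1 : ∀ j, ⟪tm u (expStep g'), (B g t - B g s) (X i j) (v j)⟫_ℂ
        = ∫ r in s..t, ⟪tm u (expStep g'),
          A g r (coeff φ (hat ((g' : ℝ → 𝔨) r)) (hatStep g r) (X i j)) (v j)⟫_ℂ := by
      intro j
      rw [LinearMap.sub_apply, sub_apply, inner_sub_right,
        hw g t (hs.trans hst), hw g s hs]
      exact intervalIntegral.integral_interval_sub_left
        (intervalIntegrable_weak h1 hφ hreg g _ _ _ g' le_rfl (hs.trans hst))
        (intervalIntegrable_weak h1 hφ hreg g _ _ _ g' le_rfl hs)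
    rw [Finset.sum_congr rfl fun j _ => e1 j, ← intervalIntegral.integral_finsetSum
      fun j _ => intervalIntegrable_weak h1 hφ hreg g _ _ _ g' hs hst]
    refine intervalIntegral.integral_congr fun r hr => ?_
    rw [uIcc_of_le hst] at hr
    simp only [z, inner_sum]
    exact Finset.sum_congr rfl fun j _ =>
      inner_sum_hatLift hφ hreg g _ _ (hs.trans hr.1) _ _
  simp_rw [← hye]
  have hzi : ∀ i, IntervalIntegrable (fun r => ‖z i r‖ ^ 2) volume s t := fun i =>
    memLp_norm_sq_intervalIntegrable hst (hz i)
  calc ∑ i, ‖y i‖ ^ 2 ≤ ∑ i, C ^ 2 * ∫ r in s..t, ‖z i r‖ ^ 2 :=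
        Finset.sum_le_sum fun i _ => hyn i
    _ = C ^ 2 * ∫ r in s..t, ∑ i, ‖z i r‖ ^ 2 := by
        rw [← Finset.mul_sum, intervalIntegral.integral_finsetSum fun i _ => hzi i]
    _ ≤ C ^ 2 * ∫ r in s..t, (L * mnorm X) ^ 2 * (∑ j, ‖v j‖ ^ 2) * c r ^ 2 := by
        gcongr
        refine intervalIntegral.integral_mono_on hst ?_ ?_ fun r hr => ?_
        · have h := IntervalIntegrable.sum Finset.univ fun i _ => hzi i
          rwa [Finset.sum_fn] at h
        · exact ((hc.pow 2).intervalIntegrable _ _).const_mul _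
        · have hr' : r ∈ Icc 0 T := ⟨hs.trans hr.1, hr.2.trans htT⟩
          have h := (hL' r _ _ (hc0 r) (hb r hr')).sum_le hn X v
          calc _ ≤ _ := h
            _ = _ := by ring
    _ = _ := by
        rw [intervalIntegral.integral_const_mul]
        linear_combination -(C * L * mnorm X) ^ 2 * (∑ j, ‖v j‖ ^ 2) * Real.sq_sqrt hI

end Columns

/-! ### Integration of families of columns -/

section ColumnSpace

variable {𝔨 : Type*} [NormedAddCommGroup 𝔨] [InnerProductSpace ℂ 𝔨] [CompleteSpace 𝔨]
  {𝔥 : Type*} [NormedAddCommGroup 𝔥] [InnerProductSpace ℂ 𝔥]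
  {𝔥' : Type*} [NormedAddCommGroup 𝔥'] [InnerProductSpace ℂ 𝔥'] [CompleteSpace 𝔥']

theorem continuous_bra_comp {K : Type*} [NormedAddCommGroup K] [InnerProductSpace ℂ K]
    (T : 𝔥 →L[ℂ] HT 𝔥' K) : Continuous fun χ : K => bra χ ∘L T := by
  refine (LipschitzWith.of_dist_le_mul (K := ‖T‖₊) fun χ χ' => ?_).continuous
  rw [dist_eq_norm, dist_eq_norm, ← ContinuousLinearMap.sub_comp, ← bra_sub, mul_comm]
  exact (ContinuousLinearMap.opNorm_comp_le _ _).trans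
    (mul_le_mul_of_nonneg_right (norm_bra_le _) (norm_nonneg _))

/-- Y is a closed subspace and χ ↦ E^χ T is norm continuous and conjugate linear, so exponential
vectors suffice. -/
theorem mem_colSpace_of_expStep {Y : Submodule ℂ (𝔥 →L[ℂ] 𝔥')}
    (hY : IsClosed (Y : Set (𝔥 →L[ℂ] 𝔥'))) {T : 𝔥 →L[ℂ] HT 𝔥' (Fock 𝔨)}
    (h : ∀ g' : step (⊤ : Submodule ℂ 𝔨), bra (expStep g') ∘L T ∈ Y) :
    T ∈ colSpace Y (Fock 𝔨) := by
  have hc : IsClosed {χ : Fock 𝔨 | bra χ ∘L T ∈ Y} := hY.preimage (continuous_bra_comp T)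
  have hd : Dense (exps (⊤ : Submodule ℂ 𝔨) : Set (Fock 𝔨)) := exps_dense dense_univ
  intro χ
  refine hd.induction (P := fun χ => bra χ ∘L T ∈ Y) (fun χ hχ => ?_) hc χ
  induction hχ using Submodule.span_induction with
  | mem χ hχ => obtain ⟨g', rfl⟩ := hχ; exact h g'
  | zero => rw [bra_zero, ContinuousLinearMap.zero_comp]; exact Y.zero_mem
  | add χ χ' _ _ h h' => rw [bra_add, ContinuousLinearMap.add_comp]; exact Y.add_mem h h'
  | smul c χ _ h => rw [bra_smul, ContinuousLinearMap.smul_comp]; exact Y.smul_mem _ h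

theorem isClosed_colSpace {Y : Submodule ℂ (𝔥 →L[ℂ] 𝔥')}
    (hY : IsClosed (Y : Set (𝔥 →L[ℂ] 𝔥'))) :
    IsClosed (colSpace Y (Fock 𝔨) : Set (𝔥 →L[ℂ] HT 𝔥' (Fock 𝔨))) := by
  have e : (colSpace Y (Fock 𝔨) : Set (𝔥 →L[ℂ] HT 𝔥' (Fock 𝔨)))
      = ⋂ χ : Fock 𝔨, {T | bra χ ∘L T ∈ Y} := by
    ext T
    simp only [mem_iInter]
    rfl
  rw [e]
  refine isClosed_iInter fun χ => hY.preimage ?_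
  exact ((ContinuousLinearMap.compL ℂ 𝔥 (HT 𝔥' (Fock 𝔨)) 𝔥') (bra χ)).continuous

/-- The average of a function over a set of positive finite measure stays in any closed convex set
that contains its values. -/
theorem intervalIntegral_mem {E : Type*} [NormedAddCommGroup E] [NormedSpace ℂ E] [CompleteSpace E]
    {Y : Submodule ℂ E} (hY : IsClosed (Y : Set E)) {f : ℝ → E} {a b : ℝ} (hab : a ≤ b)
    (hf : IntervalIntegrable f volume a b) (h : ∀ s ∈ Ioc a b, f s ∈ Y) :
    ∫ s in a..b, f s ∈ Y := by
  rcases hab.eq_or_lt with rfl | hlt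
  · simp
  rw [intervalIntegral.integral_of_le hab, ← measure_smul_setAverage _ measure_Ioc_lt_top.ne]
  have hm : ⨍ s in Ioc a b, f s ∈ (Y.restrictScalars ℝ : Set E) := by
    refine (Y.restrictScalars ℝ).convex.set_average_mem hY ?_ measure_Ioc_lt_top.ne ?_ ?_
    · rw [Real.volume_Ioc]
      simpa using hlt
    · exact (ae_restrict_mem measurableSet_Ioc).mono fun s hs => h s hs
    · exact (intervalIntegrable_iff_integrableOn_Ioc_of_le hab).1 hf
  exact (Y.restrictScalars ℝ).smul_mem _ hm

end ColumnSpace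

/-! ### The integral of a regular adapted family -/

section Integration

variable {𝔨 : Type*} [NormedAddCommGroup 𝔨] [InnerProductSpace ℂ 𝔨] [CompleteSpace 𝔨]
  {𝔥 : Type*} [NormedAddCommGroup 𝔥] [InnerProductSpace ℂ 𝔥]
  {𝔥' : Type*} [NormedAddCommGroup 𝔥'] [InnerProductSpace ℂ 𝔥'] [CompleteSpace 𝔥']
  {V : Type*} [NormedAddCommGroup V] [NormedSpace ℂ V] [OperatorSpace V]
  {D : Submodule ℂ 𝔨} {S : Set ℕ}
  {φ : dhat D →ₗ[ℂ] V →ₗ[ℂ] CBMap (StrongDual ℂ (Khat 𝔨)) V}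
  {A B : step D → ℝ → V →ₗ[ℂ] (𝔥 →L[ℂ] HT 𝔥' (Fock 𝔨))}

theorem coeff_add (ζ' : Khat 𝔨) (ζ : dhat D) (x y : V) :
    coeff φ ζ' ζ (x + y) = coeff φ ζ' ζ x + coeff φ ζ' ζ y := by
  simp [coeff]

theorem coeff_smul (ζ' : Khat 𝔨) (ζ : dhat D) (c : ℂ) (x : V) :
    coeff φ ζ' ζ (c • x) = c • coeff φ ζ' ζ x := by
  simp [coeff]

/-- The vector y(x,u) exists for each x and u. Linearity in both is read off its pairings with
exponential vectors, and boundedness from the L² estimate. -/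
theorem exists_column_integral (h1 : 1 ∈ S) (hφ : ∀ ζ, Liftable S (φ ζ) 𝔥 (HT 𝔥' (Fock 𝔨)))
    (had : FamAdapted A) (g : step D) (hA : Regular S (A g)) {t : ℝ} (ht : 0 ≤ t) :
    ∃ B : V →ₗ[ℂ] (𝔥 →L[ℂ] HT 𝔥' (Fock 𝔨)),
      ∀ (x : V) (u : 𝔥) (u' : 𝔥') (g' : step (⊤ : Submodule ℂ 𝔨)),
        ⟪tm u' (expStep g'), B x u⟫_ℂ = ∫ s in (0 : ℝ)..t,
          ⟪tm u' (expStep g'), A g s (coeff φ (hat ((g' : ℝ → 𝔨) s)) (hatStep g s) x) u⟫_ℂ := by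
  obtain ⟨C, hC, hInt⟩ := exists_adapted_integral (𝔥' := 𝔥') g t
  obtain ⟨L, hL, hL'⟩ := exists_hatLift_bound (𝔥' := 𝔥') hφ g
  obtain ⟨b, hb, hb'⟩ := hA.bound t
  choose y hy hyn using fun (x : V) (u : 𝔥) => hInt 0 t le_rfl ht le_rfl
    (fun s => hatLift (A g s) (φ (hatStep g s)) x u) (memLp_hatLift h1 hφ hA g x u le_rfl)
    fun s hs => adaptedAt_hatLift hφ had g hA x u hs.1
  have hy' : ∀ (x : V) (u : 𝔥) (u' : 𝔥') (g' : step (⊤ : Submodule ℂ 𝔨)),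
      ⟪tm u' (expStep g'), y x u⟫_ℂ = ∫ s in (0 : ℝ)..t,
        ⟪tm u' (expStep g'), A g s (coeff φ (hat ((g' : ℝ → 𝔨) s)) (hatStep g s) x) u⟫_ℂ := by
    intro x u u' g'
    rw [hy]
    refine intervalIntegral.integral_congr fun s hs => ?_
    rw [uIcc_of_le ht] at hs
    exact inner_sum_hatLift hφ hA g x u hs.1 _ _
  have hi := fun (x : V) (u : 𝔥) (u' : 𝔥') (g' : step (⊤ : Submodule ℂ 𝔨)) =>
    intervalIntegrable_weak h1 hφ hA g x u (tm u' (expStep g')) g' le_rfl ht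
  have hn : ∀ x u, ‖y x u‖ ≤ (C * Real.sqrt t * L * b) * ‖x‖ * ‖u‖ := by
    intro x u
    refine le_of_sq_le_sq ((hyn x u).trans ?_) (by positivity)
    have hle : ∫ s in (0 : ℝ)..t, ‖hatLift (A g s) (φ (hatStep g s)) x u‖ ^ 2
        ≤ ∫ s in (0 : ℝ)..t, (L * b * ‖x‖ * ‖u‖) ^ 2 := by
      refine intervalIntegral.integral_mono_on ht
        (memLp_norm_sq_intervalIntegrable ht (memLp_hatLift h1 hφ hA g x u le_rfl))
        (by simp) fun s hs => ?_
      exact pow_le_pow_left₀ (norm_nonneg _) ((hL' s _ _ hb (hb' s hs)).norm_apply_le h1 x u) 2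
    rw [intervalIntegral.integral_const, smul_eq_mul, sub_zero] at hle
    refine (mul_le_mul_of_nonneg_left hle (sq_nonneg C)).trans (le_of_eq ?_)
    linear_combination -(C * L * b * ‖x‖ * ‖u‖) ^ 2 * Real.sq_sqrt ht
  have ext : ∀ {w w' : HT 𝔥' (Fock 𝔨)}, (∀ (u' : 𝔥') (g' : step (⊤ : Submodule ℂ 𝔨)),
      ⟪tm u' (expStep g'), w⟫_ℂ = ⟪tm u' (expStep g'), w'⟫_ℂ) → w = w' := fun h =>
    ext_expStep (E := ⊤) (D := ⊤) dense_univ dense_univ fun u _ g' => h u g'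
  let f : V → 𝔥 →L[ℂ] HT 𝔥' (Fock 𝔨) := fun x => LinearMap.mkContinuous
    { toFun := y x
      map_add' := fun u v => ext fun u' g' => by
        rw [inner_add_right, hy', hy', hy', ← intervalIntegral.integral_add (hi _ _ _ _)
          (hi _ _ _ _)]
        simp only [map_add, inner_add_right]
      map_smul' := fun c u => ext fun u' g' => by
        rw [RingHom.id_apply, inner_smul_right, hy', hy', ← intervalIntegral.integral_const_mul]
        simp only [map_smul, inner_smul_right] }
    (C * Real.sqrt t * L * b * ‖x‖) (hn x)
  have hf : ∀ x u, f x u = y x u := fun _ _ => rfl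
  refine ⟨{ toFun := f, map_add' := fun x x' => ?_, map_smul' := fun c x => ?_ },
    fun x u u' g' => hy' x u u' g'⟩
  · refine ContinuousLinearMap.ext fun u => ext fun u' g' => ?_
    rw [add_apply, hf, hf, hf, inner_add_right, hy', hy', hy',
      ← intervalIntegral.integral_add (hi _ _ _ _) (hi _ _ _ _)]
    simp only [coeff_add, map_add, add_apply, inner_add_right]
  · refine ContinuousLinearMap.ext fun u => ext fun u' g' => ?_
    rw [RingHom.id_apply, smul_apply, hf, hf, inner_smul_right, hy', hy',
      ← intervalIntegral.integral_const_mul]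
    simp only [coeff_smul, map_smul, smul_apply, inner_smul_right]

theorem cut_apply_of_mem (g : step D) {s t : ℝ} (hs : s ∈ Ico 0 t) :
    (cut g t : ℝ → 𝔨) s = (g : ℝ → 𝔨) s := by
  rw [cut_apply, indicator_of_mem hs]

theorem cum_cut_cut (f : step D) {D' : Submodule ℂ 𝔨} (g : step D') {s t : ℝ} (hs : 0 ≤ s)
    (hst : s ≤ t) :
    cum (cut f t : ℝ → 𝔨) (cut g t : ℝ → 𝔨) s = cum (f : ℝ → 𝔨) (g : ℝ → 𝔨) s := by
  rw [cum_cut_left f (cut g t) hs hst, ← cum_conj, cum_cut_left g f hs hst, cum_conj]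

/-- For s < t, truncating g and g' at t changes neither ĝ(s) nor ĝ'(s). The factor for [s,∞[ splits
into those for [s,t[ and [t,∞[, and the latter leaves the integral. -/
theorem WeakEq.famAdapted (hw : WeakEq φ A B) (hA : FamAdapted A) : FamAdapted B := by
  intro g t ht x u u' g'
  -- The integral is taken over [0,t[, because at s = t the truncated step functions already vanish.
  rw [hw g t ht, hw (cut g t) t ht, ← intervalIntegral.integral_mul_const,
    intervalIntegral.integral_of_le ht, intervalIntegral.integral_of_le ht,
    ← integral_Ico_eq_integral_Ioc, ← integral_Ico_eq_integral_Ioc]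
  refine setIntegral_congr_fun measurableSet_Ico fun s hs => ?_
  have e1 : hatStep (cut g t) s = hatStep g s :=
    Subtype.ext (by simp only [hatStep, cut_apply_of_mem g hs])
  simp only [e1, cut_apply_of_mem g' hs]
  rw [hA g s hs.1 _ u u' g', hA (cut g t) s hs.1 _ u u' (cut g' t), cut_cut g hs.2.le,
    cut_cut g' hs.2.le, ip_cut_cut g' g ht, cum_cut_cut g' g hs.1 hs.2.le, mul_assoc,
    ← Complex.exp_add]
  congr 2
  ring

theorem WeakEq.apply_zero (hw : WeakEq φ A B) (g : step D) : B g 0 = 0 := by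
  refine LinearMap.ext fun x => ContinuousLinearMap.ext fun u => ?_
  refine ext_expStep (E := ⊤) (D := ⊤) dense_univ dense_univ fun u' _ g' => ?_
  rw [hw g 0 le_rfl]
  simp

theorem hasLevelBound_symm {C : ℝ} {F : ℝ → V →ₗ[ℂ] (𝔥 →L[ℂ] HT 𝔥' (Fock 𝔨))} {T : ℝ}
    (h : ∀ s t : ℝ, 0 ≤ s → s ≤ t → t ≤ T →
      HasLevelBound S (F t - F s) (C * |t - s| ^ (1 / 2 : ℝ))) :
    ∀ s ∈ Icc 0 T, ∀ t ∈ Icc 0 T, HasLevelBound S (F t - F s) (C * |t - s| ^ (1 / 2 : ℝ)) := by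
  intro s hs t ht
  rcases le_total s t with hst | hst
  · exact h s t hs.1 hst ht.2
  · have := (h t s ht.1 hst hs.2).neg
    rwa [neg_sub, abs_sub_comm] at this

theorem sqrt_integral_const {c s t : ℝ} (hc : 0 ≤ c) (hst : s ≤ t) :
    Real.sqrt (∫ _r in s..t, c ^ 2) = c * |t - s| ^ (1 / 2 : ℝ) := by
  rw [intervalIntegral.integral_const, smul_eq_mul, mul_comm, Real.sqrt_mul (sq_nonneg c),
    Real.sqrt_sq hc, Real.sqrt_eq_rpow, abs_of_nonneg (sub_nonneg.2 hst)]

/-- A constant bound b for A gives R b |t - s|^{1/2} for increments of B. As B starts at 0, this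
also bounds B itself, so integration can be repeated. -/
theorem WeakEq.regular (h1 : 1 ∈ S) (hφ : ∀ ζ, Liftable S (φ ζ) 𝔥 (HT 𝔥' (Fock 𝔨)))
    (hw : WeakEq φ A B) (had : FamAdapted A) (g : step D) (hA : Regular S (A g)) :
    Regular S (B g) := by
  have key : ∀ T : ℝ, ∃ C : ℝ, 0 ≤ C ∧ ∀ s t : ℝ, 0 ≤ s → s ≤ t → t ≤ T →
      HasLevelBound S (B g t - B g s) (C * |t - s| ^ (1 / 2 : ℝ)) := by
    intro T
    obtain ⟨b, hb, hb'⟩ := hA.bound T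
    obtain ⟨R, hR, h⟩ := exists_integral_estimate (𝔥' := 𝔥') h1 hφ g T
    refine ⟨R * b, by positivity, fun s t hs hst htT => ?_⟩
    have := h A B had hA hw (fun _ => b) continuous_const (fun _ => hb) hb' s t hs hst htT
    rwa [sqrt_integral_const hb hst, ← mul_assoc] at this
  refine ⟨fun T => ?_, fun T => ?_⟩
  · obtain ⟨C, hC, h⟩ := key T
    refine ⟨C * |T| ^ (1 / 2 : ℝ), by positivity, fun t ht => ?_⟩
    have := h 0 t le_rfl ht.1 ht.2
    rw [hw.apply_zero g, sub_zero, sub_zero] at this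
    refine this.mono (mul_le_mul_of_nonneg_left ?_ hC)
    refine Real.rpow_le_rpow (abs_nonneg _) ?_ (by norm_num)
    rw [abs_of_nonneg ht.1, abs_of_nonneg (ht.1.trans ht.2)]
    exact ht.2
  · obtain ⟨C, hC, h⟩ := key T
    exact ⟨C, hC, hasLevelBound_symm h⟩

/-- Each slice of B is a norm convergent integral of slices of A, because A is norm continuous in
time and the coefficient of φ takes finitely many values. A closed subspace is stable under such
integrals. -/
theorem WeakEq.mem_colSpace {Y : Submodule ℂ (𝔥 →L[ℂ] 𝔥')} (hY : IsClosed (Y : Set (𝔥 →L[ℂ] 𝔥')))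
    (h1 : 1 ∈ S) (hw : WeakEq φ A B) (g : step D) (hA : Regular S (A g))
    (hAY : ∀ s, 0 ≤ s → ∀ x, A g s x ∈ colSpace Y (Fock 𝔨)) {t : ℝ} (ht : 0 ≤ t) (x : V) :
    B g t x ∈ colSpace Y (Fock 𝔨) := by
  refine mem_colSpace_of_expStep hY fun g' => ?_
  obtain ⟨q, hq⟩ := exists_simpleFunc_hatStep_pair g' g
  let f : Khat 𝔨 × dhat D → ℝ → 𝔥 →L[ℂ] 𝔥' := fun ζ s =>
    bra (expStep g') ∘L A g s (coeff φ ζ.1 ζ.2 x)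
  have hc : ∀ ζ, ContinuousOn (f ζ) (Ici 0) := fun ζ =>
    ((ContinuousLinearMap.compL ℂ 𝔥 (HT 𝔥' (Fock 𝔨)) 𝔥')
      (bra (expStep g'))).continuous.comp_continuousOn (hA.continuousOn h1 _)
  have hInt : IntervalIntegrable (fun s => f (q s) s) volume 0 t :=
    intervalIntegrable_simpleFunc_comp q ht fun ζ => (hc ζ).mono fun s hs => hs.1
  have e : bra (expStep g') ∘L B g t x = ∫ s in (0 : ℝ)..t, f (q s) s := by
    refine ContinuousLinearMap.ext fun u => ext_inner_left ℂ fun u' => ?_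
    have e1 := ((innerSL ℂ u') ∘L
      (ContinuousLinearMap.apply ℂ 𝔥' u)).intervalIntegral_comp_comm hInt
    rw [ContinuousLinearMap.comp_apply, inner_bra, hw g t ht]
    refine Eq.trans ?_ e1
    refine intervalIntegral.integral_congr fun s _ => ?_
    simp only [f, hq]
    exact (inner_bra _ _ _).symm
  rw [e]
  exact intervalIntegral_mem hY ht hInt fun s hs => hAY s hs.1.le _ _

theorem exists_weakEq (h1 : 1 ∈ S) (hφ : ∀ ζ, Liftable S (φ ζ) 𝔥 (HT 𝔥' (Fock 𝔨)))
    (had : FamAdapted A) (hA : ∀ g, Regular S (A g)) :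
    ∃ B : step D → ℝ → V →ₗ[ℂ] (𝔥 →L[ℂ] HT 𝔥' (Fock 𝔨)), WeakEq φ A B := by
  have h : ∀ (g : step D) (t : ℝ), ∃ B : V →ₗ[ℂ] (𝔥 →L[ℂ] HT 𝔥' (Fock 𝔨)), 0 ≤ t →
      ∀ (x : V) (u : 𝔥) (u' : 𝔥') (g' : step (⊤ : Submodule ℂ 𝔨)),
        ⟪tm u' (expStep g'), B x u⟫_ℂ = ∫ s in (0 : ℝ)..t,
          ⟪tm u' (expStep g'), A g s (coeff φ (hat ((g' : ℝ → 𝔨) s)) (hatStep g s) x) u⟫_ℂ := by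
    intro g t
    by_cases ht : 0 ≤ t
    · obtain ⟨B, hB⟩ := exists_column_integral h1 hφ had g (hA g) ht
      exact ⟨B, fun _ => hB⟩
    · exact ⟨0, fun h => absurd h ht⟩
  choose B hB using h
  exact ⟨B, hB⟩

end Integration

/-! ### Iterated integrals of columns and their sum -/

/-- Extracting 2^{-n} leaves the square root of (4R²T)^n/n!, which is at most exp(4R²T). -/
theorem summable_pow_mul_sqrt {R T : ℝ} (hR : 0 ≤ R) (hT : 0 ≤ T) :
    Summable fun n : ℕ => R ^ n * Real.sqrt (T ^ n / n.factorial) := by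
  have hg : Summable fun n : ℕ => Real.sqrt (Real.exp (4 * (R ^ 2 * T))) * (1 / 2 : ℝ) ^ n :=
    (summable_geometric_of_lt_one (by norm_num) (by norm_num)).mul_left _
  refine Summable.of_nonneg_of_le (fun n => by positivity) (fun n => ?_) hg
  have h := Real.pow_div_factorial_le_exp (x := 4 * (R ^ 2 * T)) (by positivity) n
  have e : R ^ n * Real.sqrt (T ^ n / n.factorial)
      = Real.sqrt ((4 * (R ^ 2 * T)) ^ n / n.factorial) * (1 / 2 : ℝ) ^ n := by
    have h4 : Real.sqrt ((4 * (R ^ 2 * T)) ^ n / n.factorial)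
        = (2 * R) ^ n * Real.sqrt (T ^ n / n.factorial) := by
      rw [show (4 * (R ^ 2 * T)) ^ n / n.factorial
          = ((2 * R) ^ n) ^ 2 * (T ^ n / n.factorial) by
            rw [← pow_mul, mul_comm n 2, pow_mul, ← mul_div_assoc, ← mul_pow]; ring,
        Real.sqrt_mul (sq_nonneg _), Real.sqrt_sq (by positivity)]
    have h2 : (2 * R) ^ n * (1 / 2 : ℝ) ^ n = R ^ n := by
      rw [← mul_pow]
      congr 1
      ring
    rw [h4, mul_right_comm, h2]
  rw [e]
  exact mul_le_mul_of_nonneg_right (Real.sqrt_le_sqrt h) (by positivity)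

theorem sqrt_integral_pow {b t : ℝ} (hb : 0 ≤ b) (ht : 0 ≤ t) (n : ℕ) :
    Real.sqrt (∫ r in (0 : ℝ)..t, (b * Real.sqrt (|r| ^ n / n.factorial)) ^ 2)
      = b * Real.sqrt (t ^ (n + 1) / (n + 1).factorial) := by
  have e : ∫ r in (0 : ℝ)..t, (b * Real.sqrt (|r| ^ n / n.factorial)) ^ 2
      = b ^ 2 * (t ^ (n + 1) / (n + 1).factorial) := by
    have e1 : ∫ r in (0 : ℝ)..t, (b * Real.sqrt (|r| ^ n / n.factorial)) ^ 2
        = ∫ r in (0 : ℝ)..t, b ^ 2 / n.factorial * r ^ n := by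
      refine intervalIntegral.integral_congr fun r hr => ?_
      rw [uIcc_of_le ht] at hr
      rw [mul_pow, Real.sq_sqrt (by positivity), abs_of_nonneg hr.1]
      ring
    rw [e1, intervalIntegral.integral_const_mul, integral_pow, Nat.factorial_succ]
    have : (n.factorial : ℝ) ≠ 0 := by positivity
    have : (n : ℝ) + 1 ≠ 0 := by positivity
    push_cast
    field_simp
    simp
  rw [e, Real.sqrt_mul (sq_nonneg b), Real.sqrt_sq hb]

section Iteration

variable {𝔨 : Type*} [NormedAddCommGroup 𝔨] [InnerProductSpace ℂ 𝔨] [CompleteSpace 𝔨]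
  {𝔥 : Type*} [NormedAddCommGroup 𝔥] [InnerProductSpace ℂ 𝔥]
  {𝔥' : Type*} [NormedAddCommGroup 𝔥'] [InnerProductSpace ℂ 𝔥'] [CompleteSpace 𝔥']
  {V : Type*} [NormedAddCommGroup V] [NormedSpace ℂ V] [OperatorSpace V]
  {D : Submodule ℂ 𝔨} {S : Set ℕ}
  {φ : dhat D →ₗ[ℂ] V →ₗ[ℂ] CBMap (StrongDual ℂ (Khat 𝔨)) V}

theorem exists_iterates (h1 : 1 ∈ S) (hφ : ∀ ζ, Liftable S (φ ζ) 𝔥 (HT 𝔥' (Fock 𝔨)))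
    {A₀ : step D → ℝ → V →ₗ[ℂ] (𝔥 →L[ℂ] HT 𝔥' (Fock 𝔨))} (had : FamAdapted A₀)
    (hreg : ∀ g, Regular S (A₀ g)) :
    ∃ A : ℕ → step D → ℝ → V →ₗ[ℂ] (𝔥 →L[ℂ] HT 𝔥' (Fock 𝔨)), A 0 = A₀ ∧
      (∀ n, FamAdapted (A n)) ∧ ∀ n, WeakEq φ (A n) (A (n + 1)) := by
  let Q := {A : step D → ℝ → V →ₗ[ℂ] (𝔥 →L[ℂ] HT 𝔥' (Fock 𝔨)) //
    FamAdapted A ∧ ∀ g, Regular S (A g)}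
  have hnext : ∀ A : Q, ∃ B : Q, WeakEq φ A.1 B.1 := by
    intro A
    obtain ⟨B, hB⟩ := exists_weakEq h1 hφ A.2.1 A.2.2
    exact ⟨⟨B, hB.famAdapted A.2.1, fun g => hB.regular h1 hφ A.2.1 g (A.2.2 g)⟩, hB⟩
  choose next hn using hnext
  let q : ℕ → Q := fun n => Nat.rec ⟨A₀, had, hreg⟩ (fun _ A => next A) n
  exact ⟨fun n => (q n).1, rfl, fun n => (q n).2.1, fun n => hn (q n)⟩

variable {A : ℕ → step D → ℝ → V →ₗ[ℂ] (𝔥 →L[ℂ] HT 𝔥' (Fock 𝔨))}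

theorem regular_iterate (h1 : 1 ∈ S) (hφ : ∀ ζ, Liftable S (φ ζ) 𝔥 (HT 𝔥' (Fock 𝔨)))
    (had : ∀ n, FamAdapted (A n)) (hw : ∀ n, WeakEq φ (A n) (A (n + 1))) (g : step D)
    (h0 : Regular S (A 0 g)) : ∀ n, Regular S (A n g)
  | 0 => h0
  | n + 1 => (hw n).regular h1 hφ (had n) g (regular_iterate h1 hφ had hw g h0 n)

theorem regular_of_const {F : V →ₗ[ℂ] (𝔥 →L[ℂ] HT 𝔥' (Fock 𝔨))} {b : ℝ} (hb : 0 ≤ b)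
    (h : HasLevelBound S F b) : Regular S fun _ => F := by
  refine ⟨fun _ => ⟨b, hb, fun _ _ => h⟩, fun _ => ⟨0, le_rfl, fun s _ t _ => ?_⟩⟩
  simpa using hasLevelBound_zero

/-- Induction with bounds b R^n (t^n/n!)^{1/2}: squaring, integrating over [0,t] and taking the root
turns t^n/n! into t^{n+1}/(n+1)!. One sequence β serves for sizes and Hölder constants alike. -/
theorem exists_summable_bound (h1 : 1 ∈ S) (hφ : ∀ ζ, Liftable S (φ ζ) 𝔥 (HT 𝔥' (Fock 𝔨)))
    (had : ∀ n, FamAdapted (A n)) (hw : ∀ n, WeakEq φ (A n) (A (n + 1))) (g : step D)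
    {F : V →ₗ[ℂ] (𝔥 →L[ℂ] HT 𝔥' (Fock 𝔨))} (hF : ∀ t, A 0 g t = F) {b : ℝ} (hb : 0 ≤ b)
    (hFb : HasLevelBound S F b) (T : ℝ) :
    ∃ β : ℕ → ℝ, Summable β ∧ (∀ n, 0 ≤ β n) ∧
      (∀ n, ∀ t ∈ Icc 0 T, HasLevelBound S (A n g t) (β n)) ∧
      ∀ n, ∀ s ∈ Icc 0 T, ∀ t ∈ Icc 0 T,
        HasLevelBound S (A n g t - A n g s) (β n * |t - s| ^ (1 / 2 : ℝ)) := by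
  have hreg : ∀ n, Regular S (A n g) := by
    refine regular_iterate h1 hφ had hw g ?_
    rw [show A 0 g = fun _ => F from funext hF]
    exact regular_of_const hb hFb
  -- T may be negative. The interval [0,|T|] always contains [0,T], and powers of |T| are
  -- nonnegative.
  obtain ⟨R, hR, hest⟩ := exists_integral_estimate (𝔥' := 𝔥') h1 hφ g |T|
  have hT : T ≤ |T| := le_abs_self T
  have hbd : ∀ n, ∀ t ∈ Icc 0 |T|,
      HasLevelBound S (A n g t) (b * R ^ n * Real.sqrt (|t| ^ n / n.factorial)) := by
    intro n
    induction n with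
    | zero =>
      intro t _
      simpa [hF] using hFb
    | succ n ih =>
      intro t ht
      have h := hest (A n) (A (n + 1)) (had n) (hreg n) (hw n)
        (fun r => b * R ^ n * Real.sqrt (|r| ^ n / n.factorial))
        (continuous_const.mul (((continuous_abs.pow n).div_const _).sqrt))
        (fun r => by positivity) ih 0 t le_rfl ht.1 ht.2
      rw [(hw n).apply_zero g, sub_zero, sqrt_integral_pow (by positivity) ht.1] at h
      rw [abs_of_nonneg ht.1]
      exact h.mono (le_of_eq (by ring))
  have hle : ∀ n, ∀ t ∈ Icc 0 |T|, HasLevelBound S (A n g t)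
      (b * R ^ n * Real.sqrt (|T| ^ n / n.factorial)) := by
    intro n t ht
    refine (hbd n t ht).mono (mul_le_mul_of_nonneg_left (Real.sqrt_le_sqrt ?_) (by positivity))
    rw [abs_of_nonneg ht.1]
    gcongr
    · exact ht.1
    · exact ht.2
  let γ : ℕ → ℝ := fun n => b * (R ^ n * Real.sqrt (|T| ^ n / n.factorial))
  have hγ : Summable γ := (summable_pow_mul_sqrt hR (abs_nonneg T)).mul_left b
  have hγ0 : ∀ n, 0 ≤ γ n := fun n => by positivity
  -- Hölder constants: 0 for the constant initial family, and R times the size of the previous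
  -- iterate afterwards.
  let δ : ℕ → ℝ := fun n => Nat.casesOn n 0 fun m => R * γ m
  have hδ : Summable δ := (summable_nat_add_iff 1).1 (hγ.mul_left R)
  have hδ0 : ∀ n, 0 ≤ δ n := fun n => by
    cases n with
    | zero => exact le_rfl
    | succ m => exact mul_nonneg hR (hγ0 m)
  refine ⟨fun n => γ n + δ n, hγ.add hδ, fun n => add_nonneg (hγ0 n) (hδ0 n), fun n t ht => ?_,
    fun n s hs t ht => ?_⟩
  · refine (hle n t ⟨ht.1, ht.2.trans hT⟩).mono ?_
    have := hδ0 n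
    have e : γ n = b * R ^ n * Real.sqrt (|T| ^ n / n.factorial) := (mul_assoc _ _ _).symm
    linarith
  · have h : HasLevelBound S (A n g t - A n g s) (δ n * |t - s| ^ (1 / 2 : ℝ)) := by
      cases n with
      | zero =>
        rw [hF, hF, sub_self]
        exact hasLevelBound_zero.mono (mul_nonneg (hδ0 0) (by positivity))
      | succ m =>
        refine hasLevelBound_symm (T := |T|) (fun s t hs hst ht => ?_) s ⟨hs.1, hs.2.trans hT⟩ t
          ⟨ht.1, ht.2.trans hT⟩
        have h := hest (A m) (A (m + 1)) (had m) (hreg m) (hw m) (fun _ => γ m) continuous_const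
          (fun _ => hγ0 m) (fun r hr => (hle m r hr).mono (le_of_eq (mul_assoc _ _ _)))
          s t hs hst ht
        rwa [sqrt_integral_const (hγ0 m) hst, ← mul_assoc] at h
    refine h.mono (mul_le_mul_of_nonneg_right ?_ (by positivity))
    linarith [hγ0 n]

theorem exists_sum (h1 : 1 ∈ S) (hb : ∀ (g : step D) (T : ℝ), ∃ β : ℕ → ℝ, Summable β ∧
      (∀ n, 0 ≤ β n) ∧ ∀ n, ∀ t ∈ Icc 0 T, HasLevelBound S (A n g t) (β n)) :
    ∃ B : step D → ℝ → V →ₗ[ℂ] (𝔥 →L[ℂ] HT 𝔥' (Fock 𝔨)),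
      ∀ g t, 0 ≤ t → ∀ x, HasSum (fun n => A n g t x) (B g t x) := by
  have h : ∀ (g : step D) (t : ℝ), ∃ B : V →ₗ[ℂ] (𝔥 →L[ℂ] HT 𝔥' (Fock 𝔨)), 0 ≤ t →
      ∀ x, HasSum (fun n => A n g t x) (B x) := by
    intro g t
    by_cases ht : 0 ≤ t
    · obtain ⟨β, hβ, hβ0, h⟩ := hb g t
      have hs : ∀ x, Summable fun n => A n g t x := fun x =>
        Summable.of_norm_bounded (hβ.mul_right ‖x‖) fun n =>
          (h n t ⟨ht, le_rfl⟩).norm_le h1 (hβ0 n) x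
      refine ⟨{ toFun := fun x => ∑' n, A n g t x, map_add' := fun x y => ?_,
                map_smul' := fun c x => ?_ }, fun _ x => (hs x).hasSum⟩
      · simp only [map_add]
        exact (hs x).tsum_add (hs y)
      · simp only [map_smul]
        exact (hs x).tsum_const_smul c
    · exact ⟨0, fun h => absurd h ht⟩
  choose B hB using h
  exact ⟨B, hB⟩

variable {B : step D → ℝ → V →ₗ[ℂ] (𝔥 →L[ℂ] HT 𝔥' (Fock 𝔨))}

theorem hasSum_column_apply
    (hB : ∀ g t, 0 ≤ t → ∀ x, HasSum (fun n => A n g t x) (B g t x)) (g : step D) {t : ℝ}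
    (ht : 0 ≤ t) (x : V) (u : 𝔥) : HasSum (fun n => A n g t x u) (B g t x u) :=
  (hB g t ht x).mapL (ContinuousLinearMap.apply ℂ (HT 𝔥' (Fock 𝔨)) u)

theorem regular_sum {β : ℝ → ℕ → ℝ} (hβ : ∀ T, Summable (β T)) (hβ0 : ∀ T n, 0 ≤ β T n)
    (g : step D) (hb : ∀ T n, ∀ t ∈ Icc 0 T, HasLevelBound S (A n g t) (β T n))
    (hh : ∀ T n, ∀ s ∈ Icc 0 T, ∀ t ∈ Icc 0 T,
      HasLevelBound S (A n g t - A n g s) (β T n * |t - s| ^ (1 / 2 : ℝ)))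
    (hB : ∀ g t, 0 ≤ t → ∀ x, HasSum (fun n => A n g t x) (B g t x)) : Regular S (B g) := by
  refine ⟨fun T => ⟨∑' n, β T n, tsum_nonneg (hβ0 T), fun t ht => ?_⟩,
    fun T => ⟨∑' n, β T n, tsum_nonneg (hβ0 T), fun s hs t ht => ?_⟩⟩
  · refine hasLevelBound_of_tendsto (A := fun s : Finset ℕ => ∑ n ∈ s, A n g t) (l := Filter.atTop)
      (tsum_nonneg (hβ0 T)) (fun s => ?_) fun x v => ?_
    · exact (HasLevelBound.sum s fun n _ => hb T n t ht).mono
        ((hβ T).sum_le_tsum s fun n _ => hβ0 T n)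
    · have := hasSum_column_apply hB g ht.1 x v
      simpa [HasSum] using this
  · refine hasLevelBound_of_tendsto (A := fun F : Finset ℕ => ∑ n ∈ F, (A n g t - A n g s))
      (l := Filter.atTop) (mul_nonneg (tsum_nonneg (hβ0 T)) (by positivity)) (fun F => ?_)
      fun x v => ?_
    · refine (HasLevelBound.sum F fun n _ => hh T n s hs t ht).mono ?_
      rw [← Finset.sum_mul]
      exact mul_le_mul_of_nonneg_right ((hβ T).sum_le_tsum F fun n _ => hβ0 T n) (by positivity)
    · have := (hasSum_column_apply hB g ht.1 x v).sub (hasSum_column_apply hB g hs.1 x v)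
      simpa [HasSum] using this

theorem famAdapted_sum (had : ∀ n, FamAdapted (A n))
    (hB : ∀ g t, 0 ≤ t → ∀ x, HasSum (fun n => A n g t x) (B g t x)) : FamAdapted B := by
  intro g t ht x u u' g'
  have e1 := (hasSum_column_apply hB g ht x u).mapL (innerSL ℂ (tm u' (expStep g')))
  have e2 := ((hasSum_column_apply hB (cut g t) ht x u).mapL
    (innerSL ℂ (tm u' (expStep (cut g' t))))).mul_right
      (Complex.exp (ip (g' : ℝ → 𝔨) (g : ℝ → 𝔨) - cum (g' : ℝ → 𝔨) (g : ℝ → 𝔨) t))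
  have e3 : (fun n => innerSL ℂ (tm u' (expStep g')) (A n g t x u)) = fun n =>
      innerSL ℂ (tm u' (expStep (cut g' t))) (A n (cut g t) t x u) *
        Complex.exp (ip (g' : ℝ → 𝔨) (g : ℝ → 𝔨) - cum (g' : ℝ → 𝔨) (g : ℝ → 𝔨) t) :=
    funext fun n => had n g t ht x u u' g'
  rw [e3] at e1
  exact e1.unique e2

theorem colSpace_sum {Y : Submodule ℂ (𝔥 →L[ℂ] 𝔥')} (hY : IsClosed (Y : Set (𝔥 →L[ℂ] 𝔥')))
    (hA : ∀ n g t, 0 ≤ t → ∀ x, A n g t x ∈ colSpace Y (Fock 𝔨))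
    (hB : ∀ g t, 0 ≤ t → ∀ x, HasSum (fun n => A n g t x) (B g t x)) (g : step D) {t : ℝ}
    (ht : 0 ≤ t) (x : V) : B g t x ∈ colSpace Y (Fock 𝔨) :=
  (isClosed_colSpace hY).mem_of_tendsto (hB g t ht x)
    (Filter.Eventually.of_forall fun _ => Submodule.sum_mem _ fun n _ => hA n g t ht x)

/-- Summing the weak equations of the iterates shifts the index by one, which accounts for the
missing initial term. Sum and time integral are exchanged by dominated convergence with the bounds
β. -/
theorem weakEq_sum (h1 : 1 ∈ S) (hφ : ∀ ζ, Liftable S (φ ζ) 𝔥 (HT 𝔥' (Fock 𝔨)))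
    (hreg : ∀ n g, Regular S (A n g)) (hw : ∀ n, WeakEq φ (A n) (A (n + 1)))
    (hb : ∀ (g : step D) (T : ℝ), ∃ β : ℕ → ℝ, Summable β ∧
      (∀ n, 0 ≤ β n) ∧ ∀ n, ∀ t ∈ Icc 0 T, HasLevelBound S (A n g t) (β n))
    (hB : ∀ g t, 0 ≤ t → ∀ x, HasSum (fun n => A n g t x) (B g t x)) :
    WeakEq φ B fun g t => B g t - A 0 g t := by
  intro g t ht x u u' g'
  set w : HT 𝔥' (Fock 𝔨) := tm u' (expStep g')
  obtain ⟨β, hβ, hβ0, hβA⟩ := hb g t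
  obtain ⟨M, hM, hM'⟩ := exists_bound_hatStep_pair g' g fun ζ' ζ => ‖coeff φ ζ' ζ x‖
  have e1 : HasSum (fun n => ⟪w, A (n + 1) g t x u⟫_ℂ) ⟪w, (B g t - A 0 g t) x u⟫_ℂ := by
    have h := (hasSum_nat_add_iff' 1).2 (hasSum_column_apply hB g ht x u)
    rw [Finset.sum_range_one] at h
    exact h.mapL (innerSL ℂ w)
  refine e1.unique ?_
  have e2 : (fun n => ⟪w, A (n + 1) g t x u⟫_ℂ) = fun n => ∫ s in (0 : ℝ)..t,
      ⟪w, A n g s (coeff φ (hat ((g' : ℝ → 𝔨) s)) (hatStep g s) x) u⟫_ℂ :=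
    funext fun n => hw n g t ht x u u' g'
  rw [e2]
  refine intervalIntegral.hasSum_integral_of_dominated_convergence
    (fun n _ => ‖w‖ * (β n * M * ‖u‖)) (fun n => ?_) (fun n => ?_) ?_ ?_ ?_
  · have h := (intervalIntegrable_weak h1 hφ (hreg n g) g x u w g' le_rfl ht).aestronglyMeasurable
    rwa [uIoc_of_le ht]
  · refine Filter.Eventually.of_forall fun s hs => ?_
    rw [uIoc_of_le ht] at hs
    refine (norm_inner_le_norm _ _).trans (mul_le_mul_of_nonneg_left ?_ (norm_nonneg _))
    refine ((hβA n s ⟨hs.1.le, hs.2⟩).norm_apply_le h1 _ u).trans ?_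
    exact mul_le_mul_of_nonneg_right (mul_le_mul_of_nonneg_left (hM' s) (hβ0 n)) (norm_nonneg _)
  · exact Filter.Eventually.of_forall fun s _ =>
      ((hβ.mul_right M).mul_right ‖u‖).mul_left ‖w‖
  · simp
  · refine Filter.Eventually.of_forall fun s hs => ?_
    rw [uIoc_of_le ht] at hs
    exact (hasSum_column_apply hB g hs.1.le _ u).mapL (innerSL ℂ w)

end Iteration

/-! ### Columns of the initial condition -/

section InitialColumn

variable {𝔨 : Type*} [NormedAddCommGroup 𝔨] [InnerProductSpace ℂ 𝔨]
  {𝔥 : Type*} [NormedAddCommGroup 𝔥] [InnerProductSpace ℂ 𝔥]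
  {𝔥' : Type*} [NormedAddCommGroup 𝔥'] [InnerProductSpace ℂ 𝔥']
  {V : Type*} [NormedAddCommGroup V] [NormedSpace ℂ V] [OperatorSpace V]
  {D : Submodule ℂ 𝔨} {S : Set ℕ} {Y : Submodule ℂ (𝔥 →L[ℂ] 𝔥')}

/-- The column `x ↦ κ(x) ⊗ |ε⟩`. -/
def initialColumn {K : Type*} [NormedAddCommGroup K] [InnerProductSpace ℂ K]
    (κ : V →ₗ[ℂ] Y) (ε : K) : V →ₗ[ℂ] (𝔥 →L[ℂ] HT 𝔥' K) :=
  ((ContinuousLinearMap.compL ℂ 𝔥 𝔥' (HT 𝔥' K)) (ket ε)).toLinearMap ∘ₗ Y.subtype ∘ₗ κ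

theorem initialColumn_apply {K : Type*} [NormedAddCommGroup K] [InnerProductSpace ℂ K]
    (κ : V →ₗ[ℂ] Y) (ε : K) (x : V) (u : 𝔥) :
    initialColumn κ ε x u = tm ((κ x : 𝔥 →L[ℂ] 𝔥') u) ε := rfl

theorem hasLevelBound_initialColumn {K : Type*} [NormedAddCommGroup K] [InnerProductSpace ℂ K]
    {κ : V →ₗ[ℂ] Y} {C : ℝ} (h : HasLevelBound S κ C) (ε : K) :
    HasLevelBound S (initialColumn κ ε) (max C 0 * ‖ε‖) := by
  refine hasLevelBound_of_sum_le (by positivity) fun n hn X v => ?_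
  have h2 : mnorm (X.map fun x => (κ x : 𝔥 →L[ℂ] 𝔥')) ≤ max C 0 * mnorm X :=
    (h n hn X).trans (mul_le_mul_of_nonneg_right (le_max_left _ _) (mnorm_nonneg X))
  have h3 := sum_norm_sq_le_of_mnorm_le h2 v
  have e : ∀ i, ‖∑ j, initialColumn κ ε (X i j) (v j)‖ ^ 2
      = ‖ε‖ ^ 2 * ‖∑ j, (κ (X i j) : 𝔥 →L[ℂ] 𝔥') (v j)‖ ^ 2 := by
    intro i
    simp only [initialColumn_apply, ← ket_apply]
    rw [← map_sum, ket_apply, norm_tm]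
    ring
  simp only [e]
  rw [← Finset.mul_sum]
  refine (mul_le_mul_of_nonneg_left h3 (sq_nonneg ‖ε‖)).trans (le_of_eq (by ring))

/-- The kernel exp⟨g',g⟩ factorises over [0,t[ and [t,∞[. -/
theorem famAdapted_initialColumn (κ : V →ₗ[ℂ] Y) :
    FamAdapted fun (g : step D) (_ : ℝ) => initialColumn κ (expStep g) := by
  intro g t ht x u u' g'
  rw [initialColumn_apply, initialColumn_apply, inner_tm, inner_tm, inner_expStep, inner_expStep,
    ip_cut_cut g' g ht, mul_assoc, ← Complex.exp_add]
  congr 2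
  ring

theorem initialColumn_mem_colSpace [CompleteSpace 𝔥'] {K : Type*} [NormedAddCommGroup K]
    [InnerProductSpace ℂ K] (κ : V →ₗ[ℂ] Y) (ε : K) (x : V) :
    initialColumn κ ε x ∈ colSpace Y K := by
  intro χ
  have e : bra χ ∘L initialColumn κ ε x = ⟪χ, ε⟫_ℂ • (κ x : 𝔥 →L[ℂ] 𝔥') :=
    ContinuousLinearMap.ext fun u => bra_tm _ _ _
  rw [e]
  exact Y.smul_mem _ (κ x).2

end InitialColumn

/-! ### Operators on exponential domains given by their columns -/

section Operators

variable {𝔨 : Type*} [NormedAddCommGroup 𝔨] [InnerProductSpace ℂ 𝔨]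
  {𝔥 : Type*} [NormedAddCommGroup 𝔥] [InnerProductSpace ℂ 𝔥]
  {D : Submodule ℂ 𝔨}

theorem expDom_induction {E : Submodule ℂ 𝔥} {p : expDom E D → Prop} (h0 : p 0)
    (hv : ∀ (u : E) (g : step D), p (vexp u g)) (ha : ∀ x y, p x → p y → p (x + y))
    (ξ : expDom E D) : p ξ := by
  refine algTensor_induction (p := p) h0 (fun a b => ?_) ha ξ
  obtain ⟨b, hb⟩ := b
  revert a
  induction hb using Submodule.span_induction with
  | mem b hb =>
    obtain ⟨g, rfl⟩ := hb
    exact fun a => hv a g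
  | zero =>
    intro a
    have e : (algKet (⟨0, (exps D).zero_mem⟩ : exps D) a : algTensor E (exps D)) = 0 :=
      Subtype.ext (tm_zero_right _)
    exact (congrArg p e).mpr h0
  | add b b' hb hb' h h' =>
    intro a
    have e : (algKet (⟨b + b', (exps D).add_mem hb hb'⟩ : exps D) a : algTensor E (exps D))
        = algKet (⟨b, hb⟩ : exps D) a + algKet (⟨b', hb'⟩ : exps D) a :=
      Subtype.ext (tm_add_right _ _ _)
    exact (congrArg p e).mpr (ha _ _ (h a) (h' a))
  | smul c b hb h =>
    intro a
    have e : (algKet (⟨c • b, (exps D).smul_mem c hb⟩ : exps D) a : algTensor E (exps D))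
        = algKet (⟨b, hb⟩ : exps D) (c • a) :=
      Subtype.ext ((tm_smul_right c (a : 𝔥) b).trans (tm_smul_left c (a : 𝔥) b).symm)
    exact (congrArg p e).mpr (h (c • a))

theorem expDom_ext {E : Submodule ℂ 𝔥} {G : Type*} [AddCommGroup G] [Module ℂ G]
    {T T' : expDom E D →ₗ[ℂ] G} (h : ∀ (u : E) (g : step D), T (vexp u g) = T' (vexp u g)) :
    T = T' := by
  refine LinearMap.ext fun ξ => ?_
  refine expDom_induction (p := fun ξ => T ξ = T' ξ) (by simp) h (fun x y hx hy => ?_) ξ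
  rw [map_add, map_add, hx, hy]

variable {V : Type*} [NormedAddCommGroup V] [NormedSpace ℂ V]
  {G : Type*} [NormedAddCommGroup G] [NormedSpace ℂ G]

/-- The linear extension of a family of columns to the span of the exponential vectors. -/
def extendCol (A : step D → V →ₗ[ℂ] (𝔥 →L[ℂ] G)) : exps D →ₗ[ℂ] V →ₗ[ℂ] (𝔥 →L[ℂ] G) :=
  (expBasis D).constr ℂ A

theorem extendCol_expD (A : step D → V →ₗ[ℂ] (𝔥 →L[ℂ] G)) (g : step D) :
    extendCol A (expD g) = A g := by
  rw [← expBasis_apply, extendCol, Module.Basis.constr_basis]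

theorem extendCol_eq_sum (A : step D → V →ₗ[ℂ] (𝔥 →L[ℂ] G)) (ε : exps D) :
    extendCol A ε = ∑ g ∈ ((expBasis D).repr ε).support, (expBasis D).repr ε g • A g :=
  Module.Basis.constr_apply ..

/-- The bilinear form of the operator with columns `A`. -/
def colForm (A : step D → V →ₗ[ℂ] (𝔥 →L[ℂ] G)) :
    V →ₗ[ℂ] (⊤ : Submodule ℂ 𝔥) →ₗ[ℂ] exps D →ₗ[ℂ] G where
  toFun x := LinearMap.mk₂ ℂ
    (fun (u : (⊤ : Submodule ℂ 𝔥)) (ε : exps D) => extendCol A ε x (u : 𝔥))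
    (fun _ _ _ => by simp) (fun _ _ _ => by simp) (fun _ _ _ => by simp) (fun _ _ _ => by simp)
  map_add' x y := LinearMap.ext₂ fun u ε => by simp
  map_smul' c x := LinearMap.ext₂ fun u ε => by simp

/-- The operator with columns `A`. -/
def opOf (A : step D → V →ₗ[ℂ] (𝔥 →L[ℂ] G)) :
    V →ₗ[ℂ] (expDom (⊤ : Submodule ℂ 𝔥) D →ₗ[ℂ] G) :=
  (algLift (A := (⊤ : Submodule ℂ 𝔥)) (B := exps D)) ∘ₗ colForm A

theorem opOf_algKet (A : step D → V →ₗ[ℂ] (𝔥 →L[ℂ] G)) (x : V) (ε : exps D)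
    (u : (⊤ : Submodule ℂ 𝔥)) : opOf A x (algKet ε u) = extendCol A ε x (u : 𝔥) :=
  algLift_algKet _ _ _

theorem opOf_vexp (A : step D → V →ₗ[ℂ] (𝔥 →L[ℂ] G)) (x : V) (g : step D)
    (u : (⊤ : Submodule ℂ 𝔥)) : opOf A x (vexp u g) = A g x (u : 𝔥) := by
  rw [vexp, opOf_algKet, extendCol_expD]

theorem continuousOn_opOf {A : step D → ℝ → V →ₗ[ℂ] (𝔥 →L[ℂ] G)} {x : V}
    (h : ∀ g, ContinuousOn (fun t => A g t x) (Ici 0)) (ξ : expDom (⊤ : Submodule ℂ 𝔥) D) :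
    ContinuousOn (fun t => opOf (fun g => A g t) x ξ) (Ici 0) := by
  refine expDom_induction (p := fun ξ => ContinuousOn (fun t => opOf (fun g => A g t) x ξ) (Ici 0))
    (by simpa using continuousOn_const) (fun u g => ?_) (fun ξ ξ' hξ hξ' => ?_) ξ
  · simp only [opOf_vexp]
    exact (h g).clm_apply continuousOn_const
  · simp only [map_add]
    exact hξ.add hξ'

theorem ip_after (g' : step (⊤ : Submodule ℂ 𝔨)) (g : step D) {t : ℝ} (ht : 0 ≤ t) :
    ip (after g' ht : ℝ → 𝔨) (after g ht : ℝ → 𝔨)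
      = ip (g' : ℝ → 𝔨) (g : ℝ → 𝔨) - cum (g' : ℝ → 𝔨) (g : ℝ → 𝔨) t := by
  rw [after_eq_sub_cut, after_eq_sub_cut, ip_sub_left, ← ip_conj,
    ← ip_conj (_ : ℝ → 𝔨) (cut g' t : ℝ → 𝔨), ip_sub_left,
    ip_sub_left, map_sub, map_sub, ip_conj, ip_conj, ip_conj, ip_conj, ip_cut_left g' g ht,
    ip_cut_cut g' g ht, ← ip_conj (cut g t : ℝ → 𝔨), ip_cut_left g g' ht, cum_conj]
  ring

variable {𝔥' : Type*} [NormedAddCommGroup 𝔥'] [InnerProductSpace ℂ 𝔥']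

theorem IsProcess.congr {E : Submodule ℂ 𝔥} {X X' : ℝ → Op E D 𝔥'} (h : IsProcess X)
    (e : ∀ t, 0 ≤ t → X' t = X t) : IsProcess X' := by
  refine ⟨fun ξ' ξ => ?_, fun t ht u g u' g' => ?_⟩
  · have : (Ici (0 : ℝ)).domRestrict (fun t => ⟪ξ', X' t ξ⟫_ℂ)
        = (Ici (0 : ℝ)).domRestrict fun t => ⟪ξ', X t ξ⟫_ℂ := by
      funext t
      simp only [domRestrict_apply, e t t.2]
    rw [this]
    exact h.measurable ξ' ξ
  · rw [e t ht]
    exact h.adapted t ht u g u' g'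

variable {A B : step D → ℝ → V →ₗ[ℂ] (𝔥 →L[ℂ] HT 𝔥' (Fock 𝔨))} [OperatorSpace V]

theorem isProcess_opOf (had : FamAdapted A) {x : V}
    (h : ∀ g, ContinuousOn (fun t => A g t x) (Ici 0)) :
    IsProcess fun t => (opOf (fun g => A g t) x : Op ⊤ D 𝔥') := by
  refine ⟨fun ξ' ξ => ?_, fun t ht u g u' g' => ?_⟩
  · have hc : ContinuousOn (fun t => ⟪ξ', opOf (fun g => A g t) x ξ⟫_ℂ) (Ici 0) :=
      (innerSL ℂ ξ').continuous.comp_continuousOn (continuousOn_opOf h ξ)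
    exact hc.domRestrict.measurable
  · rw [opOf_vexp, opOf_vexp, before_eq_cut, before_eq_cut, inner_expStep, ip_after]
    exact had g t ht x u u' g'

variable [CompleteSpace 𝔨] [CompleteSpace 𝔥'] {S : Set ℕ}
  {φ : dhat D →ₗ[ℂ] V →ₗ[ℂ] CBMap (StrongDual ℂ (Khat 𝔨)) V}

/-- The operator on the domain with the extra factor D̂ has, at ζ, the lifts along φ_{|ζ⟩} as
columns. Linearity in ζ holds because lifts are unique and φ is linear. -/
theorem exists_hatOperator (hφ : ∀ ζ, Liftable S (φ ζ) 𝔥 (HT 𝔥' (Fock 𝔨)))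
    (hA : ∀ g, Regular S (A g)) (t : ℝ) :
    ∃ K : V →ₗ[ℂ] OpHat (⊤ : Submodule ℂ 𝔥) D 𝔥', 0 ≤ t →
      ∀ x (ζ : dhat D) (ξ : expDom (⊤ : Submodule ℂ 𝔥) D),
        K x (algKet ζ ξ) = opOf (fun g => hatLift (A g t) (φ ζ)) x ξ := by
  by_cases ht : 0 ≤ t
  swap
  · exact ⟨0, fun h => absurd h ht⟩
  have hl : ∀ g ζ, IsHatLift (A g t) (φ ζ) (hatLift (A g t) (φ ζ)) := fun g ζ =>
    (hA g).isHatLift (hφ ζ) ht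
  have hadd : ∀ g ζ ζ', hatLift (A g t) (φ (ζ + ζ'))
      = hatLift (A g t) (φ ζ) + hatLift (A g t) (φ ζ') := by
    intro g ζ ζ'
    refine hatLift_eq fun x η v => ?_
    rw [LinearMap.add_apply, add_apply, map_add, hl, hl]
    simp
  have hsmul : ∀ g (c : ℂ) ζ, hatLift (A g t) (φ (c • ζ)) = c • hatLift (A g t) (φ ζ) := by
    intro g c ζ
    refine hatLift_eq fun x η v => ?_
    rw [LinearMap.smul_apply, smul_apply, map_smul, hl]
    simp
  let b : V → expDom (⊤ : Submodule ℂ 𝔥) D →ₗ[ℂ] dhat D →ₗ[ℂ] HT (HT 𝔥' (Fock 𝔨)) (Khat 𝔨) :=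
    fun x => LinearMap.mk₂ ℂ (fun ξ ζ => opOf (fun g => hatLift (A g t) (φ ζ)) x ξ)
      (fun _ _ _ => by simp) (fun _ _ _ => by simp)
      (fun ξ ζ ζ' => by
        rw [← LinearMap.add_apply]
        refine LinearMap.congr_fun (expDom_ext fun u g => ?_) ξ
        rw [LinearMap.add_apply, opOf_vexp, opOf_vexp, opOf_vexp, hadd]
        rfl)
      (fun c ξ ζ => by
        rw [← LinearMap.smul_apply]
        refine LinearMap.congr_fun (expDom_ext fun u g => ?_) ξ
        rw [LinearMap.smul_apply, opOf_vexp, opOf_vexp, hsmul]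
        rfl)
  refine ⟨{ toFun := fun x => algLift (b x), map_add' := fun x y => ?_,
            map_smul' := fun c x => ?_ }, fun _ x ζ ξ => algLift_algKet _ _ _⟩
  · rw [← map_add]
    congr 1
    refine LinearMap.ext₂ fun ξ ζ => ?_
    simp [b]
  · rw [RingHom.id_apply, ← map_smul]
    congr 1
    refine LinearMap.ext₂ fun ξ ζ => ?_
    simp [b]

/-- Passes from the weak formula for columns to the integral of operators. The slices of the lifted
operator are the required coefficients, and its values along ĝ(s) are the square integrable lifts
already studied. -/
theorem isIntegralAgainst_opOf (h1 : 1 ∈ S) (hφ : ∀ ζ, Liftable S (φ ζ) 𝔥 (HT 𝔥' (Fock 𝔨)))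
    (had : FamAdapted A) (hA : ∀ g, Regular S (A g)) (hw : WeakEq φ A B) :
    IsIntegralAgainst φ (fun t => opOf fun g => A g t) (fun t => opOf fun g => B g t) := by
  choose K hK using exists_hatOperator hφ hA
  have hs : ∀ t : ℝ, 0 ≤ t → ∀ (x : V) (ζ' : Khat 𝔨) (ζ : dhat D),
      slice ζ' ζ (K t x) = opOf (fun g => A g t) (coeff φ ζ' ζ x) := by
    intro t ht x ζ' ζ
    refine expDom_ext fun u g => ?_
    change bra ζ' (K t x (algKet ζ (vexp u g))) = _
    rw [hK t ht, opOf_vexp, opOf_vexp]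
    exact (hA g).isHatLift (hφ ζ) ht x ζ' u
  have hInt : ∀ (x : V) (v : (⊤ : Submodule ℂ 𝔥)) (g : step D) (s : ℝ), 0 ≤ s →
      integrand (fun t => K t x) v g s = hatLift (A g s) (φ (hatStep g s)) x (v : 𝔥) := by
    intro x v g s hs
    rw [integrand, hK s hs, opOf_vexp]
  have hm : ∀ x, QSIntegrable fun t => K t x := by
    intro x v g T hT
    refine (memLp_congr_ae ?_).1 (memLp_hatLift h1 hφ (hA g) g x (v : 𝔥) (b := T) le_rfl)
    filter_upwards [ae_restrict_mem measurableSet_Icc] with s hs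
    exact (hInt x v g s hs.1).symm
  refine ⟨K, fun x ζ' ζ => ?_, hs, hm, fun x t ht v g => ?_⟩
  · exact (isProcess_opOf had fun g => (hA g).continuousOn h1 _).congr fun t ht => hs t ht x ζ' ζ
  · set z := integrand (fun t => K t x) v g with hz
    have hi : IntervalIntegrable (fun s => bra (hat (0 : 𝔨)) (z s)) volume 0 t := by
      rw [intervalIntegrable_iff_integrableOn_Icc_of_le ht]
      exact ((bra (hat (0 : 𝔨))).comp_memLp' (hm x v g t ht)).integrable one_le_two
    -- The Hitsuda–Skorohod part is what remains after removing the time integral. Since ĝ'(s) =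
    -- (1,0) + (0,g'(s)), its pairings are those with the noise component alone.
    refine ⟨B g t x v - ∫ s in (0 : ℝ)..t, bra (hat (0 : 𝔨)) (z s), fun v' g' => ?_, ?_⟩
    · have e1 : ⟪tm v' (expStep g'), ∫ s in (0 : ℝ)..t, bra (hat (0 : 𝔨)) (z s)⟫_ℂ
          = ∫ s in (0 : ℝ)..t, ⟪tm (tm v' (expStep g')) (hat (0 : 𝔨)), z s⟫_ℂ := by
        refine ((innerSL ℂ (tm v' (expStep g'))).intervalIntegral_comp_comm hi).symm.trans ?_
        exact intervalIntegral.integral_congr fun s _ => inner_bra _ (tm v' (expStep g')) (z s)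
      have e2 : ⟪tm v' (expStep g'), B g t x v⟫_ℂ
          = ∫ s in (0 : ℝ)..t, ⟪tm (tm v' (expStep g')) (hat ((g' : ℝ → 𝔨) s)), z s⟫_ℂ := by
        rw [hw g t ht]
        refine intervalIntegral.integral_congr fun s hs => ?_
        rw [uIcc_of_le ht] at hs
        simp only [hz, hInt x v g s hs.1]
        exact (inner_sum_hatLift hφ (hA g) g x (v : 𝔥) hs.1 _ _).symm
      rw [inner_sub_right, e1, e2, ← intervalIntegral.integral_sub
        (intervalIntegrable_inner_tm ht (hm x v g t ht) _ g' hat)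
        (intervalIntegrable_inner_tm ht (hm x v g t ht) _ g' fun _ => hat 0)]
      refine intervalIntegral.integral_congr fun s _ => ?_
      rw [hat_eq_add ((g' : ℝ → 𝔨) s) 0, sub_zero, tm_add_right, inner_add_left,
        add_sub_cancel_left]
    · change opOf (fun g => B g t) x (vexp v g) = _
      rw [opOf_vexp, add_sub_cancel]

end Operators

/-! ### Columns at finite combinations of exponential vectors -/

section ColumnBounds

variable {𝔨 : Type*} [NormedAddCommGroup 𝔨] [InnerProductSpace ℂ 𝔨] {D : Submodule ℂ 𝔨}
  {𝔥 : Type*} [NormedAddCommGroup 𝔥] [InnerProductSpace ℂ 𝔥]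
  {𝔥' : Type*} [NormedAddCommGroup 𝔥'] [InnerProductSpace ℂ 𝔥']
  {V : Type*} [NormedAddCommGroup V] [NormedSpace ℂ V] [OperatorSpace V] {S : Set ℕ}
  {B : step D → ℝ → V →ₗ[ℂ] (𝔥 →L[ℂ] HT 𝔥' (Fock 𝔨))}

theorem hasLevelBound_extendCol {A : step D → V →ₗ[ℂ] (𝔥 →L[ℂ] HT 𝔥' (Fock 𝔨))} {C : step D → ℝ}
    (h : ∀ g, HasLevelBound S (A g) (C g)) (ε : exps D) :
    HasLevelBound S (extendCol A ε)
      (∑ g ∈ ((expBasis D).repr ε).support, ‖(expBasis D).repr ε g‖ * C g) := by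
  rw [extendCol_eq_sum]
  exact HasLevelBound.sum _ fun g _ => (h g).smul _

theorem exists_bound_extendCol (hB : ∀ g, Regular S (B g)) (ε : exps D) {t : ℝ} (ht : 0 ≤ t) :
    ∃ C : ℝ, HasLevelBound S (extendCol (fun g => B g t) ε) C := by
  choose C _ hC using fun g => (hB g).bound t
  exact ⟨_, hasLevelBound_extendCol (fun g => hC g t ⟨ht, le_rfl⟩) ε⟩

theorem exists_holder_extendCol (hB : ∀ g, Regular S (B g)) (ε : exps D) (T : ℝ) :
    ∃ C : ℝ, ∀ s ∈ Icc 0 T, ∀ t ∈ Icc 0 T,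
      HasLevelBound S (extendCol (fun g => B g t) ε - extendCol (fun g => B g s) ε)
        (C * |t - s| ^ (1 / 2 : ℝ)) := by
  choose C _ hC using fun g => (hB g).holder T
  refine ⟨∑ g ∈ ((expBasis D).repr ε).support, ‖(expBasis D).repr ε g‖ * C g,
    fun s hs t ht => ?_⟩
  have e : extendCol (fun g => B g t) ε - extendCol (fun g => B g s) ε
      = extendCol (fun g => B g t - B g s) ε := by
    rw [extendCol_eq_sum, extendCol_eq_sum, extendCol_eq_sum, ← Finset.sum_sub_distrib]
    simp only [smul_sub]
  rw [e, Finset.sum_mul]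
  simp only [mul_assoc]
  exact hasLevelBound_extendCol (fun g => hC g s hs t ht) ε

theorem extendCol_mem {A : step D → V →ₗ[ℂ] (𝔥 →L[ℂ] HT 𝔥' (Fock 𝔨))}
    {P : Submodule ℂ (𝔥 →L[ℂ] HT 𝔥' (Fock 𝔨))} {x : V} (h : ∀ g, A g x ∈ P) (ε : exps D) :
    extendCol A ε x ∈ P := by
  rw [extendCol_eq_sum, LinearMap.sum_apply]
  exact P.sum_mem fun g _ => P.smul_mem _ (h g)

end ColumnBounds

/-! ### Uniqueness of weak solutions -/

section Volterra

variable {V : Type*} [NormedAddCommGroup V] [NormedSpace ℂ V] [CompleteSpace V]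

/-- Pointwise boundedness on [0,T] comes from continuity. Banach–Steinhaus, which needs V complete,
makes it uniform. -/
theorem exists_uniform_bound {d : ℝ → V →ₗ[ℂ] ℂ}
    (hb : ∀ t, 0 ≤ t → ∃ C : ℝ, ∀ x, ‖d t x‖ ≤ C * ‖x‖)
    (hc : ∀ x, ContinuousOn (fun t => d t x) (Ici 0)) (T : ℝ) :
    ∃ C : ℝ, 0 ≤ C ∧ ∀ t ∈ Icc 0 T, ∀ x, ‖d t x‖ ≤ C * ‖x‖ := by
  choose c hc' using fun t : Icc (0 : ℝ) T => hb t t.2.1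
  obtain ⟨C, hC⟩ := banach_steinhaus
      (g := fun t : Icc (0 : ℝ) T => (d t).mkContinuous (c t) (hc' t)) fun x => by
    obtain ⟨M, hM⟩ := isCompact_Icc.exists_bound_of_continuousOn
      ((hc x).mono fun s (hs : s ∈ Icc 0 T) => hs.1)
    exact ⟨M, fun t => hM t t.2⟩
  refine ⟨max C 0, le_max_right _ _, fun t ht x => ?_⟩
  refine (((d t).mkContinuous _ (hc' ⟨t, ht⟩)).le_opNorm x).trans ?_
  exact mul_le_mul_of_nonneg_right ((hC ⟨t, ht⟩).trans (le_max_left _ _)) (norm_nonneg x)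

/-- Starting from a uniform bound C on [0,T], each use of the equation improves it by one
integration, to C (Mt)^n/n! after n steps. -/
theorem eq_zero_of_volterra {d : ℝ → V →ₗ[ℂ] ℂ} {Ψ : ℝ → V → V} {M : ℝ} (hM : 0 ≤ M)
    (hΨ : ∀ s x, ‖Ψ s x‖ ≤ M * ‖x‖)
    (hb : ∀ t, 0 ≤ t → ∃ C : ℝ, ∀ x, ‖d t x‖ ≤ C * ‖x‖)
    (hc : ∀ x, ContinuousOn (fun t => d t x) (Ici 0))
    (he : ∀ t, 0 ≤ t → ∀ x, d t x = ∫ s in (0 : ℝ)..t, d s (Ψ s x)) {T : ℝ} (hT : 0 ≤ T) (x : V) :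
    d T x = 0 := by
  obtain ⟨C, hC, h⟩ := exists_uniform_bound hb hc T
  have key : ∀ n : ℕ, ∀ t ∈ Icc 0 T, ∀ x, ‖d t x‖ ≤ C * ((M * t) ^ n / n.factorial) * ‖x‖ := by
    intro n
    induction n with
    | zero => simpa using h
    | succ n ih =>
      intro t ht x
      rw [he t ht.1 x]
      have hi : IntervalIntegrable (fun s : ℝ => C * M ^ (n + 1) / n.factorial * ‖x‖ * s ^ n)
          volume 0 t := (by fun_prop : Continuous fun s : ℝ =>
            C * M ^ (n + 1) / n.factorial * ‖x‖ * s ^ n).intervalIntegrable _ _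
      refine (intervalIntegral.norm_integral_le_of_norm_le ht.1
        (Filter.Eventually.of_forall fun s hs => ?_) hi).trans (le_of_eq ?_)
      · refine (ih s ⟨hs.1.le, hs.2.trans ht.2⟩ (Ψ s x)).trans ?_
        have h0 : 0 ≤ C * ((M * s) ^ n / n.factorial) := by
          have := hs.1.le
          positivity
        refine (mul_le_mul_of_nonneg_left (hΨ s x) h0).trans (le_of_eq ?_)
        ring
      · rw [intervalIntegral.integral_const_mul, integral_pow, Nat.factorial_succ]
        have : (n.factorial : ℝ) ≠ 0 := by positivity
        have : (n : ℝ) + 1 ≠ 0 := by positivity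
        push_cast
        field_simp
        simp [mul_pow]
        ring
  have ht : Filter.Tendsto (fun n : ℕ => C * ((M * T) ^ n / n.factorial) * ‖x‖) Filter.atTop
      (nhds (C * 0 * ‖x‖)) :=
    ((FloorSemiring.tendsto_pow_div_factorial_atTop (M * T)).const_mul C).mul_const _
  rw [mul_zero, zero_mul] at ht
  exact norm_le_zero_iff.1 (ge_of_tendsto' ht fun n => key n T ⟨hT, le_rfl⟩ x)

end Volterra

/-! ### Comparison of weak solutions with the constructed one -/

section Uniqueness

variable {𝔨 : Type*} [NormedAddCommGroup 𝔨] [InnerProductSpace ℂ 𝔨] [CompleteSpace 𝔨]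
  {𝔥 : Type*} [NormedAddCommGroup 𝔥] [InnerProductSpace ℂ 𝔥]
  {𝔥' : Type*} [NormedAddCommGroup 𝔥'] [InnerProductSpace ℂ 𝔥'] [CompleteSpace 𝔥']
  {V : Type*} [NormedAddCommGroup V] [NormedSpace ℂ V] [OperatorSpace V]
  {D : Submodule ℂ 𝔨} {S : Set ℕ} {Y : Submodule ℂ (𝔥 →L[ℂ] 𝔥')}
  {φ : dhat D →ₗ[ℂ] V →ₗ[ℂ] CBMap (StrongDual ℂ (Khat 𝔨)) V}

theorem IsKBounded.exists_hasBound {W : Type*} [AddCommGroup W] [Module ℂ W] [MatrixNorm W]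
    {ψ : V →ₗ[ℂ] W} (h : IsKBounded 𝔨 ψ) : ∃ C, HasBound ψ C := by
  obtain ⟨C, hC, hC'⟩ := h
  by_cases hk : FiniteDimensional ℂ 𝔨
  · exact ⟨C, hC hk⟩
  · exact ⟨C, fun x => hC' hk 1 _⟩

theorem exists_coeff_bound (hφ : ∀ ζ, ∃ C, HasBound (φ ζ) C) {D' : Submodule ℂ 𝔨}
    (g' : step D') (g : step D) :
    ∃ M : ℝ, 0 ≤ M ∧ ∀ s x, ‖coeff φ (hat ((g' : ℝ → 𝔨) s)) (hatStep g s) x‖ ≤ M * ‖x‖ := by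
  choose C hC using hφ
  obtain ⟨M, hM, h⟩ := exists_bound_hatStep_pair g' g fun ζ' ζ => C ζ * ‖innerSL ℂ ζ'‖
  refine ⟨M, hM, fun s x => (norm_cbMap_apply_le (hC _) x _).trans ?_⟩
  rw [mul_right_comm]
  exact mul_le_mul_of_nonneg_right (h s) (norm_nonneg x)

/-- For fixed v' ε(g') and v ε(g), both solutions give functionals on V with the same inhomogeneous
Volterra equation. The initial term cancels in the difference. Density of E₁' and D₁' makes such
matrix elements determine the vector. -/
theorem eq_of_isWeakSolution [CompleteSpace V] (h1 : 1 ∈ S)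
    (hφ : ∀ ζ, ∃ C, HasBound (φ ζ) C)
    {κ : V →ₗ[ℂ] Y} {B : step D → ℝ → V →ₗ[ℂ] (𝔥 →L[ℂ] HT 𝔥' (Fock 𝔨))}
    (hB : ∀ g, Regular S (B g))
    (hw : WeakEq φ B fun g t => B g t - initialColumn κ (expStep g))
    {E₁ : Submodule ℂ 𝔥} {D₁ : Submodule ℂ 𝔨} {E₁' : Submodule ℂ 𝔥'} {D₁' : Submodule ℂ 𝔨}
    (hE' : Dense (E₁' : Set 𝔥')) (hD' : Dense (D₁' : Set 𝔨)) (hDD : D₁ ≤ D)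
    {k₁ : ℝ → V →ₗ[ℂ] Op E₁ D₁ 𝔥'}
    (hk : IsWeakSolution E₁' D₁' (φ ∘ₗ Submodule.inclusion (dhat_mono hDD)) κ k₁)
    (hb : ∀ (ξ' : expDom E₁' D₁') (ξ : expDom E₁ D₁) (t : ℝ), 0 ≤ t →
      ∃ C : ℝ, ∀ x : V, ‖⟪(ξ' : HT 𝔥' (Fock 𝔨)), k₁ t x ξ⟫_ℂ‖ ≤ C * ‖x‖)
    {t : ℝ} (ht : 0 ≤ t) (x : V) (v : E₁) (g₁ : step D₁) :
    k₁ t x (vexp v g₁) = B ⟨g₁, step_mono hDD g₁.2⟩ t x (v : 𝔥) := by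
  refine ext_expStep hE' hD' fun v' hv' g₁' => ?_
  let g : step D := ⟨g₁, step_mono hDD g₁.2⟩
  let g' : step (⊤ : Submodule ℂ 𝔨) := ⟨g₁', step_mono le_top g₁'.2⟩
  let w : HT 𝔥' (Fock 𝔨) := tm v' (expStep g₁')
  obtain ⟨M, hM, hΨ⟩ := exists_coeff_bound hφ g' g
  obtain ⟨q, hq⟩ := exists_simpleFunc_hatStep_pair g' g
  let d₁ : ℝ → V →ₗ[ℂ] ℂ := fun t =>
    (innerSL ℂ w).toLinearMap ∘ₗ LinearMap.applyₗ (vexp v g₁) ∘ₗ k₁ t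
  let d₂ : ℝ → V →ₗ[ℂ] ℂ := fun t => (innerSL ℂ w).toLinearMap ∘ₗ
    (ContinuousLinearMap.apply ℂ (HT 𝔥' (Fock 𝔨)) (v : 𝔥)).toLinearMap ∘ₗ B g t
  have hc₁ : ∀ x, ContinuousOn (fun t => d₁ t x) (Ici 0) := fun x =>
    hk.continuous (vexp ⟨v', hv'⟩ g₁') (vexp v g₁) x
  have hc₂ : ∀ x, ContinuousOn (fun t => d₂ t x) (Ici 0) := fun x =>
    (innerSL ℂ w).continuous.comp_continuousOn
      (((hB g).continuousOn h1 x).clm_apply continuousOn_const)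
  have hi : ∀ {d : ℝ → V →ₗ[ℂ] ℂ}, (∀ x, ContinuousOn (fun t => d t x) (Ici 0)) →
      ∀ t, 0 ≤ t → ∀ x, IntervalIntegrable
        (fun s => d s (coeff φ (hat ((g' : ℝ → 𝔨) s)) (hatStep g s) x)) volume 0 t := by
    intro d hd t ht x
    have h := intervalIntegrable_simpleFunc_comp q
      (Z := fun ζ s => d s (coeff φ ζ.1 ζ.2 x)) ht fun ζ => (hd _).mono fun s hs => hs.1
    simpa only [hq] using h
  have e₁ : ∀ t, 0 ≤ t → ∀ x, d₁ t x - ⟪v', (κ x : 𝔥 →L[ℂ] 𝔥') v⟫_ℂ * ⟪expStep g₁', expStep g₁⟫_ℂ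
      = ∫ s in (0 : ℝ)..t, d₁ s (coeff φ (hat ((g' : ℝ → 𝔨) s)) (hatStep g s) x) := fun t ht x =>
    hk.equation ⟨v', hv'⟩ g₁' v g₁ x t ht
  have e₂ : ∀ t, 0 ≤ t → ∀ x, d₂ t x - ⟪v', (κ x : 𝔥 →L[ℂ] 𝔥') v⟫_ℂ * ⟪expStep g₁', expStep g₁⟫_ℂ
      = ∫ s in (0 : ℝ)..t, d₂ s (coeff φ (hat ((g' : ℝ → 𝔨) s)) (hatStep g s) x) := by
    intro t ht x
    have h := hw g t ht x v v' g'
    rw [LinearMap.sub_apply, sub_apply, inner_sub_right, initialColumn_apply, inner_tm] at h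
    exact h
  have h0 := eq_zero_of_volterra (d := fun t => d₁ t - d₂ t) hM hΨ (fun t ht => ?_)
    (fun x => (hc₁ x).sub (hc₂ x)) (fun t ht x => ?_) ht x
  · exact sub_eq_zero.1 h0
  · obtain ⟨C, hC⟩ := hb (vexp ⟨v', hv'⟩ g₁') (vexp v g₁) t ht
    obtain ⟨C', hC', h'⟩ := (hB g).bound t
    refine ⟨C + ‖w‖ * (C' * ‖(v : 𝔥)‖), fun x => ?_⟩
    rw [add_mul]
    refine (norm_sub_le _ _).trans (add_le_add (hC x) ?_)
    refine (norm_inner_le_norm w _).trans ?_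
    refine (mul_le_mul_of_nonneg_left ((h' t ⟨ht, le_rfl⟩).norm_apply_le h1 x v)
      (norm_nonneg w)).trans (le_of_eq ?_)
    ring
  · simp only [LinearMap.sub_apply]
    rw [intervalIntegral.integral_sub (hi hc₁ t ht x) (hi hc₂ t ht x), ← e₁ t ht, ← e₂ t ht]
    ring

end Uniqueness

theorem hasLevelBound_of_coe {V : Type*} {W : Type*} [AddCommGroup V] [Module ℂ V] [MatrixNorm V]
    [AddCommGroup W] [Module ℂ W] [MatrixNorm W] {P : Submodule ℂ W} {S : Set ℕ}
    {c : V →ₗ[ℂ] P} {F : V →ₗ[ℂ] W} {C : ℝ} (e : ∀ x, (c x : W) = F x)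
    (h : HasLevelBound S F C) : HasLevelBound S c C := by
  intro n hn X
  have e' : (X.map c).map (fun y : P => (y : W)) = X.map F := by
    ext i j
    exact e _
  change mnorm ((X.map c).map fun y : P => (y : W)) ≤ _
  rw [e']
  exact h n hn X

end QS

end

/-! ### The existence and uniqueness theorem -/

open QS in
theorem mainTheorem1
    {𝔨 : Type*} [NormedAddCommGroup 𝔨] [InnerProductSpace ℂ 𝔨] [CompleteSpace 𝔨]
    {𝔥 : Type*} [NormedAddCommGroup 𝔥] [InnerProductSpace ℂ 𝔥] [CompleteSpace 𝔥]
    {𝔥' : Type*} [NormedAddCommGroup 𝔥'] [InnerProductSpace ℂ 𝔥'] [CompleteSpace 𝔥']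
    {V : Type*} [NormedAddCommGroup V] [NormedSpace ℂ V] [CompleteSpace V] [OperatorSpace V]
    (Y : Submodule ℂ (𝔥 →L[ℂ] 𝔥')) (hY : IsClosed (Y : Set (𝔥 →L[ℂ] 𝔥')))
    (D : Submodule ℂ 𝔨) (hD : Dense (D : Set 𝔨))
    (φ : dhat D →ₗ[ℂ] V →ₗ[ℂ] CBMap (StrongDual ℂ (Khat 𝔨)) V)
    (hφ : ∀ ζ : dhat D, IsKBounded 𝔨 (φ ζ))
    (κ : V →ₗ[ℂ] Y) (hκ : IsKBounded 𝔨 κ) :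
    ∃ k : ℝ → V →ₗ[ℂ] Op (⊤ : Submodule ℂ 𝔥) D 𝔥',
      -- `k` is a strong solution
      IsStrongSolution φ κ k ∧
      -- with slices in `Y`
      (∀ t : ℝ, 0 ≤ t → ∀ (x : V) (ε' : exps (⊤ : Submodule ℂ 𝔨)) (ε : exps D),
        ∃ y ∈ Y, ∀ u : (⊤ : Submodule ℂ 𝔥), slice (ε' : Fock 𝔨) ε (k t x) u = y u) ∧
      -- it is the sum of the iterated quantum stochastic integrals
      (∃ I : ℕ → ℝ → V →ₗ[ℂ] Op (⊤ : Submodule ℂ 𝔥) D 𝔥', IsIteratedIntegral φ κ I ∧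
        ∀ t : ℝ, 0 ≤ t → ∀ (x : V) (ξ : expDom (⊤ : Submodule ℂ 𝔥) D),
          HasSum (fun n => I n t x ξ) (k t x ξ)) ∧
      -- `col t ε` is the column `k_{t,|ε⟩}`
      (∃ col : ℝ → exps D → V →ₗ[ℂ] colSpace Y (Fock 𝔨),
        (∀ t : ℝ, 0 ≤ t → ∀ (ε : exps D) (x : V) (u : (⊤ : Submodule ℂ 𝔥)),
          (col t ε x : 𝔥 →L[ℂ] HT 𝔥' (Fock 𝔨)) u = k t x (algKet ε u)) ∧
        -- (a)
        (∀ t : ℝ, 0 ≤ t → ∀ ε : exps D, IsKBounded 𝔨 (col t ε)) ∧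
        -- (b)
        (∀ (ε : exps D) (T : ℝ), ∃ C : ℝ, ∀ s ∈ Set.Icc 0 T, ∀ t ∈ Set.Icc 0 T,
          HasKBound 𝔨 (col t ε - col s ε) (C * |t - s| ^ (1 / 2 : ℝ))) ∧
        -- (d)
        ((∀ ζ : dhat D, IsCB (φ ζ)) → IsCB κ →
          (∀ t : ℝ, 0 ≤ t → ∀ ε : exps D, IsCB (col t ε)) ∧
          (∀ (ε : exps D) (T : ℝ), ∃ C : ℝ, ∀ s ∈ Set.Icc 0 T, ∀ t ∈ Set.Icc 0 T,
            HasCBBound (col t ε - col s ε) (C * |t - s| ^ (1 / 2 : ℝ))))) ∧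
      -- (c)
      (∀ (E₁ : Submodule ℂ 𝔥) (D₁ : Submodule ℂ 𝔨) (E₁' : Submodule ℂ 𝔥') (D₁' : Submodule ℂ 𝔨)
        (_ : Dense (E₁ : Set 𝔥)) (_ : Dense (D₁ : Set 𝔨)) (_ : Dense (E₁' : Set 𝔥'))
        (_ : Dense (D₁' : Set 𝔨)) (hDD : D₁ ≤ D)
        (k₁ : ℝ → V →ₗ[ℂ] Op E₁ D₁ 𝔥'),
        IsWeakSolution E₁' D₁' (φ ∘ₗ Submodule.inclusion (dhat_mono hDD)) κ k₁ →
        (∀ (ξ' : expDom E₁' D₁') (ξ : expDom E₁ D₁) (t : ℝ), 0 ≤ t →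
          ∃ C : ℝ, ∀ x : V, ‖inner ℂ (ξ' : HT 𝔥' (Fock 𝔨)) (k₁ t x ξ)‖ ≤ C * ‖x‖) →
        ∀ t : ℝ, 0 ≤ t → ∀ (x : V) (ξ : expDom E₁ D₁),
          k₁ t x ξ = k t x (Submodule.inclusion (expDom_mono le_top hDD) ξ)) := by
  have h1 : 1 ∈ kLevels 𝔨 := one_mem_kLevels 𝔨
  have hφl : ∀ ζ, Liftable (kLevels 𝔨) (φ ζ) 𝔥 (HT 𝔥' (Fock 𝔨)) := fun ζ => liftable_kLevels (hφ ζ)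
  obtain ⟨C₀, hC₀⟩ := hκ
  have hC₀' : HasLevelBound (kLevels 𝔨) κ C₀ := hasLevelBound_kLevels_iff.2 hC₀
  obtain ⟨A, hA0, had, hw⟩ := exists_iterates (φ := φ) h1 hφl (famAdapted_initialColumn (D := D) κ)
    fun g => regular_of_const (by positivity) (hasLevelBound_initialColumn hC₀' (expStep g))
  have hF : ∀ g t, A 0 g t = initialColumn κ (expStep g) := fun g t => by rw [hA0]
  have hsum : ∀ (g : step D) (T : ℝ), ∃ β : ℕ → ℝ, Summable β ∧ (∀ n, 0 ≤ β n) ∧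
      (∀ n, ∀ t ∈ Set.Icc 0 T, HasLevelBound (kLevels 𝔨) (A n g t) (β n)) := fun g T => by
    obtain ⟨β, h, h', h'', _⟩ := exists_summable_bound h1 hφl had hw g (hF g) (by positivity)
      (hasLevelBound_initialColumn hC₀' (expStep g)) T
    exact ⟨β, h, h', h''⟩
  obtain ⟨B, hB⟩ := exists_sum h1 hsum
  -- Stated for arbitrary levels because the family B is built once. It is then regular at the
  -- levels of 𝔨-boundedness and, under the hypotheses of (d), at all levels.
  have hreg : ∀ {S : Set ℕ} {C : ℝ}, 1 ∈ S → (∀ ζ, Liftable S (φ ζ) 𝔥 (HT 𝔥' (Fock 𝔨))) →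
      HasLevelBound S κ C → ∀ g, Regular S (B g) := by
    intro S C hS hl hC g
    choose β h h' hb hh using exists_summable_bound hS hl had hw g (hF g) (by positivity)
      (hasLevelBound_initialColumn hC (expStep g))
    exact regular_sum h h' g hb hh hB
  have hregA : ∀ n g, Regular (kLevels 𝔨) (A n g) := fun n g =>
    regular_iterate h1 hφl had hw g (by
      rw [show A 0 g = fun _ => initialColumn κ (expStep g) from funext (hF g)]
      exact regular_of_const (by positivity) (hasLevelBound_initialColumn hC₀' (expStep g))) n
  have hregB := hreg h1 hφl hC₀'
  have hadB : FamAdapted B := famAdapted_sum had hB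
  have hwB : WeakEq φ B fun g t => B g t - initialColumn κ (expStep g) := by
    have h := weakEq_sum h1 hφl hregA hw hsum hB
    simpa only [hF] using h
  -- Closedness of Y carries the membership through each time integral, by induction on n, and
  -- afterwards through the series.
  have hAY : ∀ n g t, 0 ≤ t → ∀ x, A n g t x ∈ colSpace Y (Fock 𝔨) := by
    intro n
    induction n with
    | zero => exact fun g t _ x => hF g t ▸ initialColumn_mem_colSpace κ (expStep g) x
    | succ n ih => exact fun g t ht x => (hw n).mem_colSpace hY h1 g (hregA n g) (ih g) ht x
  have hBY : ∀ t, 0 ≤ t → ∀ (ε : exps D) x,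
      extendCol (fun g => B g t) ε x ∈ colSpace Y (Fock 𝔨) := fun t ht ε x =>
    extendCol_mem (fun g => colSpace_sum hY hAY hB g ht x) ε
  refine ⟨fun t => opOf fun g => B g t, ⟨fun x => isProcess_opOf hadB fun g =>
    (hregB g).continuousOn h1 x, _, isIntegralAgainst_opOf h1 hφl hadB hregB hwB,
    fun t ht x v g => ?_⟩, fun t ht x ε' ε => ?_, ⟨fun n t => opOf fun g => A n g t,
    ⟨fun t ht x v g => ?_, fun n => ⟨fun x => isProcess_opOf (had n) fun g =>
      (hregA n g).continuousOn h1 x, isIntegralAgainst_opOf h1 hφl (had n) (hregA n) (hw n)⟩⟩,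
    fun t ht x ξ => ?_⟩, ?_, ?_⟩
  · rw [opOf_vexp, opOf_vexp, LinearMap.sub_apply, sub_apply, initialColumn_apply]
    abel
  · refine ⟨bra (ε' : Fock 𝔨) ∘L extendCol (fun g => B g t) ε x, hBY t ht ε x _, fun u => ?_⟩
    change bra (ε' : Fock 𝔨) (opOf (fun g => B g t) x (algKet ε u)) = _
    rw [opOf_algKet]
    rfl
  · rw [opOf_vexp, hF]
    rfl
  · refine expDom_induction (p := fun ξ => HasSum (fun n => opOf (fun g => A n g t) x ξ)
      (opOf (fun g => B g t) x ξ)) ?_ (fun u g => ?_) (fun ξ ξ' h h' => ?_) ξ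
    · simpa only [map_zero] using hasSum_zero
    · simp only [opOf_vexp]
      exact hasSum_column_apply hB g ht x u
    · simp only [map_add]
      exact h.add h'
  -- Columns need to lie in the column space only for t ≥ 0. At negative times zero is chosen.
  · have hcol : ∀ (t : ℝ) (ε : exps D), ∃ c : V →ₗ[ℂ] colSpace Y (Fock 𝔨), 0 ≤ t →
        ∀ x, (c x : 𝔥 →L[ℂ] HT 𝔥' (Fock 𝔨)) = extendCol (fun g => B g t) ε x := by
      intro t ε
      by_cases ht : 0 ≤ t
      · exact ⟨LinearMap.codRestrict _ (extendCol (fun g => B g t) ε) (hBY t ht ε), fun _ _ => rfl⟩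
      · exact ⟨0, fun h => absurd h ht⟩
    choose col hcol using hcol
    have hbd : ∀ {S : Set ℕ}, (∀ g, Regular S (B g)) → ∀ t : ℝ, 0 ≤ t → ∀ ε,
        ∃ C, HasLevelBound S (col t ε) C := by
      intro S hS t ht ε
      obtain ⟨C, hC⟩ := exists_bound_extendCol hS ε ht
      exact ⟨C, hasLevelBound_of_coe (hcol t ε ht) hC⟩
    have hho : ∀ {S : Set ℕ}, (∀ g, Regular S (B g)) → ∀ (ε : exps D) (T : ℝ), ∃ C : ℝ,
        ∀ s ∈ Set.Icc 0 T, ∀ t ∈ Set.Icc 0 T,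
          HasLevelBound S (col t ε - col s ε) (C * |t - s| ^ (1 / 2 : ℝ)) := by
      intro S hS ε T
      obtain ⟨C, hC⟩ := exists_holder_extendCol hS ε T
      refine ⟨C, fun s hs t ht => hasLevelBound_of_coe (fun x => ?_) (hC s hs t ht)⟩
      rw [LinearMap.sub_apply, LinearMap.sub_apply, Submodule.coe_sub, hcol t ε ht.1,
        hcol s ε hs.1]
    refine ⟨col, fun t ht ε x u => ?_, fun t ht ε => ?_, fun ε T => ?_, fun hφ' hκ' => ?_⟩
    · rw [hcol t ε ht, opOf_algKet]
    · obtain ⟨C, hC⟩ := hbd hregB t ht ε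
      exact ⟨C, hasLevelBound_kLevels_iff.1 hC⟩
    · obtain ⟨C, hC⟩ := hho hregB ε T
      exact ⟨C, fun s hs t ht => hasLevelBound_kLevels_iff.1 (hC s hs t ht)⟩
    -- The columns are those of (a) and (b). Only the set of levels at which B is known to be
    -- regular is enlarged.
    · obtain ⟨C₁, hC₁⟩ := hκ'
      have hregU := hreg (Set.mem_univ 1) (fun ζ => liftable_of_isCB (hφ' ζ))
        (hasLevelBound_univ_iff.2 hC₁)
      refine ⟨fun t ht ε => ?_, fun ε T => ?_⟩
      · obtain ⟨C, hC⟩ := hbd hregU t ht ε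
        exact ⟨C, hasLevelBound_univ_iff.1 hC⟩
      · obtain ⟨C, hC⟩ := hho hregU ε T
        exact ⟨C, fun s hs t ht => hasLevelBound_univ_iff.1 (hC s hs t ht)⟩
  · intro E₁ D₁ E₁' D₁' _ _ hE' hD' hDD k₁ hk hb t ht x ξ
    refine LinearMap.congr_fun (f := k₁ t x) (g := opOf (fun g => B g t) x ∘ₗ
      Submodule.inclusion (expDom_mono le_top hDD)) (expDom_ext fun v g => ?_) ξ
    rw [eq_of_isWeakSolution h1 (fun ζ => (hφ ζ).exists_hasBound) hregB hwB hE' hD' hDD hk hb ht]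
    exact (opOf_vexp (fun g => B g t) x ⟨g, step_mono hDD g.2⟩ ⟨v, trivial⟩).symm
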